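/- Let $\Sigma$ be a compact orientable surface with a fixed orientation, and let $n\ge 1$. Let $K_{2,n}$ have bipartition $\{b,r\}$, $[n]=\{1,\dots,n\}$; for $i\in[n]$ the \emph{blue} edge $b_i$ joins $b$ to $i$ and is directed from $b$ to $i$, and the \emph{red} edge $r_i$ joins $r$ to $i$ and is directed from $r$ to $i$. A \emph{simple drawing} of $K_{2,n}$ in $\Sigma$ represents vertices by distinct points and edges by Jordan arcs joining their end vertices, such that no edge contains a vertex other than its ends, and any two edges are either disjoint or have exactly one common point, which is either a common end vertex or a crossing (not a tangency). A crossing of $b_i$ with $r_j$ ($i\neq j$) is \emph{positive} if $r_j$ crosses $b_i$ from the left-hand side of $b_i$, and \emph{negative} otherwise. For $\ell\in\{0,1,2\}$, an \emph{$\ell$-drawing} of $K_{2,n}$ in $\Sigma$ is a simple drawing in which the edges leave $b$ in the clockwise cyclic order $b_n,\dots,b_2,b_1$, leave $r$ in the clockwise cyclic order $r_1,r_2,\dots,r_n$, and in which, for all distinct $i,j\in[n]$, the $4$-cycle formed by $b_i,b_j,r_j,r_i$ has exactly $\ell$ self-crossings. (The definitions are used also for $K_{2,0}$, which has no edges.)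 In a $2$-drawing of $K_{2,n}$ each $r_i$ crosses every $b_j$ with $j\neq i$ exactly once. The \emph{crossing sequence} of $r_i$ is the sequence of the indices $j$ in the order in which $r_i$, traversed from $r$ to $i$, crosses the edges $b_j$; the crossing sequence of $b_i$ is the sequence of the indices $j$ in the order in which $b_i$, traversed from $b$ to $i$, crosses the edges $r_j$. A $2$-drawing $D_n$ of $K_{2,n}$ is - \emph{ahead first} if for every $i$, in the crossing sequence of $r_i$ the indices $i+1,\dots,n$ appear first (in some order), followed by $1,\dots,i-1$ (in some order); - \emph{ahead increasing} (respectively \emph{behind increasing}) if for every $i$, in the crossing sequence of $r_i$ the indices $i+1,\dots,n$ (respectively $1,\dots,i-1$) appear in increasing order; - \emph{ahead negative} (respectively \emph{behind negative}) if for every $i$, all crossings of $r_i$ with $b_{i+1},\dots,b_n$ (respectively with $b_1,\dots,b_{i-1}$) are negative; - \emph{$b_n$-increasing} (respectively \emph{$b_1$-increasing}) if the crossing sequence of $b_n$ is $1,2,\dots,n-1$ (respectively the crossing sequence of $b_1$ is $2,3,\dots,n$). \textbf{Claim.} Let $D_n$ be a $2$-drawing of $K_{2,n}$ in $\Sigma$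 that is ahead first and, in addition, is either (i) ahead increasing, ahead negative, and $b_n$-increasing; or (ii) behind increasing, behind negative, and $b_1$-increasing. Then there exists a $1$-drawing of $K_{2,n-1}$ in $\Sigma$. -/

import Mathlib

open Filter Topology unitInterval

/-- A local homeomorphism `f` of the plane is orientation preserving at `z` if the image under `f`
of every small counterclockwise circle around `z` winds exactly once, counterclockwise, around
`f z`. The winding number is read off from a continuous logarithm `L` of the loop. -/
def OrientationPreservingAt (f : ℂ → ℂ) (z : ℂ) : Prop :=
  ∀ᶠ ε : ℝ in 𝓝[>] 0, ∃ L : ℝ → ℂ, Continuous L ∧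
    (∀ t : ℝ, f (z + ε * Complex.exp (t * Complex.I)) - f z = Complex.exp (L t)) ∧
    L (2 * Real.pi) = L 0 + 2 * Real.pi * Complex.I

/-- A partial homeomorphism of the plane is orientation preserving if it is so at every point
of its domain. -/
def OrientationPreserving (f : OpenPartialHomeomorph ℂ ℂ) : Prop :=
  ∀ z ∈ f.source, OrientationPreservingAt f z

/-- The atlas of the surface `S` (a space locally homeomorphic to the plane `ℂ`) is oriented:
all its coordinate changes preserve the orientation of the plane. -/
def IsOrientedAtlas (S : Type*) [TopologicalSpace S] [ChartedSpace ℂ S] : Prop :=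
  ∀ e ∈ atlas ℂ S, ∀ e' ∈ atlas ℂ S, OrientationPreserving (e.symm.trans e')

section Local

variable {S : Type*} [TopologicalSpace S] [ChartedSpace ℂ S]

/-- A topological chart of `S` (not necessarily in the atlas) that is compatible with the
orientation given by the atlas. Such a chart identifies "counterclockwise", "clockwise" and
"left-hand side" in `S` with the usual notions in `ℂ`. -/
def IsOrientedChart (φ : OpenPartialHomeomorph S ℂ) : Prop :=
  ∀ e ∈ atlas ℂ S, OrientationPreserving (e.symm.trans φ)

/-- An oriented chart centred at the point `p`. -/
def IsOrientedChartAt (φ : OpenPartialHomeomorph S ℂ) (p : S) : Prop :=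
  IsOrientedChart φ ∧ p ∈ φ.source ∧ φ p = 0

/-- In the chart `φ`, near the parameter `s₀` the arc `γ` runs on the straight line through `0`
spanned by `u`, in the direction of `u`. If `s₀` is the initial parameter `0`, this says that `γ`
starts along the ray from `0` through `u`. -/
def RunsAlong (φ : OpenPartialHomeomorph S ℂ) (γ : I → S) (s₀ : I) (u : ℂ) : Prop :=
  ∀ᶠ s : I in 𝓝 s₀, ∃ x : ℝ,
    SignType.sign x = SignType.sign ((s : ℝ) - (s₀ : ℝ)) ∧ φ (γ s) = x * u

/-- The arc `γ` is flat at its interior point `γ s₀`: in a suitable chart it is a straight line.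
(By the Schoenflies theorem every arc in a surface has this property.) -/
def IsFlatAt (γ : I → S) (s₀ : I) : Prop :=
  ∃ φ : OpenPartialHomeomorph S ℂ, IsOrientedChartAt φ (γ s₀) ∧ RunsAlong φ γ s₀ 1

/-- A Jordan arc: injective, and flat at its interior points. -/
def IsJordanArc (γ : I → S) : Prop :=
  Function.Injective γ ∧ ∀ s : I, 0 < s → s < 1 → IsFlatAt γ s

/-- The arcs `γ 0, γ 1, …, γ (k-1)`, which all start at `p`, leave `p` in this counterclockwise
cyclic order: in some oriented chart centred at `p` they start along rays whose angles
`θ 0 < θ 1 < ⋯ < θ (k-1)` lie within one turn. -/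
def LeaveCounterclockwise {k : ℕ} (p : S) (γ : Fin k → I → S) : Prop :=
  ∃ φ : OpenPartialHomeomorph S ℂ, IsOrientedChartAt φ p ∧
    ∃ θ : Fin k → ℝ, StrictMono θ ∧ (∀ i j, θ i - θ j < 2 * Real.pi) ∧
      ∀ i, γ i 0 = p ∧ RunsAlong φ (γ i) 0 (Complex.exp (θ i * Complex.I))

/-- The arcs `γ 0, γ 1, …, γ (k-1)`, which all start at `p`, leave `p` in this clockwise
cyclic order. -/
def LeaveClockwise {k : ℕ} (p : S) (γ : Fin k → I → S) : Prop :=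
  ∃ φ : OpenPartialHomeomorph S ℂ, IsOrientedChartAt φ p ∧
    ∃ θ : Fin k → ℝ, StrictAnti θ ∧ (∀ i j, θ i - θ j < 2 * Real.pi) ∧
      ∀ i, γ i 0 = p ∧ RunsAlong φ (γ i) 0 (Complex.exp (θ i * Complex.I))

/-- The (blue) arc `β` and the (red) arc `ρ` have a positive crossing at `β s = ρ t`: in an
oriented chart `β` is the real axis traversed to the right, and `ρ` is the imaginary axis
traversed downwards, so `ρ` comes from the left-hand side of `β`. -/
def IsPositiveCrossing (β ρ : I → S) (s t : I) : Prop :=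
  β s = ρ t ∧ ∃ φ : OpenPartialHomeomorph S ℂ, IsOrientedChartAt φ (β s) ∧
    RunsAlong φ β s 1 ∧ RunsAlong φ ρ t (-Complex.I)

/-- The (blue) arc `β` and the (red) arc `ρ` have a negative crossing at `β s = ρ t`: `ρ` comes
from the right-hand side of `β`. -/
def IsNegativeCrossing (β ρ : I → S) (s t : I) : Prop :=
  β s = ρ t ∧ ∃ φ : OpenPartialHomeomorph S ℂ, IsOrientedChartAt φ (β s) ∧
    RunsAlong φ β s 1 ∧ RunsAlong φ ρ t Complex.I

end Local

/-- A simple drawing in `S` of the complete bipartite graph `K_{2,n}` with bipartition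
`{b, r}`, `{v 0, …, v (n-1)}` (the vertex `v i` carries the label `i + 1`). The blue edge `blue i`
joins `b` to `v i`, the red edge `red i` joins `r` to `v i`, and edges are directed this way. -/
structure SimpleDrawing (n : ℕ) (S : Type*) [TopologicalSpace S] [ChartedSpace ℂ S] where
  /-- the blue vertex -/
  b : S
  /-- the red vertex -/
  r : S
  /-- the other vertices -/
  v : Fin n → S
  b_ne_r : b ≠ r
  b_ne_v : ∀ i, b ≠ v i
  r_ne_v : ∀ i, r ≠ v i
  v_injective : Function.Injective v
  /-- the blue edges -/
  blue : ∀ i, Path b (v i)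
  /-- the red edges -/
  red : ∀ i, Path r (v i)
  blue_arc : ∀ i, IsJordanArc (blue i)
  red_arc : ∀ i, IsJordanArc (red i)
  /-- no edge contains a vertex other than its ends -/
  r_notMem_blue : ∀ i, r ∉ Set.range (blue i)
  b_notMem_red : ∀ i, b ∉ Set.range (red i)
  v_notMem_blue : ∀ i j, i ≠ j → v j ∉ Set.range (blue i)
  v_notMem_red : ∀ i j, i ≠ j → v j ∉ Set.range (red i)
  /-- two adjacent edges have only their common end in common -/
  blue_inter_blue : ∀ i j, i ≠ j → Set.range (blue i) ∩ Set.range (blue j) = {b}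
  red_inter_red : ∀ i j, i ≠ j → Set.range (red i) ∩ Set.range (red j) = {r}
  blue_inter_red_self : ∀ i, Set.range (blue i) ∩ Set.range (red i) = {v i}
  /-- two nonadjacent edges have at most one point in common -/
  blue_inter_red : ∀ i j, i ≠ j → (Set.range (blue i) ∩ Set.range (red j)).Subsingleton
  /-- a common point of two nonadjacent edges is a crossing, not a tangency -/
  crossing : ∀ i j, i ≠ j → ∀ s t : I, blue i s = red j t →
    IsPositiveCrossing (blue i) (red j) s t ∨ IsNegativeCrossing (blue i) (red j) s t

namespace SimpleDrawing

variable {n : ℕ} {S : Type*} [TopologicalSpace S] [ChartedSpace ℂ S]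

/-- The self-crossings of the canonical 4-cycle through `b, v i, r, v j`. Of its six pairs of
edges only two are nonadjacent. -/
def selfCrossings (D : SimpleDrawing n S) (i j : Fin n) : Set S :=
  (Set.range (D.blue i) ∩ Set.range (D.red j)) ∪ (Set.range (D.blue j) ∩ Set.range (D.red i))

/-- An `l`-drawing of `K_{2,n}`: the clockwise rotations are `(n, …, 2, 1)` at `b`,
`(1, 2, …, n)` at `r`, and `(b, r)` at each other vertex, and every canonical 4-cycle has exactly
`l` self-crossings. -/
structure IsLDrawing (D : SimpleDrawing n S) (l : ℕ) : Prop where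
  rotation_b : LeaveCounterclockwise D.b (fun i => (D.blue i : I → S))
  rotation_r : LeaveClockwise D.r (fun i => (D.red i : I → S))
  rotation_v : ∀ i, LeaveClockwise (D.v i) ![((D.blue i).symm : I → S), (D.red i).symm]
  crossings : ∀ i j, i ≠ j → (D.selfCrossings i j).encard = l

/-- Along the red edge `red i`, the crossing with `blue j` comes before the crossing with
`blue k`; that is, `j` comes before `k` in the crossing sequence of `red i`. -/
def RedBefore (D : SimpleDrawing n S) (i j k : Fin n) : Prop :=
  ∃ s t : I, s < t ∧ D.red i s ∈ Set.range (D.blue j) ∧ D.red i t ∈ Set.range (D.blue k)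

/-- Along the blue edge `blue i`, the crossing with `red j` comes before the crossing with
`red k`; that is, `j` comes before `k` in the crossing sequence of `blue i`. -/
def BlueBefore (D : SimpleDrawing n S) (i j k : Fin n) : Prop :=
  ∃ s t : I, s < t ∧ D.blue i s ∈ Set.range (D.red j) ∧ D.blue i t ∈ Set.range (D.red k)

/-- In the crossing sequence of each `red i`, the indices greater than `i` come before those
smaller than `i`. -/
def AheadFirst (D : SimpleDrawing n S) : Prop :=
  ∀ i j k, j < i → i < k → D.RedBefore i k j

/-- In the crossing sequence of each `red i`, the indices greater than `i` appear in increasing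
order. -/
def AheadIncreasing (D : SimpleDrawing n S) : Prop :=
  ∀ i j k, i < j → j < k → D.RedBefore i j k

/-- In the crossing sequence of each `red i`, the indices smaller than `i` appear in increasing
order. -/
def BehindIncreasing (D : SimpleDrawing n S) : Prop :=
  ∀ i j k, j < k → k < i → D.RedBefore i j k

/-- All crossings of `red i` with `blue j`, for `j > i`, are negative. -/
def AheadNegative (D : SimpleDrawing n S) : Prop :=
  ∀ i j, i < j → ∀ s t : I, D.blue j s = D.red i t →
    IsNegativeCrossing (D.blue j) (D.red i) s t

/-- All crossings of `red i` with `blue j`, for `j < i`, are negative. -/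
def BehindNegative (D : SimpleDrawing n S) : Prop :=
  ∀ i j, j < i → ∀ s t : I, D.blue j s = D.red i t →
    IsNegativeCrossing (D.blue j) (D.red i) s t

/-- The crossing sequence of the blue edge `blue m` lists all indices other than `m` in increasing
order. -/
def BlueIncreasingAt (D : SimpleDrawing n S) (m : Fin n) : Prop :=
  ∀ j k, j ≠ m → k ≠ m → j < k → D.BlueBefore m j k

end SimpleDrawing

/-!
Let `m` be the last index (in the first case) or the first index (in the second case). In both cases
every red edge `red i` with `i ≠ m` crosses `blue m` from right to left, after its crossings with
the blue edges of greater index and before those with the blue edges of smaller index; let `p i` be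
this crossing point. Moreover the points `p i` appear in the order of their indices along `blue m`
(`SimpleDrawing.IsSeparating`). Let `c` be the greatest index other than `m`. The part of `red c`
before `p c` crosses no blue edge, so all red edges can be rerouted along it: delete the blue and
the red edge of index `m`, and replace `red i` by an arc which follows `red c` from `r` to `p c`,
then follows `blue m` backwards to `p i`, and from there follows `red i`. The new red edge crosses
exactly the blue edges of smaller index, each of them once, so the new drawing is a 1-drawing. If
the new edges run in parallel, to the left of their guiding arcs (the *spines*), a smaller index
being further left, then they are disjoint and leave `r` in the original order.

The topological work is to make the new edges disjoint flat arcs, without the Schoenflies theorem.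

* Winding numbers, read off from continuous logarithms, show that orientation preserving local
  homeomorphisms are closed under composition and inversion, and that shears and small
  displacements of the plane preserve the orientation. Hence any two oriented charts are compatible
  (`IsOrientedChart.transition`), and charts may be modified by such maps.
* An initial segment of a flat arc is straight in a single oriented chart (`exists_arc_chart`):
  if this is so up to a parameter `t`, a homeomorphism supported in a flat chart at `γ t`
  pushes the arc back along itself, so it is so beyond `t`.
* Orientation preserving coordinate changes which respect the real axis respect its upper side
  (`OrientationPreservingAt.upper_side`), so the left-hand side of an arc does not depend on the
  chart (`eventually_left_side`). Therefore a flat arc can be displaced to its left, as the graph of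
  a small function in a chart along the arc, off any set which does not approach it from the left
  (`exists_displaced_arc`).
* The spines are flat: their right-angled corners are straightened by shears. To the left of a spine
  there are no blue edges and no red tails (`Comb.spine_left`). The spines are displaced one after
  the other, by increasing index, each one avoiding the arcs constructed before
  (`Comb.exists_disjoint_reroutings`).
-/

/-! ### Continuous logarithms and winding numbers -/

/-- A nowhere vanishing function on a simply connected space has a continuous logarithm. -/
theorem exists_continuous_log {A : Type*} [TopologicalSpace A] [SimplyConnectedSpace A]
    [LocallyPathConnectedSpace A] {H : A → ℂ} (hH : Continuous H) (h0 : ∀ p, H p ≠ 0) :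
    ∃ L : A → ℂ, Continuous L ∧ ∀ p, H p = Complex.exp (L p) := by
  obtain ⟨a⟩ : Nonempty A := inferInstance
  obtain ⟨F, ⟨-, hF⟩, -⟩ := Complex.isCoveringMapOn_exp.existsUnique_continuousMap_lifts
    ⟨H, hH⟩ (a₀ := a) (e₀ := Complex.log (H a)) (Complex.exp_log (h0 a)) (fun p => h0 p)
  exact ⟨F, F.continuous, fun p => (congrFun hF p).symm⟩

/-- Two continuous logarithms of the same function differ by a constant. -/
theorem sub_eq_sub_of_exp_eq {A : Type*} [TopologicalSpace A] [PreconnectedSpace A] {f g : A → ℂ}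
    (hf : Continuous f) (hg : Continuous g) (h : ∀ a, Complex.exp (f a) = Complex.exp (g a))
    (a a' : A) : f a - g a = f a' - g a' := by
  refine Complex.isCoveringMap_exp.const_of_comp (g := fun a => f a - g a) (hf.sub hg) ?_ a a'
  intro x y
  simp [Complex.exp_sub, h]

/-- The winding number is invariant under homotopies of loops in the punctured plane. -/
theorem exists_log_of_homotopy {H : ℝ × ℝ → ℂ} (hH : Continuous H) (h0 : ∀ p, H p ≠ 0)
    (hper : ∀ s, H (s, 2 * Real.pi) = H (s, 0)) {L₀ : ℝ → ℂ} (hL₀ : Continuous L₀)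
    (e₀ : ∀ t, H (0, t) = Complex.exp (L₀ t)) :
    ∃ L₁ : ℝ → ℂ, Continuous L₁ ∧ (∀ t, H (1, t) = Complex.exp (L₁ t)) ∧
      L₁ (2 * Real.pi) - L₁ 0 = L₀ (2 * Real.pi) - L₀ 0 := by
  obtain ⟨L, hL, e⟩ := exists_continuous_log hH h0
  refine ⟨fun t => L (1, t), by fun_prop, fun t => e _, ?_⟩
  have h1 := sub_eq_sub_of_exp_eq (f := fun s : ℝ => L (s, 2 * Real.pi)) (g := fun s => L (s, 0))
    (by fun_prop) (by fun_prop) (fun s => by rw [← e, ← e, hper]) 1 0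
  have h2 := sub_eq_sub_of_exp_eq (f := fun t : ℝ => L (0, t)) (g := L₀)
    (by fun_prop) hL₀ (fun s => by rw [← e, e₀]) (2 * Real.pi) 0
  linear_combination h1 + h2

/-! ### Orientation preserving local homeomorphisms of the plane -/

theorem OrientationPreservingAt.congr {f g : ℂ → ℂ} {z : ℂ} (hf : OrientationPreservingAt f z)
    (h : f =ᶠ[𝓝 z] g) : OrientationPreservingAt g z := by
  obtain ⟨δ, hδ, hb⟩ := Metric.eventually_nhds_iff.1 h
  have hε : ∀ᶠ ε : ℝ in 𝓝[>] 0, ε ∈ Set.Ioo 0 δ := Ioo_mem_nhdsGT hδ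
  filter_upwards [hf, hε] with ε ⟨L, hL, e, w⟩ hεδ
  refine ⟨L, hL, fun t => ?_, w⟩
  rw [← e t, hb (y := z) (by simpa using hδ), hb]
  simpa [dist_eq_norm, Complex.norm_exp, abs_of_pos hεδ.1] using hεδ.2

/-- A local homeomorphism which preserves the orientation at `z` preserves the winding number of
every loop in a small punctured neighbourhood of `z`. -/
theorem OrientationPreservingAt.exists_log_comp {f : ℂ → ℂ} {z : ℂ} {U : Set ℂ}
    (hf : OrientationPreservingAt f z) (hU : U ∈ 𝓝 z) (hc : ContinuousOn f U)
    (hi : Set.InjOn f U) :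
    ∃ δ > 0, ∀ (L : ℝ → ℂ) (w : ℤ), Continuous L → (∀ t, ‖Complex.exp (L t)‖ < δ) →
      L (2 * Real.pi) = L 0 + w * (2 * Real.pi * Complex.I) →
      ∃ M : ℝ → ℂ, Continuous M ∧ (∀ t, f (z + Complex.exp (L t)) - f z = Complex.exp (M t)) ∧
        M (2 * Real.pi) = M 0 + w * (2 * Real.pi * Complex.I) := by
  obtain ⟨δ, hδ, hb⟩ := Metric.mem_nhds_iff.1 hU
  refine ⟨δ, hδ, fun L w hL hLδ hLw => ?_⟩
  have hε : ∀ᶠ ε : ℝ in 𝓝[>] 0, ε ∈ Set.Ioo 0 δ := Ioo_mem_nhdsGT hδ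
  obtain ⟨ε, ⟨N, hN, eN, wN⟩, hε0, hεδ⟩ := (hf.and hε).exists
  -- `N t - i t` is periodic, so the `w`-fold circle is mapped to a loop of winding number `w`
  have hperN : ∀ t, N (t + 2 * Real.pi) = N t + 2 * Real.pi * Complex.I := by
    intro t
    have := sub_eq_sub_of_exp_eq (f := fun t => N (t + 2 * Real.pi)) (g := N)
      (by fun_prop) hN (fun t => by
        rw [← eN, ← eN]
        have : Complex.exp (((t + 2 * Real.pi : ℝ) : ℂ) * Complex.I)
            = Complex.exp (t * Complex.I) := by
          rw [← Complex.exp_periodic (t * Complex.I)]; congr 1; push_cast; ring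
        rw [this]) t 0
    simp only [zero_add, wN] at this
    linear_combination this
  have hwN : N (w * (2 * Real.pi)) = N 0 + w * (2 * Real.pi * Complex.I) := by
    have hp : Function.Periodic (fun t : ℝ => N t - t * Complex.I) (2 * Real.pi) := by
      intro t
      simp only [hperN]; push_cast; ring
    have := hp.int_mul w 0
    simp only [zero_add, Complex.ofReal_zero, zero_mul, sub_zero] at this
    rw [← this]; push_cast; ring
  set c : ℝ → ℝ := fun s => max 0 (min s 1) with hcdef
  have hc01 : ∀ s, 0 ≤ c s ∧ c s ≤ 1 := fun s => ⟨le_max_left _ _, by simp [hcdef]⟩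
  have hcc : Continuous c := by fun_prop
  set Λ : ℝ × ℝ → ℂ := fun p =>
    (1 - c p.1) * (Real.log ε + w * p.2 * Complex.I) + c p.1 * L p.2 with hΛ
  have hΛc : Continuous Λ := by fun_prop
  have hΛδ : ∀ p, ‖Complex.exp (Λ p)‖ < δ := by
    intro p
    have h1 : (L p.2).re < Real.log δ := by
      rw [Real.lt_log_iff_exp_lt hδ, ← Complex.norm_exp]; exact hLδ _
    have h2 : Real.log ε < Real.log δ := Real.log_lt_log hε0 hεδ
    rw [Complex.norm_exp, ← Real.lt_log_iff_exp_lt hδ]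
    have h3 : (Λ p).re = (1 - c p.1) * Real.log ε + c p.1 * (L p.2).re := by
      simp [hΛ]
    rw [h3]
    obtain ⟨h4, h5⟩ := hc01 p.1
    rcases h4.eq_or_lt with h6 | h6
    · rw [← h6]; simpa using h2
    · nlinarith
  have hmem : ∀ p, z + Complex.exp (Λ p) ∈ U := fun p => hb (by simpa using hΛδ p)
  have hzU : z ∈ U := mem_of_mem_nhds hU
  obtain ⟨M, hM, eM, wM⟩ := exists_log_of_homotopy
    (H := fun p => f (z + Complex.exp (Λ p)) - f z)
    ((hc.comp_continuous (by fun_prop) hmem).sub continuous_const)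
    (fun p h => by
      have := hi (hmem p) hzU (sub_eq_zero.1 h)
      simp [Complex.exp_ne_zero] at this)
    (fun s => by
      have : Complex.exp (Λ (s, 2 * Real.pi)) = Complex.exp (Λ (s, 0)) := by
        have : Λ (s, 2 * Real.pi) = Λ (s, 0) + w * (2 * Real.pi * Complex.I) := by
          simp only [hΛ, hLw]; push_cast; ring
        rw [this]
        exact (Complex.exp_periodic.int_mul w) _
      simp only [this])
    (L₀ := fun t => N (w * t)) (by fun_prop)
    (fun t => by
      rw [← eN]
      have : Complex.exp (Λ (0, t)) = ε * Complex.exp (((w * t : ℝ) : ℂ) * Complex.I) := by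
        simp only [hΛ, hcdef]
        simp only [zero_le_one, inf_of_le_left, max_self, Complex.ofReal_zero, sub_zero, one_mul,
          zero_mul, add_zero, Complex.exp_add]
        rw [← Complex.ofReal_exp, Real.exp_log hε0]
        push_cast; rfl
      simp only [this])
  refine ⟨M, hM, fun t => ?_, ?_⟩
  · rw [← eM]; simp [hΛ, hcdef]
  · simp only [mul_zero, hwN] at wM
    linear_combination wM

theorem OrientationPreservingAt.comp {f g : ℂ → ℂ} {z : ℂ} {U : Set ℂ}
    (hg : OrientationPreservingAt g (f z)) (hf : OrientationPreservingAt f z)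
    (hU : U ∈ 𝓝 (f z)) (hc : ContinuousOn g U) (hi : Set.InjOn g U) (hfz : ContinuousAt f z) :
    OrientationPreservingAt (g ∘ f) z := by
  obtain ⟨δ, hδ, h⟩ := hg.exists_log_comp hU hc hi
  obtain ⟨δ', hδ', hb⟩ := Metric.continuousAt_iff.1 hfz δ hδ
  have hε : ∀ᶠ ε : ℝ in 𝓝[>] 0, ε ∈ Set.Ioo 0 δ' := Ioo_mem_nhdsGT hδ'
  filter_upwards [hf, hε] with ε ⟨L, hL, e, w⟩ hεδ
  obtain ⟨M, hM, eM, wM⟩ := h L 1 hL (fun t => by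
    rw [← e, ← dist_eq_norm]
    refine hb ?_
    simpa [dist_eq_norm, Complex.norm_exp, abs_of_pos hεδ.1] using hεδ.2) (by simpa using w)
  refine ⟨M, hM, fun t => ?_, by simpa using wM⟩
  rw [← eM, ← e]; simp

theorem OrientationPreservingAt.inverse {f g : ℂ → ℂ} {z : ℂ} {U : Set ℂ}
    (hf : OrientationPreservingAt f z) (hU : U ∈ 𝓝 z) (hc : ContinuousOn f U)
    (hi : Set.InjOn f U) {V : Set ℂ} (hV : V ∈ 𝓝 (f z)) (hgc : ContinuousOn g V)
    (hgf : g (f z) = z) (hfg : ∀ y ∈ V, f (g y) = y) :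
    OrientationPreservingAt g (f z) := by
  obtain ⟨δ, hδ, h⟩ := hf.exists_log_comp hU hc hi
  obtain ⟨δ', hδ', hb⟩ := Metric.continuousAt_iff.1 (hgc.continuousAt hV) δ hδ
  obtain ⟨δ'', hδ'', hbV⟩ := Metric.mem_nhds_iff.1 hV
  have hε : ∀ᶠ ε : ℝ in 𝓝[>] 0, ε ∈ Set.Ioo 0 (min δ' δ'') :=
    Ioo_mem_nhdsGT (lt_min hδ' hδ'')
  filter_upwards [hε] with ε hεδ
  have hdist : ∀ t : ℝ, dist (f z + ε * Complex.exp (t * Complex.I)) (f z) = ε := by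
    intro t
    simp [dist_eq_norm, Complex.norm_exp, abs_of_pos hεδ.1]
  have hmem : ∀ t : ℝ, f z + ε * Complex.exp (t * Complex.I) ∈ V := fun t => hbV (by
    rw [Metric.mem_ball, hdist]; exact hεδ.2.trans_le (min_le_right _ _))
  have hne : ∀ t : ℝ, g (f z + ε * Complex.exp (t * Complex.I)) - z ≠ 0 := by
    intro t h0
    have h1 := hfg _ (hmem t)
    rw [sub_eq_zero.1 h0] at h1
    simp [hεδ.1.ne'] at h1
  obtain ⟨L, hL, e⟩ := exists_continuous_log (A := ℝ)
    (H := fun t : ℝ => g (f z + ε * Complex.exp (t * Complex.I)) - z)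
    ((hgc.comp_continuous (by fun_prop) hmem).sub continuous_const) hne
  -- the loop has some winding number `w`, which `f` preserves; its image is a circle, so `w = 1`
  obtain ⟨w, hw⟩ : ∃ w : ℤ, L (2 * Real.pi) = L 0 + w * (2 * Real.pi * Complex.I) := by
    rw [← Complex.exp_eq_exp_iff_exists_int, ← e, ← e]
    simp [Complex.exp_two_pi_mul_I]
  obtain ⟨M, hM, eM, wM⟩ := h L w hL (fun t => by
    rw [← e, ← dist_eq_norm]
    have := hb (x := f z + ε * Complex.exp (t * Complex.I)) (by
      rw [hdist]; exact hεδ.2.trans_le (min_le_left _ _))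
    rwa [hgf] at this) hw
  have hcirc := sub_eq_sub_of_exp_eq (f := M) (g := fun t : ℝ => Real.log ε + t * Complex.I) hM
    (by fun_prop) (fun t => by
      rw [← eM, ← e, add_sub_cancel, hfg _ (hmem t), Complex.exp_add, ← Complex.ofReal_exp,
        Real.exp_log hεδ.1]; ring) (2 * Real.pi) 0
  have hw1 : (w : ℂ) * (2 * Real.pi * Complex.I) = 2 * Real.pi * Complex.I := by
    rw [wM] at hcirc
    push_cast at hcirc
    linear_combination hcirc
  refine ⟨L, hL, fun t => ?_, by rw [hw, hw1]⟩
  rw [← e, hgf]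

/-- A displacement `w ↦ w + u w` of the plane preserves the orientation if the straight line
homotopy to the identity goes through injective maps. -/
theorem orientationPreservingAt_add {u : ℂ → ℂ} (hu : Continuous u)
    (hi : ∀ s : ℝ, 0 ≤ s → s ≤ 1 → Function.Injective fun w => w + s * u w) (z : ℂ) :
    OrientationPreservingAt (fun w => w + u w) z := by
  filter_upwards [self_mem_nhdsWithin] with ε hε
  have hε0 : (0 : ℝ) < ε := hε
  set c : ℝ → ℝ := fun s => max 0 (min s 1) with hcdef
  have hc01 : ∀ s, 0 ≤ c s ∧ c s ≤ 1 := fun s => ⟨le_max_left _ _, by simp [hcdef]⟩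
  have hcc : Continuous c := by fun_prop
  set q : ℝ → ℂ := fun t => z + ε * Complex.exp (t * Complex.I) with hq
  have hqc : Continuous q := by fun_prop
  obtain ⟨M, hM, eM, wM⟩ := exists_log_of_homotopy
    (H := fun p => (q p.2 + c p.1 * u (q p.2)) - (z + c p.1 * u z)) (by fun_prop)
    (fun p h => by
      have := hi _ (hc01 p.1).1 (hc01 p.1).2 (sub_eq_zero.1 h)
      simp [hq, hε0.ne'] at this)
    (fun s => by simp [hq])
    (L₀ := fun t => Real.log ε + t * Complex.I) (by fun_prop)
    (fun t => by
      rw [Complex.exp_add, ← Complex.ofReal_exp, Real.exp_log hε0]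
      simp [hq, hcdef])
  refine ⟨M, hM, fun t => ?_, ?_⟩
  · rw [← eM]; simp [hq, hcdef]
  · push_cast at wM
    linear_combination wM

theorem orientationPreservingAt_mul_const {c : ℂ} (hc : c ≠ 0) (z : ℂ) :
    OrientationPreservingAt (fun w => w * c) z := by
  filter_upwards [self_mem_nhdsWithin] with ε hε
  have hε0 : (0 : ℝ) < ε := hε
  refine ⟨fun t => Complex.log c + Real.log ε + t * Complex.I, by fun_prop, fun t => ?_, ?_⟩
  · rw [Complex.exp_add, Complex.exp_add, ← Complex.ofReal_exp, Real.exp_log hε0,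
      Complex.exp_log hc]
    ring
  · push_cast; ring

/-! ### Oriented charts -/

theorem OpenPartialHomeomorph.orientationPreservingAt_symm {T : OpenPartialHomeomorph ℂ ℂ} {z : ℂ}
    (hz : z ∈ T.source) (h : OrientationPreservingAt T z) :
    OrientationPreservingAt T.symm (T z) :=
  h.inverse (T.open_source.mem_nhds hz) T.continuousOn T.injOn
    (T.open_target.mem_nhds (T.map_source hz)) T.continuousOn_symm (T.left_inv hz)
    fun _ hy => T.right_inv hy

theorem OpenPartialHomeomorph.orientationPreservingAt_comp {T T' : OpenPartialHomeomorph ℂ ℂ}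
    {z : ℂ} (hz : z ∈ T.source) (hz' : T z ∈ T'.source) (h : OrientationPreservingAt T z)
    (h' : OrientationPreservingAt T' (T z)) : OrientationPreservingAt (T' ∘ T) z :=
  h'.comp h (T'.open_source.mem_nhds hz') T'.continuousOn T'.injOn (T.continuousAt hz)

section Charts

variable {S : Type*} [TopologicalSpace S] [ChartedSpace ℂ S]

/-- The coordinate change between two oriented charts preserves the orientation, even if neither
of them belongs to the atlas. -/
theorem IsOrientedChart.transition {φ ψ : OpenPartialHomeomorph S ℂ} (hφ : IsOrientedChart φ)
    (hψ : IsOrientedChart ψ) {p : S} (hp : p ∈ φ.source) (hp' : p ∈ ψ.source) :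
    OrientationPreservingAt (φ.symm.trans ψ) (φ p) := by
  set e := chartAt ℂ p
  have he : e ∈ atlas ℂ S := chart_mem_atlas ℂ p
  have hpe : p ∈ e.source := mem_chart_source ℂ p
  have h1 := hφ e he (e p) (by simp [hpe, hp])
  have h2 := OpenPartialHomeomorph.orientationPreservingAt_symm (by simp [hpe, hp]) h1
  have h3 := hψ e he (e p) (by simp [hpe, hp'])
  have e1 : (e.symm.trans φ) (e p) = φ p := by simp [hpe]
  have e2 : (e.symm.trans φ).symm (φ p) = e p := by simp [hp]
  rw [e1] at h2
  have h4 := OpenPartialHomeomorph.orientationPreservingAt_comp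
    (T := (e.symm.trans φ).symm) (T' := e.symm.trans ψ) (z := φ p)
    (by simp [hp, hpe]) (by rw [e2]; simp [hpe, hp']) h2 (by rwa [e2])
  refine h4.congr ?_
  have : φ.symm ⁻¹' e.source ∈ 𝓝 (φ p) := by
    refine (φ.continuousAt_symm (φ.map_source hp)).preimage_mem_nhds ?_
    rw [φ.left_inv hp]; exact e.open_source.mem_nhds hpe
  filter_upwards [this] with z hz
  simp only [Set.mem_preimage] at hz
  simp [hz]

theorem isOrientedChart_of_transition {χ : OpenPartialHomeomorph S ℂ}
    (h : ∀ p ∈ χ.source, ∃ φ : OpenPartialHomeomorph S ℂ, IsOrientedChart φ ∧ p ∈ φ.source ∧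
      OrientationPreservingAt (φ.symm.trans χ) (φ p)) : IsOrientedChart χ := by
  intro e he z hz
  simp only [OpenPartialHomeomorph.trans_source, OpenPartialHomeomorph.symm_source,
    Set.mem_inter_iff, Set.mem_preimage] at hz
  obtain ⟨φ, hφ, hp, ho⟩ := h _ hz.2
  have h1 := hφ e he z (by simp [hz.1, hp])
  have h4 := OpenPartialHomeomorph.orientationPreservingAt_comp
    (T := e.symm.trans φ) (T' := φ.symm.trans χ) (z := z)
    (by simp [hz.1, hp]) (by simp [hp, hz.2]) h1 ho
  refine h4.congr ?_
  have : e.symm ⁻¹' φ.source ∈ 𝓝 z :=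
    (e.continuousAt_symm hz.1).preimage_mem_nhds (φ.open_source.mem_nhds hp)
  filter_upwards [this] with z hz
  simp only [Set.mem_preimage] at hz
  simp [hz]

theorem IsOrientedChart.transHomeomorph {φ : OpenPartialHomeomorph S ℂ} (hφ : IsOrientedChart φ)
    {g : ℂ ≃ₜ ℂ} (hg : ∀ z, OrientationPreservingAt g z) :
    IsOrientedChart (φ.transHomeomorph g) := by
  refine isOrientedChart_of_transition fun p hp => ⟨φ, hφ, hp, ?_⟩
  have hp : p ∈ φ.source := hp
  refine (hg (φ p)).congr ?_
  filter_upwards [φ.open_target.mem_nhds (φ.map_source hp)] with z hz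
  simp [hz]

end Charts

/-! ### Homeomorphisms of the plane: shears, rotations and pushes -/

/-- The shear `x + i y ↦ x + i (y - f x)`, which flattens the graph of `f`. -/
def shear (f : ℝ → ℝ) (hf : Continuous f) : ℂ ≃ₜ ℂ where
  toFun z := z + (-(f z.re) * Complex.I : ℂ)
  invFun z := z + (f z.re * Complex.I : ℂ)
  left_inv z := by simp
  right_inv z := by simp
  continuous_toFun := by fun_prop
  continuous_invFun := by fun_prop

theorem shear_apply (f : ℝ → ℝ) (hf : Continuous f) (z : ℂ) :
    shear f hf z = z + (-(f z.re) * Complex.I : ℂ) := rfl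

theorem shear_orientationPreservingAt (f : ℝ → ℝ) (hf : Continuous f) (z : ℂ) :
    OrientationPreservingAt (shear f hf) z := by
  refine orientationPreservingAt_add (u := fun z => (-(f z.re) * Complex.I : ℂ)) (by fun_prop)
    (fun s _ _ w w' h => ?_) z
  simp only at h
  have hre : w.re = w'.re := by simpa using congrArg Complex.re h
  rw [hre] at h
  exact add_right_cancel h

/-- Multiplication by a nonzero complex number. -/
noncomputable def mulHomeo (c : ℂ) (hc : c ≠ 0) : ℂ ≃ₜ ℂ := Homeomorph.mulRight₀ c hc

theorem mulHomeo_apply (c : ℂ) (hc : c ≠ 0) (z : ℂ) : mulHomeo c hc z = z * c := rfl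

theorem mulHomeo_orientationPreservingAt (c : ℂ) (hc : c ≠ 0) (z : ℂ) :
    OrientationPreservingAt (mulHomeo c hc) z :=
  orientationPreservingAt_mul_const hc z

/-- The amount by which the push in the disc of radius `ρ` moves the point `z`: half the distance to
the complement of the disc, a function with Lipschitz constant `1 / 2`, so that a displacement by
this amount is a homeomorphism. -/
noncomputable def pushAmount (ρ : ℝ) (z : ℂ) : ℝ := Metric.infDist z (Metric.ball 0 ρ)ᶜ / 2

theorem pushAmount_nonneg (ρ : ℝ) (z : ℂ) : 0 ≤ pushAmount ρ z :=
  div_nonneg Metric.infDist_nonneg (by norm_num)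

theorem pushAmount_eq_zero {ρ : ℝ} {z : ℂ} (hz : z ∉ Metric.ball 0 ρ) : pushAmount ρ z = 0 := by
  have : z ∈ (Metric.ball (0 : ℂ) ρ)ᶜ := hz
  simp [pushAmount, Metric.infDist_zero_of_mem this]

theorem compl_ball_nonempty (ρ : ℝ) : ((Metric.ball (0 : ℂ) ρ)ᶜ).Nonempty :=
  ⟨(|ρ| : ℝ), by simp [le_abs_self]⟩

theorem pushAmount_pos {ρ : ℝ} {z : ℂ} (hz : z ∈ Metric.ball 0 ρ) : 0 < pushAmount ρ z := by
  have := (Metric.isOpen_ball (x := (0 : ℂ)) (ε := ρ)).isClosed_compl.notMem_iff_infDist_pos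
    (compl_ball_nonempty ρ) (x := z)
  have := this.1 (by simpa using hz)
  unfold pushAmount; linarith

theorem abs_pushAmount_sub_le (ρ : ℝ) (z w : ℂ) :
    |pushAmount ρ z - pushAmount ρ w| ≤ ‖z - w‖ / 2 := by
  have h := (Metric.lipschitz_infDist_pt (Metric.ball (0 : ℂ) ρ)ᶜ).dist_le_mul z w
  rw [Real.dist_eq, dist_eq_norm, NNReal.coe_one, one_mul] at h
  rw [pushAmount, pushAmount, ← sub_div, abs_div, abs_two]
  linarith

theorem continuous_pushAmount (ρ : ℝ) : Continuous (pushAmount ρ) :=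
  (Metric.continuous_infDist_pt _).div_const 2

theorem approximatesLinearOn_push (ρ : ℝ) :
    ApproximatesLinearOn (fun z : ℂ => z + (-(pushAmount ρ z) : ℂ))
      ((ContinuousLinearEquiv.refl ℝ ℂ : ℂ ≃L[ℝ] ℂ) : ℂ →L[ℝ] ℂ) Set.univ (1 / 2) := by
  intro z _ w _
  have h := abs_pushAmount_sub_le ρ z w
  have e : z + (-(pushAmount ρ z) : ℂ) - (w + (-(pushAmount ρ w) : ℂ))
      - ((ContinuousLinearEquiv.refl ℝ ℂ : ℂ ≃L[ℝ] ℂ) : ℂ →L[ℝ] ℂ) (z - w)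
      = ((-(pushAmount ρ z - pushAmount ρ w) : ℝ) : ℂ) := by
    simp; ring
  rw [e, Complex.norm_real, Real.norm_eq_abs, abs_neg]
  calc _ ≤ _ := h
    _ = _ := by simp; ring

/-- A homeomorphism of the plane which is the identity off the disc of radius `ρ` around `0`, and
moves all points of that disc to the left. -/
noncomputable def push (ρ : ℝ) : ℂ ≃ₜ ℂ :=
  (approximatesLinearOn_push ρ).toHomeomorph _ (Or.inr (by
    have : ‖(((ContinuousLinearEquiv.refl ℝ ℂ).symm : ℂ ≃L[ℝ] ℂ) : ℂ →L[ℝ] ℂ)‖₊ = 1 := by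
      rw [← NNReal.coe_inj, coe_nnnorm]
      exact ContinuousLinearMap.norm_id
    rw [this, inv_one]
    norm_num))

theorem push_apply (ρ : ℝ) (z : ℂ) : push ρ z = z + (-(pushAmount ρ z) : ℂ) := rfl

theorem push_eq_self {ρ : ℝ} {z : ℂ} (hz : z ∉ Metric.ball 0 ρ) : push ρ z = z := by
  simp [push_apply, pushAmount_eq_zero hz]

theorem push_mem_ball {ρ : ℝ} {z : ℂ} (hz : z ∈ Metric.ball 0 ρ) :
    push ρ z ∈ Metric.ball (0 : ℂ) ρ := by
  by_contra h
  exact h (((push ρ).injective (push_eq_self h)).symm ▸ hz)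

theorem push_ofReal (ρ x : ℝ) : push ρ x = ((x - pushAmount ρ x : ℝ) : ℂ) := by
  simp [push_apply, sub_eq_add_neg]

theorem push_ofReal_mono (ρ : ℝ) {x y : ℝ} (h : x ≤ y) :
    x - pushAmount ρ x ≤ y - pushAmount ρ y := by
  have h1 := abs_pushAmount_sub_le ρ y x
  rw [← Complex.ofReal_sub, Complex.norm_real, Real.norm_eq_abs, abs_of_nonneg (sub_nonneg.2 h)]
    at h1
  have := le_abs_self (pushAmount ρ y - pushAmount ρ x)
  linarith

theorem push_orientationPreservingAt (ρ : ℝ) (z : ℂ) : OrientationPreservingAt (push ρ) z := by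
  refine orientationPreservingAt_add (u := fun z => (-(pushAmount ρ z) : ℂ))
    (by have := continuous_pushAmount ρ; fun_prop) (fun s h0 h1 w w' h => ?_) z
  simp only at h
  have h2 := abs_pushAmount_sub_le ρ w w'
  have h3 : w - w' = ((s * (pushAmount ρ w - pushAmount ρ w') : ℝ) : ℂ) := by
    push_cast; linear_combination h
  have h4 : ‖w - w'‖ = s * |pushAmount ρ w - pushAmount ρ w'| := by
    rw [h3, Complex.norm_real, Real.norm_eq_abs, abs_mul, abs_of_nonneg h0]
  have h5 : ‖w - w'‖ ≤ ‖w - w'‖ / 2 :=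
    calc ‖w - w'‖ ≤ 1 * |pushAmount ρ w - pushAmount ρ w'| := by
          rw [h4]; exact mul_le_mul_of_nonneg_right h1 (abs_nonneg _)
      _ ≤ _ := by rw [one_mul]; exact h2
  have h6 : ‖w - w'‖ = 0 := le_antisymm (by linarith) (norm_nonneg _)
  exact sub_eq_zero.1 (norm_eq_zero.1 h6)

/-! ### Pushing along a chart of the surface -/

section Surface

variable {S : Type*} [TopologicalSpace S]

theorem isClosed_symm_image [T2Space S] {ψ : OpenPartialHomeomorph S ℂ} {K : Set ℂ}
    (hK : IsCompact K) (hKt : K ⊆ ψ.target) : IsClosed (ψ.symm '' K) :=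
  (hK.image_of_continuousOn (ψ.continuousOn_symm.mono hKt)).isClosed

open Classical in
/-- The self-map of `S` which in the chart `ψ` is `k`, and the identity elsewhere. -/
noncomputable def extendById (ψ : OpenPartialHomeomorph S ℂ) (k : ℂ → ℂ) (p : S) : S :=
  if p ∈ ψ.source then ψ.symm (k (ψ p)) else p

theorem extendById_of_mem {ψ : OpenPartialHomeomorph S ℂ} {k : ℂ → ℂ} {p : S}
    (hp : p ∈ ψ.source) : extendById ψ k p = ψ.symm (k (ψ p)) := if_pos hp

theorem extendById_of_notMem {ψ : OpenPartialHomeomorph S ℂ} {k : ℂ → ℂ} {p : S}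
    (hp : p ∉ ψ.source) : extendById ψ k p = p := if_neg hp

theorem extendById_of_fixed {ψ : OpenPartialHomeomorph S ℂ} {k : ℂ → ℂ} {p : S}
    (hp : p ∈ ψ.source → k (ψ p) = ψ p) : extendById ψ k p = p := by
  by_cases h : p ∈ ψ.source
  · rw [extendById_of_mem h, hp h, ψ.left_inv h]
  · exact extendById_of_notMem h

theorem extendById_eventuallyEq [T2Space S] {ψ : OpenPartialHomeomorph S ℂ} {k : ℂ → ℂ}
    {K : Set ℂ} (hK : IsCompact K) (hKt : K ⊆ ψ.target) (hk : ∀ z ∉ K, k z = z) {p : S}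
    (hp : p ∉ ψ.symm '' K) : ∀ᶠ q in 𝓝 p, extendById ψ k q = q := by
  filter_upwards [(isClosed_symm_image hK hKt).isOpen_compl.mem_nhds hp] with q hq
  exact extendById_of_fixed fun hqs => hk _ fun h => hq ⟨_, h, ψ.left_inv hqs⟩

theorem continuous_extendById [T2Space S] {ψ : OpenPartialHomeomorph S ℂ} {k : ℂ → ℂ}
    {K : Set ℂ} (hK : IsCompact K) (hKt : K ⊆ ψ.target) (hk : ∀ z ∉ K, k z = z)
    (hkK : ∀ z ∈ K, k z ∈ K) (hkc : Continuous k) : Continuous (extendById ψ k) := by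
  rw [continuous_iff_continuousAt]
  intro p
  by_cases hp : p ∈ ψ.symm '' K
  · obtain ⟨z, hz, rfl⟩ := hp
    have hs : ψ.symm z ∈ ψ.source := ψ.map_target (hKt hz)
    have h1 : ContinuousAt (fun q => ψ.symm (k (ψ q))) (ψ.symm z) := by
      refine ContinuousAt.comp (g := ψ.symm) (f := fun q => k (ψ q)) (ψ.continuousAt_symm ?_)
        (hkc.continuousAt.comp (ψ.continuousAt hs))
      rw [ψ.right_inv (hKt hz)]
      exact hKt (hkK _ hz)
    refine h1.congr ?_
    filter_upwards [ψ.open_source.mem_nhds hs] with q hq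
    rw [extendById_of_mem hq]
  · exact continuousAt_id.congr
      ((extendById_eventuallyEq hK hKt hk hp).mono fun q hq => hq.symm)

theorem extendById_leftInverse {ψ : OpenPartialHomeomorph S ℂ} {k k' : ℂ → ℂ}
    {K : Set ℂ} (hKt : K ⊆ ψ.target) (hk : ∀ z ∉ K, k z = z)
    (hkK : ∀ z ∈ K, k z ∈ K) (hkk : Function.LeftInverse k' k) :
    Function.LeftInverse (extendById ψ k') (extendById ψ k) := by
  intro p
  by_cases hp : p ∈ ψ.source
  · have ht : k (ψ p) ∈ ψ.target := by
      by_cases h : ψ p ∈ K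
      · exact hKt (hkK _ h)
      · rw [hk _ h]; exact ψ.map_source hp
    rw [extendById_of_mem hp, extendById_of_mem (ψ.map_target ht), ψ.right_inv ht, hkk,
      ψ.left_inv hp]
  · rw [extendById_of_notMem hp, extendById_of_notMem hp]

/-- A homeomorphism of the plane supported in a compact part of the target of a chart, transported
to a homeomorphism of the surface. -/
noncomputable def extendHomeo [T2Space S] (ψ : OpenPartialHomeomorph S ℂ) (k : ℂ ≃ₜ ℂ)
    (K : Set ℂ) (hK : IsCompact K) (hKt : K ⊆ ψ.target) (hk : ∀ z ∉ K, k z = z) : S ≃ₜ S :=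
  have hkK : ∀ z ∈ K, k z ∈ K := fun z hz => by
    by_contra h
    exact h ((k.injective (hk _ h)).symm ▸ hz)
  have hk' : ∀ z ∉ K, k.symm z = z := fun z hz => by rw [k.symm_apply_eq, hk z hz]
  have hkK' : ∀ z ∈ K, k.symm z ∈ K := fun z hz => by
    by_contra h
    have := hk _ h
    rw [k.apply_symm_apply] at this
    exact h (this ▸ hz)
  { toFun := extendById ψ k
    invFun := extendById ψ k.symm
    left_inv := extendById_leftInverse hKt hk hkK k.left_inv
    right_inv := extendById_leftInverse hKt hk' hkK' k.right_inv
    continuous_toFun := continuous_extendById hK hKt hk hkK k.continuous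
    continuous_invFun := continuous_extendById hK hKt hk' hkK' k.symm.continuous }

theorem extendHomeo_apply [T2Space S] {ψ : OpenPartialHomeomorph S ℂ} {k : ℂ ≃ₜ ℂ}
    {K : Set ℂ} (hK : IsCompact K) (hKt : K ⊆ ψ.target) (hk : ∀ z ∉ K, k z = z) (p : S) :
    extendHomeo ψ k K hK hKt hk p = extendById ψ k p := rfl

theorem IsOrientedChart.extendHomeo_trans [T2Space S] [ChartedSpace ℂ S]
    {ψ Φ : OpenPartialHomeomorph S ℂ}
    (hψ : IsOrientedChart ψ) (hΦ : IsOrientedChart Φ) {k : ℂ ≃ₜ ℂ} {K : Set ℂ} (hK : IsCompact K)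
    (hKt : K ⊆ ψ.target) (hk : ∀ z ∉ K, k z = z) (hko : ∀ z, OrientationPreservingAt k z) :
    IsOrientedChart ((extendHomeo ψ k K hK hKt hk).toOpenPartialHomeomorph.trans Φ) := by
  refine isOrientedChart_of_transition fun p hp => ?_
  have hp : extendById ψ k p ∈ Φ.source := by simpa [extendHomeo_apply] using hp
  by_cases hps : p ∈ ψ.source
  · refine ⟨ψ, hψ, hps, ?_⟩
    have hkt : k (ψ p) ∈ ψ.target := by
      by_cases h : ψ p ∈ K
      · by_cases h' : k (ψ p) ∈ K
        · exact hKt h'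
        · exact absurd ((k.injective (hk _ h')).symm ▸ h) h'
      · rw [hk _ h]; exact ψ.map_source hps
    rw [extendById_of_mem hps] at hp
    have h1 := hψ.transition hΦ (ψ.map_target hkt) hp
    rw [ψ.right_inv hkt] at h1
    have h2 := OpenPartialHomeomorph.orientationPreservingAt_comp
      (T := k.toOpenPartialHomeomorph) (z := ψ p) (by simp) (by simp [hkt, hp]) (hko _) h1
    refine h2.congr ?_
    filter_upwards [ψ.open_target.mem_nhds (ψ.map_source hps)] with z hz
    simp [extendHomeo_apply, extendById_of_mem (ψ.map_target hz), ψ.right_inv hz]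
  · rw [extendById_of_notMem hps] at hp
    refine ⟨Φ, hΦ, hp, ?_⟩
    have hid : OrientationPreservingAt (fun w => w * 1) (Φ p) :=
      orientationPreservingAt_mul_const one_ne_zero _
    refine hid.congr ?_
    have hpK : p ∉ ψ.symm '' K := by
      rintro ⟨z, hz, rfl⟩
      exact hps (ψ.map_target (hKt hz))
    have h1 := extendById_eventuallyEq hK hKt hk hpK
    have h2 := (Φ.continuousAt_symm (Φ.map_source hp)).eventually (by rwa [Φ.left_inv hp])
    filter_upwards [h2, Φ.open_target.mem_nhds (Φ.map_source hp)] with z hz hzt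
    simp [extendHomeo_apply, hz, hzt]

end Surface

/-! ### Flat curves -/

section Curves

variable {S : Type*} [TopologicalSpace S]

/-- The variant of `RunsAlong` for curves `γ : ℝ → S` of which only the part over `[0, 1]`
matters. -/
def RunsOn (φ : OpenPartialHomeomorph S ℂ) (γ : ℝ → S) (s₀ : ℝ) (u : ℂ) : Prop :=
  ∀ᶠ s in 𝓝[Set.Icc 0 1] s₀, ∃ x : ℝ,
    SignType.sign x = SignType.sign (s - s₀) ∧ φ (γ s) = x * u

theorem runsAlong_iff_runsOn {φ : OpenPartialHomeomorph S ℂ} {γ : I → S} {γ' : ℝ → S}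
    (h : ∀ s : I, γ' s = γ s) {s₀ : I} {u : ℂ} : RunsAlong φ γ s₀ u ↔ RunsOn φ γ' s₀ u := by
  unfold RunsAlong RunsOn
  rw [nhdsWithin_eq_map_subtype_coe s₀.2, eventually_map]
  simp only [← h]

theorem RunsOn.congr {φ : OpenPartialHomeomorph S ℂ} {γ γ' : ℝ → S} {s₀ : ℝ} {u : ℂ}
    (h : RunsOn φ γ s₀ u) (hγ : ∀ᶠ s in 𝓝[Set.Icc 0 1] s₀, γ s = γ' s) : RunsOn φ γ' s₀ u := by
  filter_upwards [h, hγ] with s hs e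
  rwa [← e]

theorem Icc_mem_nhds_of_Ioo {s : ℝ} (hs : s ∈ Set.Ioo (0 : ℝ) 1) : Set.Icc (0 : ℝ) 1 ∈ 𝓝 s :=
  Icc_mem_nhds hs.1 hs.2

theorem RunsOn.eventually_nhds {φ : OpenPartialHomeomorph S ℂ} {γ : ℝ → S} {s₀ : ℝ} {u : ℂ}
    (h : RunsOn φ γ s₀ u) (hs : s₀ ∈ Set.Ioo (0 : ℝ) 1) :
    ∀ᶠ s in 𝓝 s₀, ∃ x : ℝ, SignType.sign x = SignType.sign (s - s₀) ∧ φ (γ s) = x * u := by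
  unfold RunsOn at h
  rwa [nhdsWithin_eq_nhds.2 (Icc_mem_nhds_of_Ioo hs)] at h

variable [ChartedSpace ℂ S]

/-- The variant of `IsFlatAt` for curves `γ : ℝ → S` of which only the part over `[0, 1]`
matters. -/
def FlatAt (γ : ℝ → S) (s₀ : ℝ) : Prop :=
  ∃ φ : OpenPartialHomeomorph S ℂ, IsOrientedChartAt φ (γ s₀) ∧ RunsOn φ γ s₀ 1

theorem FlatAt.congr {γ γ' : ℝ → S} {s₀ : ℝ} (h : FlatAt γ s₀) (hγ : γ =ᶠ[𝓝 s₀] γ') :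
    FlatAt γ' s₀ := by
  obtain ⟨φ, h1, h2⟩ := h
  exact ⟨φ, hγ.eq_of_nhds ▸ h1, h2.congr (hγ.filter_mono nhdsWithin_le_nhds)⟩

theorem sign_eq_sign_of_lt {x y : ℝ} (h1 : y < 0 → x < 0) (h2 : y = 0 → x = 0)
    (h3 : 0 < y → 0 < x) : SignType.sign x = SignType.sign y := by
  rcases lt_trichotomy y 0 with h | h | h
  · rw [sign_neg h, sign_neg (h1 h)]
  · rw [h, h2 h]
  · rw [sign_pos h, sign_pos (h3 h)]

theorem neg_of_sign_eq {x y : ℝ} (h : SignType.sign x = SignType.sign y) (hy : y < 0) : x < 0 := by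
  rw [sign_neg hy] at h; exact sign_eq_neg_one_iff.1 h

theorem pos_of_sign_eq {x y : ℝ} (h : SignType.sign x = SignType.sign y) (hy : 0 < y) : 0 < x := by
  rw [sign_pos hy] at h; exact sign_eq_one_iff.1 h

/-- A continuous injective real function which takes a larger value at the end than at the
beginning of an interval is strictly increasing there. -/
theorem strictMonoOn_of_injOn {f : ℝ → ℝ} {a b : ℝ} (hab : a ≤ b)
    (hf : ContinuousOn f (Set.Icc a b)) (hi : Set.InjOn f (Set.Icc a b)) {c d : ℝ}
    (hc : c ∈ Set.Icc a b) (hd : d ∈ Set.Icc a b) (hcd : c < d) (h : f c < f d) :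
    StrictMonoOn f (Set.Icc a b) := by
  rcases hf.strictMonoOn_of_injOn_Icc' hab hi with h' | h'
  · exact h'
  · exact absurd (h' hc hd hcd) h.le.not_gt

/-- One step of the construction of a chart along a flat arc: charts along all shorter initial
segments of the arc yield a chart along an initial segment which reaches beyond `γ t`. The segment
is pushed back, in a flat chart at `γ t`, into the domain of one of the given charts. -/
theorem exists_arc_chart_extension [T2Space S] {γ : ℝ → S} (hc : Continuous γ)
    (hi : Set.InjOn γ (Set.Icc 0 1)) {t : ℝ} (ht : t ∈ Set.Ioo (0 : ℝ) 1) (hf : FlatAt γ t)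
    {φ : OpenPartialHomeomorph S ℂ}
    (hP : ∀ a, 0 ≤ a → a < t → ∃ Φ : OpenPartialHomeomorph S ℂ, IsOrientedChart Φ ∧
      (∀ᶠ p in 𝓝 (γ 0), Φ p = φ p) ∧ ∀ s ∈ Set.Icc 0 a, γ s ∈ Φ.source ∧ (Φ (γ s)).im = 0) :
    ∃ b, t < b ∧ ∃ Φ : OpenPartialHomeomorph S ℂ, IsOrientedChart Φ ∧
      (∀ᶠ p in 𝓝 (γ 0), Φ p = φ p) ∧ ∀ s ∈ Set.Icc 0 b, γ s ∈ Φ.source ∧ (Φ (γ s)).im = 0 := by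
  obtain ⟨ψ, ⟨hψ, hψs, hψ0⟩, hrun⟩ := hf
  have hev : ∀ᶠ s in 𝓝 t, (s ∈ Set.Icc (0 : ℝ) 1 ∧ γ s ∈ ψ.source) ∧
      ∃ x : ℝ, SignType.sign x = SignType.sign (s - t) ∧ ψ (γ s) = x := by
    filter_upwards [hrun.eventually_nhds ht, Icc_mem_nhds_of_Ioo ht,
      hc.continuousAt (ψ.open_source.mem_nhds hψs)] with s h1 h2 h3
    exact ⟨⟨h2, h3⟩, by simpa using h1⟩
  obtain ⟨δ, hδ, hb⟩ := Metric.nhds_basis_closedBall.eventually_iff.1 hev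
  rw [Real.closedBall_eq_Icc] at hb
  set x : ℝ → ℝ := fun s => (ψ (γ s)).re with hx
  have hxψ : ∀ s ∈ Set.Icc (t - δ) (t + δ), ψ (γ s) = x s := by
    intro s hs
    obtain ⟨-, y, -, h⟩ := hb hs
    rw [hx]; simp [h]
  have hxsign : ∀ s ∈ Set.Icc (t - δ) (t + δ),
      SignType.sign (x s) = SignType.sign (s - t) := by
    intro s hs
    obtain ⟨-, y, h', h⟩ := hb hs
    rw [hx]; simp [h, h']
  have hxc : ContinuousOn x (Set.Icc (t - δ) (t + δ)) :=
    Complex.continuous_re.comp_continuousOn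
      (ψ.continuousOn.comp hc.continuousOn fun s hs => (hb hs).1.2)
  have hxi : Set.InjOn x (Set.Icc (t - δ) (t + δ)) := by
    intro s hs s' hs' h
    refine hi (hb hs).1.1 (hb hs').1.1 (ψ.injOn (hb hs).1.2 (hb hs').1.2 ?_)
    rw [hxψ s hs, hxψ s' hs', h]
  have hxt : x t = 0 := by simp [hx, hψ0]
  have htm : t ∈ Set.Icc (t - δ) (t + δ) := ⟨by linarith, by linarith⟩
  have hlm : t - δ ∈ Set.Icc (t - δ) (t + δ) := ⟨by linarith, by linarith⟩
  have hrm : t + δ ∈ Set.Icc (t - δ) (t + δ) := ⟨by linarith, by linarith⟩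
  have hxl : x (t - δ) < 0 := neg_of_sign_eq (hxsign _ hlm) (by linarith)
  have hxm : StrictMonoOn x (Set.Icc (t - δ) (t + δ)) :=
    strictMonoOn_of_injOn (by linarith) hxc hxi hlm htm (by linarith) (by rw [hxt]; exact hxl)
  have hδ0 : 0 ≤ t - δ := (hb hlm).1.1.1
  have hδ1 : t + δ ≤ 1 := (hb hrm).1.1.2
  -- a disc in the flat chart which `γ` meets only near the parameter `t`
  set K : Set S := γ '' (Set.Icc 0 (t - δ) ∪ Set.Icc (t + δ) 1) with hK
  have hKc : IsClosed K := ((isCompact_Icc.union isCompact_Icc).image hc).isClosed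
  have htK : γ t ∉ K := by
    rintro ⟨s, hs, h⟩
    have hs01 : s ∈ Set.Icc (0 : ℝ) 1 := by
      rcases hs with hs | hs
      · exact ⟨hs.1, by linarith [hs.2]⟩
      · exact ⟨by linarith [hs.1], hs.2⟩
    have := hi hs01 ⟨ht.1.le, ht.2.le⟩ h
    rcases hs with hs | hs
    · linarith [hs.2]
    · linarith [hs.1]
  have h0t : (0 : ℂ) ∈ ψ.target := hψ0 ▸ ψ.map_source hψs
  have hev2 : ∀ᶠ z in 𝓝 (0 : ℂ), z ∈ ψ.target ∧ ψ.symm z ∉ K := by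
    refine Filter.Eventually.and (ψ.open_target.mem_nhds h0t) ?_
    have : ψ.symm 0 = γ t := by rw [← hψ0, ψ.left_inv hψs]
    exact (ψ.continuousAt_symm h0t).preimage_mem_nhds (hKc.isOpen_compl.mem_nhds (this ▸ htK))
  obtain ⟨ρ, hρ, hρb⟩ := Metric.nhds_basis_closedBall.eventually_iff.1 hev2
  have hKt : Metric.closedBall (0 : ℂ) ρ ⊆ ψ.target := fun z hz => (hρb hz).1
  have hcomp : IsCompact (Metric.closedBall (0 : ℂ) ρ) := isCompact_closedBall _ _
  have hfix : ∀ z ∉ Metric.closedBall (0 : ℂ) ρ, push ρ z = z := fun z hz =>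
    push_eq_self fun h => hz (Metric.ball_subset_closedBall h)
  have hd : 0 < pushAmount ρ 0 := pushAmount_pos (by simpa using hρ)
  -- the end `a` of a shorter segment, not yet further left than the push moves `γ t`
  obtain ⟨a, hat, haδ, hxa1, hxa2⟩ : ∃ a, a < t ∧ t - δ < a ∧ -pushAmount ρ 0 < x a ∧ -ρ < x a := by
    have hxct : ContinuousAt x t := hxc.continuousAt (Icc_mem_nhds (by linarith) (by linarith))
    have h1 : ∀ᶠ s in 𝓝 t, -pushAmount ρ 0 < x s :=
      hxct.eventually (lt_mem_nhds (by rw [hxt]; linarith))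
    have h2 : ∀ᶠ s in 𝓝 t, -ρ < x s :=
      hxct.eventually (lt_mem_nhds (by rw [hxt]; linarith))
    have h3 : ∀ᶠ s in 𝓝 t, t - δ < s := lt_mem_nhds (by linarith)
    obtain ⟨s, hs, h⟩ := (((h1.and (h2.and h3)).filter_mono nhdsWithin_le_nhds).and
      (self_mem_nhdsWithin : Set.Iio t ∈ 𝓝[<] t)).exists
    exact ⟨s, h, hs.2.2, hs.1, hs.2.1⟩
  obtain ⟨b, htb, hbδ, hxb1, hxb2⟩ : ∃ b, t < b ∧ b < t + δ ∧
      x b - pushAmount ρ (x b) < x a ∧ x b < ρ := by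
    have hxct : ContinuousAt x t := hxc.continuousAt (Icc_mem_nhds (by linarith) (by linarith))
    have hpc : Continuous fun y : ℝ => y - pushAmount ρ y := by
      have := continuous_pushAmount ρ
      fun_prop
    have h1 : ∀ᶠ s in 𝓝 t, x s - pushAmount ρ (x s) < x a :=
      (hpc.continuousAt.comp hxct).eventually (gt_mem_nhds (by simp [hxt]; linarith))
    have h2 : ∀ᶠ s in 𝓝 t, x s < ρ :=
      hxct.eventually (gt_mem_nhds (by rw [hxt]; linarith))
    have h3 : ∀ᶠ s in 𝓝 t, s < t + δ := gt_mem_nhds (by linarith)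
    obtain ⟨s, hs, h⟩ := (((h1.and (h2.and h3)).filter_mono nhdsWithin_le_nhds).and
      (self_mem_nhdsWithin : Set.Ioi t ∈ 𝓝[>] t)).exists
    exact ⟨s, h, hs.2.2, hs.1, hs.2.1⟩
  obtain ⟨Φ, hΦ, hΦφ, hΦγ⟩ := hP a (by linarith) hat
  have hKnot : ∀ p ∈ K, p ∈ ψ.source → ψ p ∉ Metric.closedBall (0 : ℂ) ρ := by
    intro p hp hps h
    have := (hρb h).2
    rw [ψ.left_inv hps] at this
    exact this hp
  have hh : ∀ s ∈ Set.Icc 0 b, extendById ψ (push ρ) (γ s) ∈ Φ.source ∧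
      (Φ (extendById ψ (push ρ) (γ s))).im = 0 := by
    intro s hs
    by_cases hsK : γ s ∈ ψ.source ∧ ψ (γ s) ∈ Metric.ball (0 : ℂ) ρ
    · obtain ⟨hss, hsb⟩ := hsK
      have hsK : γ s ∉ K := fun h => hKnot _ h hss (Metric.ball_subset_closedBall hsb)
      have hsl : t - δ < s := by
        by_contra h
        exact hsK ⟨s, Or.inl ⟨hs.1, not_lt.1 h⟩, rfl⟩
      have hsm : s ∈ Set.Icc (t - δ) (t + δ) := ⟨hsl.le, by linarith [hs.2]⟩
      have hbm : b ∈ Set.Icc (t - δ) (t + δ) := ⟨by linarith, hbδ.le⟩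
      set y : ℝ := x s - pushAmount ρ (x s) with hy
      have hky : push ρ (ψ (γ s)) = y := by rw [hxψ s hsm, push_ofReal]
      have hyb : (y : ℂ) ∈ Metric.ball (0 : ℂ) ρ := hky ▸ push_mem_ball hsb
      have hyρ : -ρ < y := by
        rw [mem_ball_zero_iff, Complex.norm_real, Real.norm_eq_abs] at hyb
        exact (abs_lt.1 hyb).1
      have hyx : y ≤ x s := by have := pushAmount_nonneg ρ (x s); linarith
      have hya : y < x a := lt_of_le_of_lt (push_ofReal_mono ρ (hxm.monotoneOn hsm hbm hs.2)) hxb1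
      have hxl' : x (t - δ) < -ρ := by
        have h1 := hKnot (γ (t - δ)) ⟨_, Or.inl ⟨hδ0, le_rfl⟩, rfl⟩ (hb hlm).1.2
        rw [hxψ _ hlm, mem_closedBall_zero_iff, Complex.norm_real, Real.norm_eq_abs,
          abs_of_neg hxl] at h1
        linarith
      obtain ⟨s', hs', hs'y⟩ := intermediate_value_Icc hsl.le
        (hxc.mono (Set.Icc_subset_Icc le_rfl hsm.2)) ⟨by linarith, hyx⟩
      have hs'm : s' ∈ Set.Icc (t - δ) (t + δ) := ⟨hs'.1, hs'.2.trans hsm.2⟩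
      have ham : a ∈ Set.Icc (t - δ) (t + δ) := ⟨haδ.le, by linarith⟩
      have hs'a : s' < a := by
        rw [← hxm.lt_iff_lt hs'm ham, hs'y]; exact hya
      have : extendById ψ (push ρ) (γ s) = γ s' := by
        rw [extendById_of_mem hss, hky, ← hs'y, ← hxψ s' hs'm, ψ.left_inv (hb hs'm).1.2]
      rw [this]
      exact hΦγ s' ⟨by linarith [hs'.1], hs'a.le⟩
    · have hfx : extendById ψ (push ρ) (γ s) = γ s :=
        extendById_of_fixed fun h => push_eq_self fun h' => hsK ⟨h, h'⟩
      rw [hfx]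
      refine hΦγ s ⟨hs.1, ?_⟩
      by_contra h
      push Not at h
      have ham : a ∈ Set.Icc (t - δ) (t + δ) := ⟨haδ.le, by linarith⟩
      have hbm : b ∈ Set.Icc (t - δ) (t + δ) := ⟨by linarith, hbδ.le⟩
      have hsm : s ∈ Set.Icc (t - δ) (t + δ) := ⟨by linarith, by linarith [hs.2]⟩
      refine hsK ⟨(hb hsm).1.2, ?_⟩
      rw [hxψ s hsm, mem_ball_zero_iff, Complex.norm_real, Real.norm_eq_abs, abs_lt]
      have h1 := hxm ham hsm h
      have h2 := hxm.monotoneOn hsm hbm hs.2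
      exact ⟨by linarith, by linarith⟩
  refine ⟨b, htb, (extendHomeo ψ (push ρ) _ hcomp hKt hfix).toOpenPartialHomeomorph.trans Φ,
    hψ.extendHomeo_trans hΦ hcomp hKt hfix (push_orientationPreservingAt ρ), ?_, ?_⟩
  · have h0 : γ 0 ∉ ψ.symm '' Metric.closedBall (0 : ℂ) ρ := by
      rintro ⟨z, hz, h⟩
      exact (hρb hz).2 (h ▸ ⟨0, Or.inl ⟨le_rfl, hδ0⟩, rfl⟩)
    filter_upwards [hΦφ, extendById_eventuallyEq hcomp hKt hfix h0] with p h1 h2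
    simp [extendHomeo_apply, h2, h1]
  · intro s hs
    simpa [extendHomeo_apply] using hh s hs

/-- An initial segment of a flat arc is contained in the domain of an oriented chart in which it is
straight. Near the initial point this chart can be prescribed. -/
theorem exists_arc_chart [T2Space S] {γ : ℝ → S} (hc : Continuous γ)
    (hi : Set.InjOn γ (Set.Icc 0 1)) (hf : ∀ s ∈ Set.Ioo (0 : ℝ) 1, FlatAt γ s)
    {φ : OpenPartialHomeomorph S ℂ} (hφ : IsOrientedChartAt φ (γ 0)) (hr : RunsOn φ γ 0 1)
    {a : ℝ} (ha : a < 1) :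
    ∃ Φ : OpenPartialHomeomorph S ℂ, IsOrientedChart Φ ∧
      (∀ᶠ p in 𝓝 (γ 0), Φ p = φ p) ∧
        ∀ s ∈ Set.Icc 0 a, γ s ∈ Φ.source ∧ (Φ (γ s)).im = 0 := by
  set P : ℝ → Prop := fun b => ∃ Φ : OpenPartialHomeomorph S ℂ, IsOrientedChart Φ ∧
      (∀ᶠ p in 𝓝 (γ 0), Φ p = φ p) ∧
        ∀ s ∈ Set.Icc 0 b, γ s ∈ Φ.source ∧ (Φ (γ s)).im = 0 with hP
  have hmono : ∀ b c, b ≤ c → P c → P b := fun b c hbc ⟨Φ, h1, h2, h3⟩ =>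
    ⟨Φ, h1, h2, fun s hs => h3 s ⟨hs.1, hs.2.trans hbc⟩⟩
  obtain ⟨b₀, hb₀, hPb₀⟩ : ∃ b > 0, P b := by
    have h1 : ∀ᶠ s in 𝓝[Set.Icc 0 1] (0 : ℝ), γ s ∈ φ.source ∧ (φ (γ s)).im = 0 := by
      filter_upwards [hr, nhdsWithin_le_nhds
        (hc.continuousAt (φ.open_source.mem_nhds hφ.2.1))] with s ⟨x, _, h⟩ h'
      exact ⟨h', by simp [h]⟩
    obtain ⟨δ, hδ, hb⟩ := Metric.mem_nhdsWithin_iff.1 h1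
    refine ⟨min (δ / 2) 1, by positivity, φ, hφ.1, by simp, fun s hs => hb ⟨?_, hs.1, ?_⟩⟩
    · rw [Metric.mem_ball, Real.dist_eq, sub_zero, abs_of_nonneg hs.1]
      linarith [hs.2.trans (min_le_left _ _)]
    · exact hs.2.trans (min_le_right _ _)
  change P a
  by_contra hna
  have hlt : ∀ b, P b → b < a := fun b hb => by
    by_contra h
    exact hna (hmono _ _ (not_lt.1 h) hb)
  have hbdd : BddAbove {b | P b} := ⟨a, fun b hb => (hlt b hb).le⟩
  set t := sSup {b | P b} with ht
  have ht0 : 0 < t := hb₀.trans_le (le_csSup hbdd hPb₀)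
  have hta : t ≤ a := csSup_le ⟨b₀, hPb₀⟩ fun b hb => (hlt b hb).le
  have hts : t ∈ Set.Ioo (0 : ℝ) 1 := ⟨ht0, hta.trans_lt ha⟩
  obtain ⟨b, htb, hb⟩ := exists_arc_chart_extension hc hi hts (hf t hts) (φ := φ) fun c _ hct => by
    obtain ⟨d, hd, hcd⟩ := exists_lt_of_lt_csSup ⟨b₀, hPb₀⟩ hct
    exact hmono _ _ hcd.le hd
  exact (le_csSup hbdd (show b ∈ {b | P b} from hb)).not_gt htb

end Curves

/-! ### The left-hand side of a flat arc -/

/-- Near `z₀`, an orientation preserving local homeomorphism which maps the horizontal line through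
`z₀` to a horizontal line, in the same direction, maps the upper side of the line to the upper side.
Indeed the polar angle of the image of a small circle, which is only allowed to be a multiple of `π`
at the two points of the line, increases from `0` to `2π`, so it lies between `0` and `π` over the
upper half of the circle. -/
theorem OrientationPreservingAt.upper_side {τ : ℂ → ℂ} {z₀ : ℂ} (h : OrientationPreservingAt τ z₀)
    (hpos : ∀ᶠ ε : ℝ in 𝓝[>] 0, 0 < (τ (z₀ + ε) - τ z₀).re ∧ (τ (z₀ + ε) - τ z₀).im = 0)
    (him : ∀ᶠ z in 𝓝 z₀, (z - z₀).im ≠ 0 → (τ z - τ z₀).im ≠ 0) :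
    ∀ᶠ z in 𝓝 z₀, 0 < (z - z₀).im → 0 < (τ z - τ z₀).im := by
  obtain ⟨δ₁, hδ₁, h₁⟩ := Metric.eventually_nhds_iff.1 him
  obtain ⟨δ₂, hδ₂, h₂⟩ := mem_nhdsGT_iff_exists_Ioo_subset.1 (h.and hpos)
  have hδ₂ : 0 < δ₂ := hδ₂
  filter_upwards [Metric.ball_mem_nhds z₀ (lt_min hδ₁ hδ₂)] with z hz hzim
  rw [Metric.mem_ball, dist_eq_norm, lt_min_iff] at hz
  set ε : ℝ := ‖z - z₀‖ with hε
  have hz0 : z - z₀ ≠ 0 := fun h0 => by simp [h0] at hzim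
  have hε0 : 0 < ε := norm_pos_iff.2 hz0
  obtain ⟨⟨L, hL, e, w⟩, hp1, hp2⟩ := h₂ ⟨hε0, hz.2⟩
  have hπ := Real.pi_pos
  have e0 : Complex.exp (L 0) = ((τ (z₀ + ε) - τ z₀).re : ℝ) := by
    rw [← e 0]
    apply Complex.ext <;> simp [hp2]
  set r := (τ (z₀ + ε) - τ z₀).re with hr
  set θ : ℝ → ℝ := fun t => (L t - L 0).im with hθ
  have hθc : Continuous θ := by fun_prop
  -- the height of the image point is a positive multiple of the sine of its polar angle
  have him' : ∀ t : ℝ, (τ (z₀ + ε * Complex.exp (t * Complex.I)) - τ z₀).im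
      = r * (Real.exp (L t - L 0).re * Real.sin (θ t)) := by
    intro t
    have e1 : Complex.exp (L t) = (r : ℂ) * Complex.exp (L t - L 0) := by
      rw [← e0, ← Complex.exp_add, add_sub_cancel]
    rw [e t, e1, Complex.im_ofReal_mul, Complex.exp_im]
  have hsin : ∀ t ∈ Set.Ioo 0 (2 * Real.pi), t ≠ Real.pi → Real.sin (θ t) ≠ 0 := by
    intro t ht htπ hs
    have h3 := h₁ (y := z₀ + ε * Complex.exp (t * Complex.I)) (by
      simpa [dist_eq_norm, Complex.norm_exp, abs_of_pos hε0] using hz.1)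
    rw [him' t, hs] at h3
    refine h3 ?_ (by simp)
    have h4 : Real.sin t ≠ 0 := by
      rcases lt_or_gt_of_ne htπ with h5 | h5
      · exact (Real.sin_pos_of_pos_of_lt_pi ht.1 h5).ne'
      · have := Real.sin_pos_of_pos_of_lt_pi (x := t - Real.pi) (by linarith) (by linarith [ht.2])
        rw [Real.sin_sub_pi] at this
        linarith
    simpa [Complex.exp_ofReal_mul_I_im, hε0.ne'] using h4
  have hθ0 : θ 0 = 0 := by simp [hθ]
  have hθ2 : θ (2 * Real.pi) = 2 * Real.pi := by simp [hθ, w]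
  have hθπ : θ Real.pi = Real.pi := by
    obtain ⟨t, ht, htπ⟩ := intermediate_value_Ioo (a := 0) (b := 2 * Real.pi) (by linarith)
      hθc.continuousOn (show Real.pi ∈ Set.Ioo (θ 0) (θ (2 * Real.pi)) by
        rw [hθ0, hθ2]; exact ⟨hπ, by linarith⟩)
    by_cases h5 : t = Real.pi
    · rwa [h5] at htπ
    · exact absurd (by rw [htπ]; simp) (hsin t ht h5)
  have hup : ∀ t ∈ Set.Ioo 0 Real.pi, 0 < Real.sin (θ t) := by
    intro t ht
    refine Real.sin_pos_of_pos_of_lt_pi ?_ ?_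
    · by_contra h5
      obtain ⟨u, hu, hu0⟩ := intermediate_value_Icc ht.2.le hθc.continuousOn
        (show (0 : ℝ) ∈ Set.Icc (θ t) (θ Real.pi) from ⟨not_lt.1 h5, by rw [hθπ]; exact hπ.le⟩)
      by_cases h6 : u = Real.pi
      · rw [h6, hθπ] at hu0; exact hπ.ne' hu0
      · exact hsin u ⟨by linarith [hu.1, ht.1], by linarith [hu.2]⟩ h6 (by simp [hu0])
    · by_contra h5
      obtain ⟨u, hu, hu0⟩ := intermediate_value_Ioc ht.1.le hθc.continuousOn
        (show Real.pi ∈ Set.Ioc (θ 0) (θ t) from ⟨by rw [hθ0]; exact hπ, not_lt.1 h5⟩)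
      exact hsin u ⟨hu.1, by linarith [hu.2, ht.2]⟩ (by linarith [hu.2, ht.2]) (by simp [hu0])
  have harg : (z - z₀).arg ∈ Set.Ioo 0 Real.pi := by
    have h5 := Complex.sin_arg (z - z₀)
    have h6 : 0 < Real.sin (z - z₀).arg := by rw [h5]; positivity
    have h7 := Complex.arg_nonneg_iff.2 hzim.le
    refine ⟨lt_of_le_of_ne h7 fun h8 => ?_, lt_of_le_of_ne (Complex.arg_le_pi _) fun h8 => ?_⟩
    · rw [← h8] at h6; simp at h6
    · rw [h8] at h6; simp at h6
  have hzpol : z = z₀ + ε * Complex.exp ((z - z₀).arg * Complex.I) := by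
    rw [Complex.norm_mul_exp_arg_mul_I]; ring
  rw [hzpol, him']
  have := hup _ harg
  positivity

section Displacement

variable {S : Type*} [TopologicalSpace S] [ChartedSpace ℂ S]

theorem RunsOn.exists_Icc {ψ : OpenPartialHomeomorph S ℂ} {γ : ℝ → S} (hc : Continuous γ) {s : ℝ}
    (hψ : IsOrientedChartAt ψ (γ s)) (hr : RunsOn ψ γ s 1) (hs : s ∈ Set.Ioo (0 : ℝ) 1)
    {U : Set ℝ} (hU : U ∈ 𝓝 s) :
    ∃ δ > 0, ∀ s' ∈ Set.Icc (s - δ) (s + δ), s' ∈ U ∧ γ s' ∈ ψ.source ∧ ∃ x : ℝ,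
      SignType.sign x = SignType.sign (s' - s) ∧ ψ (γ s') = x := by
  have hev : ∀ᶠ s' in 𝓝 s, s' ∈ U ∧ γ s' ∈ ψ.source ∧
      ∃ x : ℝ, SignType.sign x = SignType.sign (s' - s) ∧ ψ (γ s') = x := by
    filter_upwards [hr.eventually_nhds hs, hU,
      hc.continuousAt (ψ.open_source.mem_nhds hψ.2.1)] with s h1 h2 h3
    exact ⟨h2, h3, by simpa using h1⟩
  obtain ⟨δ, hδ, hb⟩ := Metric.nhds_basis_closedBall.eventually_iff.1 hev
  rw [Real.closedBall_eq_Icc] at hb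
  exact ⟨δ, hδ, fun s' hs' => hb hs'⟩

/-- All charts in which an arc is straight agree on what is its left-hand side. -/
theorem eventually_left_side {γ : ℝ → S} (hc : Continuous γ)
    {Φ : OpenPartialHomeomorph S ℂ} (hΦ : IsOrientedChart Φ) {a : ℝ}
    (hΦγ : ∀ s ∈ Set.Icc 0 a, γ s ∈ Φ.source ∧ (Φ (γ s)).im = 0)
    (hmono : StrictMonoOn (fun s => (Φ (γ s)).re) (Set.Icc 0 a)) {s : ℝ}
    (hs : s ∈ Set.Ioo 0 a) (hs1 : s < 1) {ψ : OpenPartialHomeomorph S ℂ}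
    (hψ : IsOrientedChartAt ψ (γ s)) (hr : RunsOn ψ γ s 1) :
    ∀ᶠ p in 𝓝 (γ s), 0 < (Φ p).im → 0 < (ψ p).im := by
  obtain ⟨δ, hδ, hb⟩ := hr.exists_Icc hc hψ ⟨hs.1, hs1⟩ (Icc_mem_nhds hs.1 hs.2)
  have hsI : s ∈ Set.Icc 0 a := ⟨hs.1.le, hs.2.le⟩
  have hsδ : s ∈ Set.Icc (s - δ) (s + δ) := ⟨by linarith, by linarith⟩
  have hlδ : s - δ ∈ Set.Icc (s - δ) (s + δ) := ⟨by linarith, by linarith⟩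
  have hrδ : s + δ ∈ Set.Icc (s - δ) (s + δ) := ⟨by linarith, by linarith⟩
  have hΦs : γ s ∈ Φ.source := (hΦγ s hsI).1
  have hX : ∀ s' ∈ Set.Icc 0 a, Φ (γ s') = ((Φ (γ s')).re : ℝ) := fun s' hs' =>
    Complex.ext (by simp) (by simp [(hΦγ s' hs').2])
  have ho : OrientationPreservingAt (ψ ∘ Φ.symm) (Φ (γ s)) :=
    hΦ.transition hψ.1 hΦs hψ.2.1
  have e0 : (ψ ∘ Φ.symm) (Φ (γ s)) = 0 := by simp [Φ.left_inv hΦs, hψ.2.2]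
  have key := ho.upper_side ?_ ?_
  · have h1 := (Φ.continuousAt hΦs).eventually key
    filter_upwards [h1, Φ.open_source.mem_nhds hΦs] with p hp hps hpim
    have := hp (by rw [Complex.sub_im, (hΦγ s hsI).2, sub_zero]; exact hpim)
    simpa [Φ.left_inv hΦs, hψ.2.2, Φ.left_inv hps] using this
  · have hlt : (Φ (γ s)).re < (Φ (γ (s + δ))).re := hmono hsI (hb _ hrδ).1 (by linarith)
    have hcont : ContinuousOn (fun s => (Φ (γ s)).re) (Set.Icc s (s + δ)) :=
      Complex.continuous_re.comp_continuousOn (Φ.continuousOn.comp hc.continuousOn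
        fun s' hs' => (hΦγ s' (hb s' ⟨by linarith [hs'.1], hs'.2⟩).1).1)
    filter_upwards [Ioo_mem_nhdsGT (sub_pos.2 hlt)] with ε hε
    obtain ⟨s', hs', e⟩ := intermediate_value_Ioo (by linarith : s ≤ s + δ) hcont
      (show (Φ (γ s)).re + ε ∈ Set.Ioo _ _ from ⟨by linarith [hε.1], by linarith [hε.2]⟩)
    obtain ⟨hs'a, hs'ψ, x, hx, hxe⟩ := hb s' ⟨by linarith [hs'.1], hs'.2.le⟩
    have e1 : Φ (γ s) + ε = Φ (γ s') := by
      rw [hX s hsI, hX s' hs'a, ← Complex.ofReal_add, ← e]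
    rw [e0, e1]
    simp only [Function.comp_apply, Φ.left_inv (hΦγ s' hs'a).1, hxe, sub_zero, Complex.ofReal_re,
      Complex.ofReal_im, and_true]
    exact pos_of_sign_eq hx (by linarith [hs'.1])
  · -- near `γ s`, the preimage of the real axis under `ψ` consists of points of `γ`
    have hcont : ContinuousOn (fun s => (ψ (γ s)).re) (Set.Icc (s - δ) (s + δ)) :=
      Complex.continuous_re.comp_continuousOn (ψ.continuousOn.comp hc.continuousOn
        fun s' hs' => (hb s' hs').2.1)
    have hl : (ψ (γ (s - δ))).re < 0 := by
      obtain ⟨-, -, x, hx, hxe⟩ := hb _ hlδ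
      rw [hxe, Complex.ofReal_re]
      exact neg_of_sign_eq hx (by linarith)
    have hr : 0 < (ψ (γ (s + δ))).re := by
      obtain ⟨-, -, x, hx, hxe⟩ := hb _ hrδ
      rw [hxe, Complex.ofReal_re]
      exact pos_of_sign_eq hx (by linarith)
    have hcτ : ContinuousAt (ψ ∘ Φ.symm) (Φ (γ s)) := by
      refine ContinuousAt.comp ?_ (Φ.continuousAt_symm (Φ.map_source hΦs))
      rw [Φ.left_inv hΦs]
      exact ψ.continuousAt hψ.2.1
    have hre : ∀ᶠ z in 𝓝 (Φ (γ s)), ((ψ ∘ Φ.symm) z).re ∈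
        Set.Ioo (ψ (γ (s - δ))).re (ψ (γ (s + δ))).re :=
      (Complex.continuous_re.continuousAt.comp hcτ).eventually
        (Ioo_mem_nhds (by simpa [Φ.left_inv hΦs, hψ.2.2] using hl)
          (by simpa [Φ.left_inv hΦs, hψ.2.2] using hr))
    have hsrc : ∀ᶠ z in 𝓝 (Φ (γ s)), Φ.symm z ∈ ψ.source :=
      (Φ.continuousAt_symm (Φ.map_source hΦs)).eventually
        (by rw [Φ.left_inv hΦs]; exact ψ.open_source.mem_nhds hψ.2.1)
    filter_upwards [hre, hsrc, Φ.open_target.mem_nhds (Φ.map_source hΦs)] with z h1 h2 h3 h4 h5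
    rw [e0, sub_zero] at h5
    obtain ⟨s', hs', e⟩ := intermediate_value_Icc (by linarith : s - δ ≤ s + δ) hcont
      (Set.Ioo_subset_Icc_self h1)
    obtain ⟨hs'a, hs'ψ, x, hx, hxe⟩ := hb s' hs'
    have e2 : ψ (γ s') = ψ (Φ.symm z) := by
      apply Complex.ext
      · exact e
      · simp only [Function.comp_apply] at h5
        rw [h5, hxe, Complex.ofReal_im]
    have e3 := ψ.injOn hs'ψ h2 e2
    have e4 : z = Φ (γ s') := by rw [e3, Φ.right_inv h3]
    refine h4 ?_
    rw [Complex.sub_im, (hΦγ s hsI).2, e4, (hΦγ s' hs'a).2, sub_zero]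

end Displacement

/-! ### Displacing a flat arc to its left -/

section Displacement

variable {S : Type*} [TopologicalSpace S] [ChartedSpace ℂ S]

/-- A curve which in some chart is the graph of a continuous function, traversed from left to right,
is straightened by a shear. -/
theorem exists_chart_of_graph {ρ : ℝ → S} {Φ : OpenPartialHomeomorph S ℂ} (hΦ : IsOrientedChart Φ)
    {f : ℝ → ℝ} (hf : Continuous f) {X : ℝ → ℝ} {s : ℝ} (hs : ρ s ∈ Φ.source)
    (h : ∀ᶠ s' in 𝓝 s, Φ (ρ s') = X s' + f (X s') * Complex.I ∧
      SignType.sign (X s' - X s) = SignType.sign (s' - s)) :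
    ∃ χ : OpenPartialHomeomorph S ℂ, IsOrientedChartAt χ (ρ s) ∧ RunsOn χ ρ s 1 ∧
      ∀ p, (χ p).im = (Φ p).im - f (Φ p).re := by
  set T : ℂ ≃ₜ ℂ := Homeomorph.addRight (-(X s : ℂ)) with hT
  have hTo : ∀ z, OrientationPreservingAt T z := fun z =>
    orientationPreservingAt_add (u := fun _ => -(X s : ℂ)) continuous_const
      (fun _ _ _ => add_left_injective _) z
  have hval : ∀ s', Φ (ρ s') = X s' + f (X s') * Complex.I →
      ((Φ.transHomeomorph (shear f hf)).transHomeomorph T) (ρ s') = ((X s' - X s : ℝ) : ℂ) := by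
    intro s' hs'
    simp [hT, hs', shear_apply, sub_eq_add_neg]
  refine ⟨(Φ.transHomeomorph (shear f hf)).transHomeomorph T, ⟨(hΦ.transHomeomorph
    (shear_orientationPreservingAt f hf)).transHomeomorph hTo, by simpa using hs, ?_⟩, ?_, ?_⟩
  · rw [hval s h.self_of_nhds.1]; simp
  · filter_upwards [h.filter_mono nhdsWithin_le_nhds] with s' hs'
    exact ⟨X s' - X s, hs'.2, by rw [hval s' hs'.1, mul_one]⟩
  · intro p
    simp [hT, shear_apply, sub_eq_add_neg]

/-- A function which is linear near `0`, positive between `0` and `c`, vanishes elsewhere, and whose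
graph between `0` and `c` stays in a given open set. -/
theorem exists_small_graph {V : Set ℂ} (hV : IsOpen V) (hVn : Vᶜ.Nonempty) {c κ : ℝ} (hκ : 0 < κ)
    (hc : 0 < c) (hVc : ∀ x ∈ Set.Ioo 0 c, (x : ℂ) ∈ V)
    (hκV : ∀ᶠ x : ℝ in 𝓝[>] 0, κ * x ≤ Metric.infDist (x : ℂ) Vᶜ) :
    ∃ f : ℝ → ℝ, Continuous f ∧ (∀ x, x ≤ 0 → f x = 0) ∧ (∀ x, c ≤ x → f x = 0) ∧
      (∀ x ∈ Set.Ioo 0 c, 0 < f x ∧ x + f x * Complex.I ∈ V) ∧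
      ∀ᶠ x in 𝓝[>] 0, f x = κ / 2 * x := by
  refine ⟨fun x => max 0 (min (min (κ / 2 * x) (Metric.infDist (x : ℂ) Vᶜ / 2)) (c - x)),
    ?_, ?_, ?_, ?_, ?_⟩
  · have h1 : Continuous fun x : ℝ => Metric.infDist (x : ℂ) Vᶜ :=
      (Metric.continuous_infDist_pt _).comp Complex.continuous_ofReal
    fun_prop
  · intro x hx
    refine max_eq_left ((min_le_left _ _).trans ((min_le_left _ _).trans ?_))
    nlinarith
  · intro x hx
    exact max_eq_left ((min_le_right _ _).trans (by linarith))
  · intro x hx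
    have hpos : 0 < Metric.infDist (x : ℂ) Vᶜ :=
      (hV.isClosed_compl.notMem_iff_infDist_pos hVn).1 (by simpa using hVc x hx)
    set m := min (min (κ / 2 * x) (Metric.infDist (x : ℂ) Vᶜ / 2)) (c - x) with hm
    have hmpos : 0 < m := by
      refine lt_min (lt_min ?_ (by linarith)) (by linarith [hx.2])
      have := hx.1
      positivity
    have hmle : m ≤ Metric.infDist (x : ℂ) Vᶜ / 2 := (min_le_left _ _).trans (min_le_right _ _)
    change 0 < max 0 m ∧ x + ((max 0 m : ℝ) : ℂ) * Complex.I ∈ V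
    rw [max_eq_right hmpos.le]
    refine ⟨hmpos, ?_⟩
    by_contra hnot
    have := Metric.infDist_le_dist_of_mem (x := (x : ℂ)) (show _ ∈ Vᶜ from hnot)
    rw [dist_eq_norm, sub_add_cancel_left, norm_neg, norm_mul, Complex.norm_I, mul_one,
      Complex.norm_real, Real.norm_eq_abs, abs_of_pos hmpos] at this
    linarith
  · have h1 : ∀ᶠ x : ℝ in 𝓝[>] 0, x ∈ Set.Ioo 0 (c / (κ / 2 + 1)) :=
      Ioo_mem_nhdsGT (by positivity)
    filter_upwards [hκV, h1] with x hx hx1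
    have h2 : κ / 2 * x ≤ c - x := by
      have := (lt_div_iff₀ (by positivity)).1 hx1.2
      linarith
    rw [min_eq_left (by linarith : κ / 2 * x ≤ Metric.infDist (x : ℂ) Vᶜ / 2), min_eq_left h2,
      max_eq_right (by have := hx1.1; positivity)]

/-- Let `O` be a set that does not approach the flat arc `γ` from its left-hand side before the
parameter `a`. Then the initial segment of `γ` up to `a` can be displaced to the left, so that it
avoids both `O` and `γ`. Near the initial point, `O` is only required to avoid a sector of slope
`η` to the left of `γ`, and the displaced arc starts along a ray in this sector. -/
theorem exists_displaced_arc [T2Space S] {γ : ℝ → S} (hc : Continuous γ)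
    (hi : Set.InjOn γ (Set.Icc 0 1)) (hf : ∀ s ∈ Set.Ioo (0 : ℝ) 1, FlatAt γ s)
    {φ : OpenPartialHomeomorph S ℂ} (hφ : IsOrientedChartAt φ (γ 0)) (hr : RunsOn φ γ 0 1)
    {a : ℝ} (ha : a ∈ Set.Ioo (0 : ℝ) 1) {O : Set S}
    (hleft : ∀ s ∈ Set.Ioo 0 a, ∃ ψ : OpenPartialHomeomorph S ℂ, IsOrientedChartAt ψ (γ s) ∧
      RunsOn ψ γ s 1 ∧ ∀ᶠ p in 𝓝 (γ s), p ∈ O → (ψ p).im ≤ 0)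
    {η : ℝ} (hη : 0 < η)
    (hsector : ∀ᶠ p in 𝓝 (γ 0), p ∈ O → 0 < (φ p).im → η * (φ p).re ≤ (φ p).im) :
    ∃ (ρ : ℝ → S) (η' : ℝ), 0 < η' ∧ η' < η ∧ Continuous ρ ∧ Set.InjOn ρ (Set.Icc 0 1) ∧
      (∀ s ∈ Set.Ioo (0 : ℝ) 1, FlatAt ρ s) ∧ ρ 0 = γ 0 ∧ (∀ s, a ≤ s → ρ s = γ s) ∧
      RunsOn φ ρ 0 (1 + η' * Complex.I) ∧
      ∀ s ∈ Set.Ioo 0 a, ρ s ∉ O ∧ ∀ s' ∈ Set.Icc (0 : ℝ) 1, ρ s ≠ γ s' := by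
  obtain ⟨ha0, ha1⟩ := ha
  obtain ⟨b, hab, hb1⟩ := exists_between ha1
  obtain ⟨Φ, hΦ, hΦφ, hΦγ⟩ := exists_arc_chart hc hi hf hφ hr hb1
  set X : ℝ → ℝ := fun s => (Φ (γ s)).re with hX
  have hXΦ : ∀ s ∈ Set.Icc 0 b, Φ (γ s) = X s := fun s hs =>
    Complex.ext (by simp [hX]) (by simp [(hΦγ s hs).2])
  have h0b : (0 : ℝ) ∈ Set.Icc 0 b := ⟨le_rfl, by linarith⟩
  have hab' : a ∈ Set.Icc 0 b := ⟨ha0.le, hab.le⟩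
  have hX0 : X 0 = 0 := by simp [hX, hΦφ.self_of_nhds, hφ.2.2]
  have hXc : ContinuousOn X (Set.Icc 0 b) :=
    Complex.continuous_re.comp_continuousOn
      (Φ.continuousOn.comp hc.continuousOn fun s hs => (hΦγ s hs).1)
  have hXi : Set.InjOn X (Set.Icc 0 b) := by
    intro s hs s' hs' h
    refine hi ⟨hs.1, by linarith [hs.2]⟩ ⟨hs'.1, by linarith [hs'.2]⟩
      (Φ.injOn (hΦγ s hs).1 (hΦγ s' hs').1 ?_)
    rw [hXΦ s hs, hXΦ s' hs', h]
  have hXm : StrictMonoOn X (Set.Icc 0 b) := by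
    have h1 : ∀ᶠ s in 𝓝[>] (0 : ℝ), s ∈ Set.Ioo 0 b := Ioo_mem_nhdsGT (by linarith)
    have h2 : ∀ᶠ s in 𝓝[>] (0 : ℝ), ∃ x : ℝ,
        SignType.sign x = SignType.sign (s - 0) ∧ φ (γ s) = x * 1 :=
      nhdsWithin_le_of_mem (mem_of_superset (Ioo_mem_nhdsGT zero_lt_one)
        Set.Ioo_subset_Icc_self) hr
    have h3 : ∀ᶠ s in 𝓝[>] (0 : ℝ), Φ (γ s) = φ (γ s) :=
      nhdsWithin_le_nhds (hc.continuousAt.eventually hΦφ)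
    obtain ⟨s, hs, ⟨x, hx, e⟩, e'⟩ := (h1.and (h2.and h3)).exists
    refine strictMonoOn_of_injOn (by linarith) hXc hXi h0b (Set.Ioo_subset_Icc_self hs) hs.1 ?_
    rw [hX0, hX]
    simp only [e', e, mul_one, Complex.ofReal_re]
    exact pos_of_sign_eq hx (by linarith [hs.1])
  have hXa : 0 < X a := hX0 ▸ hXm h0b hab' ha0
  -- the points of the chart which the displaced arc may use
  set C : Set S := γ '' Set.Icc b 1 with hC
  have hCc : IsClosed C := (isCompact_Icc.image hc).isClosed
  have hγC : ∀ s ∈ Set.Icc 0 b, s < b → γ s ∉ C := by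
    rintro s hs hsb ⟨s', hs', e⟩
    have := hi ⟨by linarith [hs'.1], hs'.2⟩ ⟨hs.1, by linarith⟩ e
    linarith [hs'.1]
  set W : Set ℂ := {z | 0 < z.im → z ∈ Φ.target ∧ Φ.symm z ∉ O ∧ Φ.symm z ∉ γ '' Set.Icc 0 1}
    with hW
  set V : Set ℂ := interior W ∩ {z | 0 < z.re} with hV
  have hVo : IsOpen V := isOpen_interior.inter (isOpen_lt continuous_const Complex.continuous_re)
  have hVn : Vᶜ.Nonempty := ⟨0, fun h => by simpa using h.2⟩
  have hγW : ∀ z ∈ Φ.target, Φ.symm z ∉ C → 0 < z.im → Φ.symm z ∉ γ '' Set.Icc 0 1 := by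
    rintro z hz hzC hzim ⟨s, hs, e⟩
    rcases le_total s b with h | h
    · have := (hΦγ s ⟨hs.1, h⟩).2
      rw [e, Φ.right_inv hz] at this
      exact hzim.ne' this
    · exact hzC ⟨s, ⟨h, hs.2⟩, e⟩
  have hWγ : ∀ s ∈ Set.Ioo 0 a, (X s : ℂ) ∈ interior W := by
    intro s hs
    have hsb : s ∈ Set.Ioo 0 b := ⟨hs.1, hs.2.trans hab⟩
    have hsb' := Set.Ioo_subset_Icc_self hsb
    obtain ⟨ψ, hψ, hψr, hψO⟩ := hleft s hs
    have h1 := eventually_left_side hc hΦ hΦγ hXm hsb (hsb.2.trans hb1) hψ hψr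
    have h2 : ∀ᶠ p in 𝓝 (γ s), p ∉ C := hCc.isOpen_compl.mem_nhds (hγC s hsb' hsb.2)
    have hsrc := (hΦγ s hsb').1
    have h3 := (Φ.continuousAt_symm (Φ.map_source hsrc)).eventually
      (by rw [Φ.left_inv hsrc]; exact h1.and (h2.and hψO))
    rw [hXΦ s hsb'] at h3
    rw [mem_interior_iff_mem_nhds]
    filter_upwards [h3, Φ.open_target.mem_nhds (hXΦ s hsb' ▸ Φ.map_source hsrc)] with z hz hzt hzim
    obtain ⟨h4, h5, h6⟩ := hz
    rw [Φ.right_inv hzt] at h4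
    exact ⟨hzt, fun h7 => (h4 hzim).not_ge (h6 h7), hγW z hzt h5 hzim⟩
  -- with this slope, the disc of radius `κ x` around a small `x > 0` does not leave the sector
  set κ : ℝ := η / (1 + η) with hκ
  have hκ0 : 0 < κ := by positivity
  have hκη : κ = η * (1 - κ) := by rw [hκ]; field_simp; ring
  have hκV : ∀ᶠ x : ℝ in 𝓝[>] 0, κ * x ≤ Metric.infDist (x : ℂ) Vᶜ := by
    have hsrc := (hΦγ 0 h0b).1
    have e0 : Φ (γ 0) = 0 := by rw [hXΦ 0 h0b, hX0]; simp
    have h2 : ∀ᶠ p in 𝓝 (γ 0), p ∉ C := hCc.isOpen_compl.mem_nhds (hγC 0 h0b (by linarith))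
    have h3 := (Φ.continuousAt_symm (Φ.map_source hsrc)).eventually
      (by rw [Φ.left_inv hsrc]; exact hΦφ.and (h2.and hsector))
    rw [e0] at h3
    have h4 : ∀ᶠ z in 𝓝 (0 : ℂ), z ∈ Φ.target := Φ.open_target.mem_nhds (e0 ▸ Φ.map_source hsrc)
    obtain ⟨r, hr0, hrb⟩ := Metric.eventually_nhds_iff.1 (h3.and h4)
    have h1 : ∀ᶠ x : ℝ in 𝓝[>] 0, x ∈ Set.Ioo 0 (r / 2) := Ioo_mem_nhdsGT (by positivity)
    have hκ1 : κ < 1 := by rw [hκ, div_lt_one (by positivity)]; linarith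
    filter_upwards [h1] with x hx
    have hx0 := hx.1
    have hball : Metric.ball (x : ℂ) (κ * x) ⊆ W ∩ {z | 0 < z.re} := by
      intro w hw
      rw [Metric.mem_ball, dist_eq_norm] at hw
      have hre := (abs_lt.1 ((Complex.abs_re_le_norm _).trans_lt hw)).1
      have him := (abs_lt.1 ((Complex.abs_im_le_norm _).trans_lt hw)).2
      simp only [Complex.sub_re, Complex.ofReal_re, Complex.sub_im, Complex.ofReal_im,
        sub_zero] at hre him
      have hwr : dist w 0 < r := by
        rw [dist_zero_right]
        have := norm_add_le (w - x) x
        rw [sub_add_cancel, Complex.norm_real, Real.norm_eq_abs, abs_of_pos hx0] at this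
        nlinarith [hx.2]
      refine ⟨fun hwim => ?_, show 0 < w.re by nlinarith⟩
      obtain ⟨⟨h5, h6, h7⟩, h8⟩ := hrb hwr
      refine ⟨h8, fun h9 => ?_, hγW w h8 h6 hwim⟩
      rw [← h5, Φ.right_inv h8] at h7
      have := h7 h9 hwim
      nlinarith
    have hball' : Metric.ball (x : ℂ) (κ * x) ⊆ V := fun w hw =>
      ⟨interior_maximal (fun w hw => (hball hw).1) Metric.isOpen_ball hw, (hball hw).2⟩
    refine (Metric.le_infDist hVn).2 fun w hw => ?_
    by_contra h
    exact hw (hball' (by rw [Metric.mem_ball, dist_comm]; exact not_le.1 h))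
  have hVX : ∀ x ∈ Set.Ioo 0 (X a), (x : ℂ) ∈ V := by
    intro x hx
    obtain ⟨s, hs, rfl⟩ := intermediate_value_Ioo ha0.le
      (hXc.mono (Set.Icc_subset_Icc le_rfl hab.le)) (show x ∈ Set.Ioo (X 0) (X a) by rwa [hX0])
    exact ⟨hWγ s hs, by simpa using hx.1⟩
  obtain ⟨f, hfc, hf0, hfa, hfpos, hflin⟩ := exists_small_graph hVo hVn hκ0 hXa hVX hκV
  -- the displaced arc
  set cl : ℝ → ℝ := fun s => max 0 (min s a) with hcl
  have hclI : ∀ s, cl s ∈ Set.Icc 0 b := fun s =>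
    ⟨le_max_left _ _, max_le (by linarith) ((min_le_right _ _).trans hab.le)⟩
  have hclI' : ∀ s, cl s ≤ a := fun s => max_le ha0.le (min_le_right _ _)
  have hcls : ∀ s ∈ Set.Icc 0 a, cl s = s := fun s hs => by
    simp [hcl, hs.1, hs.2]
  set Z : ℝ → ℂ := fun s => X (cl s) + f (X (cl s)) * Complex.I with hZ
  have hXcl : Continuous fun s => X (cl s) :=
    hXc.comp_continuous (by fun_prop) hclI
  have hZc : Continuous Z := (Complex.continuous_ofReal.comp hXcl).add
    ((Complex.continuous_ofReal.comp (hfc.comp hXcl)).mul continuous_const)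
  have hXIoo : ∀ s ∈ Set.Ioo 0 a, X s ∈ Set.Ioo 0 (X a) := fun s hs =>
    ⟨hX0 ▸ hXm h0b ⟨hs.1.le, by linarith [hs.2]⟩ hs.1,
      hXm ⟨hs.1.le, by linarith [hs.2]⟩ hab' hs.2⟩
  have hZt : ∀ s, Z s ∈ Φ.target := by
    intro s
    rcases (hclI s).1.eq_or_lt with h | h
    · have e : Z s = Φ (γ 0) := by simp [hZ, ← h, hX0, hf0 0 le_rfl, hXΦ 0 h0b]
      rw [e]; exact Φ.map_source (hΦγ 0 h0b).1
    rcases (hclI' s).eq_or_lt with h' | h'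
    · have e : Z s = Φ (γ a) := by simp [hZ, h', hfa _ le_rfl, hXΦ a hab']
      rw [e]; exact Φ.map_source (hΦγ a hab').1
    · have h1 := hfpos _ (hXIoo _ ⟨h, h'⟩)
      exact (interior_subset h1.2.1 (by simpa using h1.1)).1
  set ρ : ℝ → S := fun s => if s ≤ a then Φ.symm (Z s) else γ s with hρ
  have hρc : Continuous ρ := by
    refine Continuous.if_le (Φ.continuousOn_symm.comp_continuous hZc hZt) hc continuous_id
      continuous_const fun s hs => ?_
    have hs : s = a := hs
    rw [hs]
    have e : Z a = Φ (γ a) := by simp [hZ, hcls a ⟨ha0.le, le_rfl⟩, hfa _ le_rfl, hXΦ a hab']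
    rw [e, Φ.left_inv (hΦγ a hab').1]
  have hkey : ∀ s ∈ Set.Icc 0 b, ρ s ∈ Φ.source ∧ Φ (ρ s) = X s + f (X s) * Complex.I := by
    intro s hs
    by_cases hsa : s ≤ a
    · simp only [hρ, if_pos hsa]
      refine ⟨Φ.map_target (hZt s), ?_⟩
      rw [Φ.right_inv (hZt s)]
      simp [hZ, hcls s ⟨hs.1, hsa⟩]
    · simp only [hρ, if_neg hsa]
      refine ⟨(hΦγ s hs).1, ?_⟩
      rw [hfa _ (hXm.monotoneOn hab' hs (not_le.1 hsa).le), hXΦ s hs]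
      simp
  have hρ0 : ρ 0 = γ 0 := by
    refine Φ.injOn (hkey 0 h0b).1 (hΦγ 0 h0b).1 ?_
    rw [(hkey 0 h0b).2, hXΦ 0 h0b, hX0, hf0 0 le_rfl]; simp
  have hργ : ∀ s, a ≤ s → ρ s = γ s := by
    intro s hs
    by_cases hsa : s ≤ a
    · have hsa : s = a := le_antisymm hsa hs
      rw [hsa]
      refine Φ.injOn (hkey a hab').1 (hΦγ a hab').1 ?_
      rw [(hkey a hab').2, hXΦ a hab', hfa _ le_rfl]; simp
    · simp only [hρ, if_neg hsa]
  have hρO : ∀ s ∈ Set.Ioo 0 a, ρ s ∉ O ∧ ∀ s' ∈ Set.Icc (0 : ℝ) 1, ρ s ≠ γ s' := by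
    intro s hs
    have hsb : s ∈ Set.Icc 0 b := ⟨hs.1.le, by linarith [hs.2]⟩
    have h1 := hfpos _ (hXIoo s hs)
    have h2 := interior_subset h1.2.1 (by simpa using h1.1)
    rw [← (hkey s hsb).2, Φ.left_inv (hkey s hsb).1] at h2
    exact ⟨h2.2.1, fun s' hs' e => h2.2.2 ⟨s', hs', e.symm⟩⟩
  refine ⟨ρ, κ / 2, by positivity, ?_, hρc, ?_, ?_, hρ0, hργ, ?_, hρO⟩
  · have : κ < η := by rw [hκ, div_lt_iff₀ (by positivity)]; nlinarith
    linarith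
  · have hmix : ∀ s ∈ Set.Icc (0 : ℝ) 1, ∀ s' ∈ Set.Icc (0 : ℝ) 1, s < a → a ≤ s' →
        ρ s = ρ s' → s = s' := by
      intro s hs s' hs' hsa hs'a e
      rw [hργ s' hs'a] at e
      rcases hs.1.eq_or_lt with h | h
      · rw [← h, hρ0] at e
        rw [← h]; exact hi ⟨le_rfl, zero_le_one⟩ hs' e
      · exact absurd e ((hρO s ⟨h, hsa⟩).2 s' hs')
    intro s hs s' hs' e
    rcases lt_or_ge s a with h | h <;> rcases lt_or_ge s' a with h' | h'
    · have hsb : s ∈ Set.Icc 0 b := ⟨hs.1, by linarith⟩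
      have hsb' : s' ∈ Set.Icc 0 b := ⟨hs'.1, by linarith⟩
      refine hXi hsb hsb' ?_
      have h1 := (hkey s hsb).2
      rw [e, (hkey s' hsb').2] at h1
      simpa using (congrArg Complex.re h1).symm
    · exact hmix s hs s' hs' h h' e
    · exact (hmix s' hs' s hs h' h e.symm).symm
    · rw [hργ s h, hργ s' h'] at e
      exact hi hs hs' e
  · intro s hs
    by_cases hsb : s < b
    · suffices h : ∀ᶠ s' in 𝓝 s, Φ (ρ s') = X s' + f (X s') * Complex.I ∧
          SignType.sign (X s' - X s) = SignType.sign (s' - s) by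
        obtain ⟨χ, h1, h2, -⟩ :=
          exists_chart_of_graph hΦ hfc (X := X) (hkey s ⟨hs.1.le, hsb.le⟩).1 h
        exact ⟨χ, h1, h2⟩
      filter_upwards [Ioo_mem_nhds hs.1 hsb] with s' hs'
      have hsI : s ∈ Set.Icc 0 b := ⟨hs.1.le, hsb.le⟩
      have hsI' : s' ∈ Set.Icc 0 b := ⟨hs'.1.le, hs'.2.le⟩
      refine ⟨(hkey s' hsI').2, sign_eq_sign_of_lt (fun h => ?_) (fun h => ?_) fun h => ?_⟩
      · have := hXm hsI' hsI (by linarith); linarith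
      · rw [sub_eq_zero.1 h, sub_self]
      · have := hXm hsI hsI' (by linarith); linarith
    · refine (hf s hs).congr ?_
      filter_upwards [lt_mem_nhds (by linarith : a < s)] with s' hs'
      exact (hργ s' hs'.le).symm
  · have h1 : ∀ᶠ s in 𝓝[Set.Icc 0 1] (0 : ℝ), Φ (ρ s) = φ (ρ s) :=
      Filter.Eventually.filter_mono nhdsWithin_le_nhds
        ((hρc.tendsto 0).eventually (by rw [hρ0]; exact hΦφ))
    have h2 : ∀ᶠ s in 𝓝[Set.Icc 0 1] (0 : ℝ), s < b :=
      nhdsWithin_le_nhds (gt_mem_nhds (by linarith))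
    have h3 : ∀ᶠ s in 𝓝[Set.Icc 0 1] (0 : ℝ), 0 < X s → f (X s) = κ / 2 * X s := by
      have h4 := eventually_nhdsWithin_iff.1 hflin
      have h5 : Tendsto X (𝓝[Set.Icc 0 1] 0) (𝓝 0) := by
        have h6 := hXc 0 h0b
        rw [ContinuousWithinAt, hX0] at h6
        refine h6.mono_left (nhdsWithin_le_of_mem ?_)
        filter_upwards [h2, self_mem_nhdsWithin] with s hs hs'
        exact ⟨hs'.1, hs.le⟩
      exact h5.eventually h4
    filter_upwards [h1, h2, h3, self_mem_nhdsWithin] with s e hsb hfs hs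
    have hsI : s ∈ Set.Icc 0 b := ⟨hs.1, hsb.le⟩
    refine ⟨X s, ?_, ?_⟩
    · refine sign_eq_sign_of_lt (fun h => ?_) (fun h => ?_) fun h => ?_
      · linarith [hs.1]
      · rw [sub_zero] at h; rw [h, hX0]
      · have := hXm h0b hsI (by linarith); rwa [hX0] at this
    · rw [← e, (hkey s hsI).2]
      rcases hs.1.eq_or_lt with h | h
      · rw [← h, hX0, hf0 0 le_rfl]; simp
      · rw [hfs (hX0 ▸ hXm h0b hsI h)]; push_cast; ring

end Displacement

/-! ### Reparametrisation, corners and tails of arcs -/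

section Reparametrisation

variable {S : Type*} [TopologicalSpace S]

theorem RunsOn.comp {ψ : OpenPartialHomeomorph S ℂ} {γ γ' : ℝ → S} {g : ℝ → ℝ} {s : ℝ} {u : ℂ}
    (h : RunsOn ψ γ (g s) u) (hgs : g s ∈ Set.Ioo (0 : ℝ) 1) (hg : ContinuousAt g s)
    (hsign : ∀ s', SignType.sign (g s' - g s) = SignType.sign (s' - s))
    (hγ : ∀ᶠ s' in 𝓝 s, γ' s' = γ (g s')) : RunsOn ψ γ' s u := by
  refine Filter.Eventually.filter_mono nhdsWithin_le_nhds ?_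
  filter_upwards [hg.eventually (h.eventually_nhds hgs), hγ] with s' ⟨x, hx, e⟩ e'
  exact ⟨x, by rw [hx, hsign], by rw [e', e]⟩

theorem RunsOn.comp_neg {ψ : OpenPartialHomeomorph S ℂ} {γ γ' : ℝ → S} {g : ℝ → ℝ} {s : ℝ} {u : ℂ}
    (h : RunsOn ψ γ (g s) u) (hgs : g s ∈ Set.Ioo (0 : ℝ) 1) (hg : ContinuousAt g s)
    (hsign : ∀ s', SignType.sign (-(g s' - g s)) = SignType.sign (s' - s))
    (hγ : ∀ᶠ s' in 𝓝 s, γ' s' = γ (g s')) : RunsOn ψ γ' s (-u) := by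
  refine Filter.Eventually.filter_mono nhdsWithin_le_nhds ?_
  filter_upwards [hg.eventually (h.eventually_nhds hgs), hγ] with s' ⟨x, hx, e⟩ e'
  refine ⟨-x, ?_, by rw [e', e]; push_cast; ring⟩
  rw [← hsign s', Left.sign_neg, Left.sign_neg, hx]

theorem RunsOn.mul {ψ : OpenPartialHomeomorph S ℂ} {γ : ℝ → S} {s : ℝ} {u : ℂ}
    (h : RunsOn ψ γ s u) {c : ℂ} (hc : c ≠ 0) :
    RunsOn (ψ.transHomeomorph (mulHomeo c hc)) γ s (u * c) := by
  filter_upwards [h] with s' ⟨x, hx, e⟩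
  exact ⟨x, hx, by simp [e, mulHomeo_apply, mul_assoc]⟩

/-- A continuous injective curve comes near the point `γ s` only near the parameter `s`. -/
theorem eventually_forall_param_mem [T2Space S] {γ : ℝ → S} (hc : Continuous γ)
    (hi : Set.InjOn γ (Set.Icc 0 1)) {s : ℝ} (hs : s ∈ Set.Icc (0 : ℝ) 1) {P : ℝ → Prop}
    (hP : ∀ᶠ s' in 𝓝[Set.Icc 0 1] s, P s') :
    ∀ᶠ p in 𝓝 (γ s), ∀ s' ∈ Set.Icc (0 : ℝ) 1, γ s' = p → P s' := by
  obtain ⟨U, hU, hsU, hUP⟩ := eventually_nhds_iff.1 (eventually_nhdsWithin_iff.1 hP)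
  have hK : IsClosed (γ '' (Set.Icc 0 1 \ U)) := ((isCompact_Icc.diff hsU).image hc).isClosed
  have hsK : γ s ∉ γ '' (Set.Icc 0 1 \ U) := by
    rintro ⟨s', hs', e⟩
    exact hs'.2 (hi hs'.1 hs e ▸ hUP)
  filter_upwards [hK.isOpen_compl.mem_nhds hsK] with p hp s' hs' e
  by_contra h
  exact hp ⟨s', ⟨hs', fun hU' => h (hU s' hU' hs')⟩, e⟩

variable [ChartedSpace ℂ S]

theorem IsOrientedChartAt.mul {ψ : OpenPartialHomeomorph S ℂ} {p : S}
    (h : IsOrientedChartAt ψ p) {c : ℂ} (hc : c ≠ 0) :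
    IsOrientedChartAt (ψ.transHomeomorph (mulHomeo c hc)) p :=
  ⟨h.1.transHomeomorph (mulHomeo_orientationPreservingAt c hc), by simpa using h.2.1,
    by simp [h.2.2, mulHomeo_apply]⟩

theorem FlatAt.comp {γ γ' : ℝ → S} {g : ℝ → ℝ} {s : ℝ} (h : FlatAt γ (g s))
    (hgs : g s ∈ Set.Ioo (0 : ℝ) 1) (hg : ContinuousAt g s)
    (hsign : ∀ s', SignType.sign (g s' - g s) = SignType.sign (s' - s))
    (hγ : ∀ᶠ s' in 𝓝 s, γ' s' = γ (g s')) : FlatAt γ' s := by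
  obtain ⟨ψ, h1, h2⟩ := h
  exact ⟨ψ, by rwa [hγ.self_of_nhds], h2.comp hgs hg hsign hγ⟩

theorem exists_chart_of_reverse {γ γ' : ℝ → S} {g : ℝ → ℝ} {s : ℝ}
    {ψ : OpenPartialHomeomorph S ℂ} (hψ : IsOrientedChartAt ψ (γ (g s))) (hr : RunsOn ψ γ (g s) 1)
    (hgs : g s ∈ Set.Ioo (0 : ℝ) 1) (hg : ContinuousAt g s)
    (hsign : ∀ s', SignType.sign (-(g s' - g s)) = SignType.sign (s' - s))
    (hγ : ∀ᶠ s' in 𝓝 s, γ' s' = γ (g s')) :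
    ∃ χ : OpenPartialHomeomorph S ℂ, IsOrientedChartAt χ (γ' s) ∧ RunsOn χ γ' s 1 ∧
      ∀ p, χ p = -ψ p := by
  have h1 : (-1 : ℂ) ≠ 0 := by norm_num
  refine ⟨ψ.transHomeomorph (mulHomeo (-1) h1), ?_, ?_, fun p => by simp [mulHomeo_apply]⟩
  · rw [hγ.self_of_nhds]; exact hψ.mul h1
  · have := (hr.comp_neg hgs hg hsign hγ).mul h1
    simpa using this

/-- A right-angled corner between coordinate half-axes is straightened by turning the bisecting
line of the corner into the imaginary axis, followed by a shear. -/
theorem exists_chart_of_corner {γ : ℝ → S} {ψ : OpenPartialHomeomorph S ℂ} {s : ℝ}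
    (hψ : IsOrientedChartAt ψ (γ s)) (κ : ℝ)
    (h : ∀ᶠ s' in 𝓝 s, ∃ x : ℝ, SignType.sign x = SignType.sign (s' - s) ∧
      ψ (γ s') * (-1 - Complex.I) = x + κ * |x| * Complex.I) :
    ∃ χ : OpenPartialHomeomorph S ℂ, IsOrientedChartAt χ (γ s) ∧ RunsOn χ γ s 1 ∧
      ∀ p, (χ p).im = (ψ p * (-1 - Complex.I)).im - κ * |(ψ p * (-1 - Complex.I)).re| := by
  have hw : (-1 - Complex.I : ℂ) ≠ 0 := fun h => by simpa using congrArg Complex.re h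
  obtain ⟨χ, h1, h2, h3⟩ := exists_chart_of_graph (ρ := γ) (s := s) (hψ.mul hw).1
    (f := fun x => κ * |x|) (by fun_prop) (X := fun s' => (ψ (γ s') * (-1 - Complex.I)).re)
    (hψ.mul hw).2.1 (by
      filter_upwards [h] with s' ⟨x, hx, e⟩
      have e1 : (ψ (γ s') * (-1 - Complex.I)).re = x := by rw [e]; simp
      refine ⟨?_, ?_⟩
      · rw [e1]
        simpa [mulHomeo_apply] using e
      · rw [e1, hψ.2.2, zero_mul, Complex.zero_re, sub_zero, hx])
  exact ⟨χ, h1, h2, fun p => by rw [h3]; simp [mulHomeo_apply]⟩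

end Reparametrisation

/-! ### Combs -/

/-- A comb: the flat arcs `R 0, …, R N` start at the common point `r` and are otherwise disjoint;
they cross the flat arc `B`, one after the other and from its right-hand side to its left-hand side;
a closed set `F` avoids the part of `B` between these crossings, and the part of the last arc
`R N` before its crossing with `B`. Arcs are parametrised by `[0, 1]`. -/
structure Comb (S : Type*) [TopologicalSpace S] [ChartedSpace ℂ S] (N : ℕ) where
  /-- the common initial point of the arcs `R i` -/
  r : S
  /-- the teeth of the comb -/
  R : Fin (N + 1) → ℝ → S
  /-- the arc that is crossed by all teeth -/
  B : ℝ → S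
  /-- the parameter on `R i` of the crossing of `R i` with `B` -/
  t : Fin (N + 1) → ℝ
  /-- the parameter on `B` of the crossing of `R i` with `B` -/
  s : Fin (N + 1) → ℝ
  /-- the obstacles -/
  F : Set S
  /-- a chart around `r` -/
  φ : OpenPartialHomeomorph S ℂ
  R_cont : ∀ i, Continuous (R i)
  R_inj : ∀ i, Set.InjOn (R i) (Set.Icc 0 1)
  R_zero : ∀ i, R i 0 = r
  R_flat : ∀ i, ∀ x ∈ Set.Ioo (0 : ℝ) 1, FlatAt (R i) x
  B_cont : Continuous B
  B_inj : Set.InjOn B (Set.Icc 0 1)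
  B_flat : ∀ x ∈ Set.Ioo (0 : ℝ) 1, FlatAt B x
  t_mem : ∀ i, t i ∈ Set.Ioo (0 : ℝ) 1
  s_mem : ∀ i, s i ∈ Set.Ioo (0 : ℝ) 1
  s_mono : StrictMono s
  cross_eq : ∀ i, B (s i) = R i (t i)
  cross : ∀ i, ∃ ψ : OpenPartialHomeomorph S ℂ, IsOrientedChartAt ψ (B (s i)) ∧
    RunsOn ψ B (s i) 1 ∧ RunsOn ψ (R i) (t i) Complex.I
  R_R : ∀ i j, i ≠ j → ∀ x ∈ Set.Icc (0 : ℝ) 1, ∀ y ∈ Set.Icc (0 : ℝ) 1, R i x = R j y → x = 0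
  R_B : ∀ i, ∀ x ∈ Set.Icc (0 : ℝ) 1, ∀ y ∈ Set.Icc (0 : ℝ) 1, R i x = B y → x = t i ∧ y = s i
  F_closed : IsClosed F
  F_B : ∀ y ∈ Set.Icc (s 0) (s (Fin.last N)), B y ∉ F
  F_R : ∀ x ∈ Set.Icc 0 (t (Fin.last N)), R (Fin.last N) x ∉ F
  φ_chart : IsOrientedChartAt φ r
  φ_run : RunsOn φ (R (Fin.last N)) 0 1

namespace Comb

variable {S : Type*} [TopologicalSpace S] [ChartedSpace ℂ S] {N : ℕ} (C : Comb S N)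

/-- The part of a tooth after its crossing with the arc `B`. -/
def tail (i : Fin (N + 1)) : Set S := C.R i '' Set.Icc (C.t i) 1

/-- The parametrisation of the initial part of `spine i`, on the last tooth. -/
noncomputable def headParam (i : Fin (N + 1)) (x : ℝ) : ℝ := 2 * C.t (Fin.last N) / C.t i * x

/-- The parametrisation of the middle part of `spine i`, on `B`. -/
noncomputable def backParam (i : Fin (N + 1)) (x : ℝ) : ℝ :=
  C.s (Fin.last N) + (C.s i - C.s (Fin.last N)) * (2 / C.t i * x - 1)

/-- The arc that follows the last tooth up to its crossing with `B`, then follows `B` backwards to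
its crossing with the tooth `i`, and then follows this tooth, with unchanged parametrisation. -/
noncomputable def spine (i : Fin (N + 1)) (x : ℝ) : S :=
  if x ≤ C.t i / 2 then C.R (Fin.last N) (C.headParam i x)
  else if x ≤ C.t i then C.B (C.backParam i x) else C.R i x

theorem tail_isClosed [T2Space S] (i : Fin (N + 1)) : IsClosed (C.tail i) :=
  (isCompact_Icc.image (C.R_cont i)).isClosed

theorem headParam_half (i : Fin (N + 1)) : C.headParam i (C.t i / 2) = C.t (Fin.last N) := by
  have := (C.t_mem i).1
  unfold headParam; field_simp

theorem backParam_half (i : Fin (N + 1)) : C.backParam i (C.t i / 2) = C.s (Fin.last N) := by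
  have := (C.t_mem i).1
  unfold backParam; field_simp; ring

theorem backParam_end (i : Fin (N + 1)) : C.backParam i (C.t i) = C.s i := by
  have := (C.t_mem i).1
  unfold backParam; field_simp; ring

theorem headParam_strictMono (i : Fin (N + 1)) : StrictMono (C.headParam i) := by
  have h1 := (C.t_mem i).1
  have h2 := (C.t_mem (Fin.last N)).1
  intro x y h
  exact mul_lt_mul_of_pos_left h (by positivity)

theorem backParam_strictAnti {i : Fin (N + 1)} (hi : i < Fin.last N) :
    StrictAnti (C.backParam i) := by
  have h1 := (C.t_mem i).1
  have h2 := C.s_mono hi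
  intro x y h
  have h3 : 2 / C.t i * x < 2 / C.t i * y := mul_lt_mul_of_pos_left h (by positivity)
  unfold backParam
  nlinarith

theorem headParam_cont (i : Fin (N + 1)) : Continuous (C.headParam i) := by
  unfold headParam; fun_prop

theorem backParam_cont (i : Fin (N + 1)) : Continuous (C.backParam i) := by
  unfold backParam; fun_prop

theorem spine_head {i : Fin (N + 1)} {x : ℝ} (hx : x ≤ C.t i / 2) :
    C.spine i x = C.R (Fin.last N) (C.headParam i x) := if_pos hx

theorem spine_back {i : Fin (N + 1)} {x : ℝ} (hx : C.t i / 2 ≤ x) (hx' : x ≤ C.t i) :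
    C.spine i x = C.B (C.backParam i x) := by
  rcases hx.eq_or_lt with h | h
  · rw [← h, spine_head C le_rfl, headParam_half, backParam_half, cross_eq]
  · rw [spine, if_neg (not_le.2 h), if_pos hx']

theorem spine_tail {i : Fin (N + 1)} {x : ℝ} (hx : C.t i ≤ x) : C.spine i x = C.R i x := by
  have h0 := (C.t_mem i).1
  rcases hx.eq_or_lt with h | h
  · rw [← h, spine_back C (by linarith) le_rfl, backParam_end, cross_eq]
  · rw [spine, if_neg (by linarith), if_neg (by linarith)]

theorem spine_zero (i : Fin (N + 1)) : C.spine i 0 = C.r := by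
  have h0 := (C.t_mem i).1
  rw [spine_head C (by linarith), ← C.R_zero (Fin.last N)]
  simp [headParam]

theorem spine_continuous (i : Fin (N + 1)) : Continuous (C.spine i) := by
  refine Continuous.if_le ((C.R_cont _).comp (C.headParam_cont i))
    (Continuous.if_le (C.B_cont.comp (C.backParam_cont i)) (C.R_cont i) continuous_id
      continuous_const ?_) continuous_id continuous_const ?_
  · rintro x (rfl : x = _)
    simp only [backParam_end, cross_eq]
  · rintro x (rfl : x = _)
    have h0 := (C.t_mem i).1
    rw [if_pos (by linarith)]
    simp only [headParam_half, backParam_half, cross_eq]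

theorem headParam_mem {i : Fin (N + 1)} {x : ℝ} (h0 : 0 ≤ x) (hx : x ≤ C.t i / 2) :
    C.headParam i x ∈ Set.Icc 0 (C.t (Fin.last N)) := by
  have h1 := (C.t_mem i).1
  have h2 := (C.t_mem (Fin.last N)).1
  refine ⟨by unfold headParam; positivity, ?_⟩
  rw [← C.headParam_half i]
  exact (C.headParam_strictMono i).monotone hx

theorem backParam_mem {i : Fin (N + 1)} (hi : i < Fin.last N) {x : ℝ} (h0 : C.t i / 2 ≤ x)
    (hx : x ≤ C.t i) : C.backParam i x ∈ Set.Icc (C.s i) (C.s (Fin.last N)) := by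
  have h1 := (C.backParam_strictAnti hi).antitone hx
  have h2 := (C.backParam_strictAnti hi).antitone h0
  rw [backParam_end] at h1
  rw [backParam_half] at h2
  exact ⟨h1, h2⟩

theorem Icc_t_subset (i : Fin (N + 1)) : Set.Icc 0 (C.t i) ⊆ Set.Icc 0 1 :=
  Set.Icc_subset_Icc le_rfl (C.t_mem i).2.le

theorem Icc_s_subset (i j : Fin (N + 1)) : Set.Icc (C.s i) (C.s j) ⊆ Set.Icc 0 1 :=
  Set.Icc_subset_Icc (C.s_mem i).1.le (C.s_mem j).2.le

theorem spine_injOn {i : Fin (N + 1)} (hi : i < Fin.last N) :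
    Set.InjOn (C.spine i) (Set.Icc 0 1) := by
  have ht := C.t_mem i
  have h0 := ht.1
  have hab : ∀ x y, 0 ≤ x → x ≤ C.t i / 2 → C.t i / 2 ≤ y → y ≤ C.t i →
      C.spine i x = C.spine i y → x = y := by
    intro x y hx0 hx hy hy' e
    rw [spine_head C hx, spine_back C hy hy'] at e
    obtain ⟨e1, e2⟩ := C.R_B _ _ (C.Icc_t_subset _ (C.headParam_mem hx0 hx)) _
      (C.Icc_s_subset _ _ (C.backParam_mem hi hy hy')) e
    rw [← C.headParam_half i] at e1
    rw [← C.backParam_half i] at e2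
    rw [(C.headParam_strictMono i).injective e1, (C.backParam_strictAnti hi).injective e2]
  have hac : ∀ x y, 0 ≤ x → x ≤ C.t i / 2 → C.t i ≤ y → y ≤ 1 →
      C.spine i x ≠ C.spine i y := by
    intro x y hx0 hx hy hy' e
    rw [spine_head C hx, spine_tail C hy] at e
    have := C.R_R i (Fin.last N) hi.ne y ⟨by linarith, hy'⟩ _
      (C.Icc_t_subset _ (C.headParam_mem hx0 hx)) e.symm
    linarith
  have hbc : ∀ x y, C.t i / 2 ≤ x → x ≤ C.t i → C.t i ≤ y → y ≤ 1 →
      C.spine i x = C.spine i y → x = y := by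
    intro x y hx0 hx hy hy' e
    rw [spine_back C hx0 hx, spine_tail C hy] at e
    obtain ⟨e1, e2⟩ := C.R_B i y ⟨by linarith, hy'⟩ _
      (C.Icc_s_subset _ _ (C.backParam_mem hi hx0 hx)) e.symm
    rw [← C.backParam_end i] at e2
    rw [(C.backParam_strictAnti hi).injective e2, e1]
  intro x hx y hy e
  rcases le_total x (C.t i / 2) with hx1 | hx1
  · rcases le_total y (C.t i / 2) with hy1 | hy1
    · rw [spine_head C hx1, spine_head C hy1] at e
      exact (C.headParam_strictMono i).injective (C.R_inj _
        (C.Icc_t_subset _ (C.headParam_mem hx.1 hx1))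
        (C.Icc_t_subset _ (C.headParam_mem hy.1 hy1)) e)
    · rcases le_total y (C.t i) with hy2 | hy2
      · exact hab x y hx.1 hx1 hy1 hy2 e
      · exact absurd e (hac x y hx.1 hx1 hy2 hy.2)
  · rcases le_total y (C.t i / 2) with hy1 | hy1
    · rcases le_total x (C.t i) with hx2 | hx2
      · exact (hab y x hy.1 hy1 hx1 hx2 e.symm).symm
      · exact absurd e.symm (hac y x hy.1 hy1 hx2 hx.2)
    · rcases le_total x (C.t i) with hx2 | hx2 <;> rcases le_total y (C.t i) with hy2 | hy2
      · rw [spine_back C hx1 hx2, spine_back C hy1 hy2] at e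
        exact (C.backParam_strictAnti hi).injective (C.B_inj
          (C.Icc_s_subset _ _ (C.backParam_mem hi hx1 hx2))
          (C.Icc_s_subset _ _ (C.backParam_mem hi hy1 hy2)) e)
      · exact hbc x y hx1 hx2 hy2 hy.2 e
      · exact (hbc y x hy1 hy2 hx2 hx.2 e.symm).symm
      · rw [spine_tail C hx2, spine_tail C hy2] at e
        exact C.R_inj i hx hy e

theorem sign_headParam (i : Fin (N + 1)) (x y : ℝ) :
    SignType.sign (C.headParam i y - C.headParam i x) = SignType.sign (y - x) := by
  have h := C.headParam_strictMono i
  refine sign_eq_sign_of_lt (fun h1 => ?_) (fun h1 => ?_) fun h1 => ?_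
  · have := h (show y < x by linarith); linarith
  · rw [sub_eq_zero.1 h1, sub_self]
  · have := h (show x < y by linarith); linarith

theorem sign_backParam {i : Fin (N + 1)} (hi : i < Fin.last N) (x y : ℝ) :
    SignType.sign (-(C.backParam i y - C.backParam i x)) = SignType.sign (y - x) := by
  have h := C.backParam_strictAnti hi
  refine sign_eq_sign_of_lt (fun h1 => ?_) (fun h1 => ?_) fun h1 => ?_
  · have := h (show y < x by linarith); linarith
  · rw [sub_eq_zero.1 h1, sub_self, neg_zero]
  · have := h (show x < y by linarith); linarith

/-- A tail leaves its crossing with `B` along the positive imaginary axis. -/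
theorem eventually_tail [T2Space S] {i : Fin (N + 1)} {ψ : OpenPartialHomeomorph S ℂ}
    (hR : RunsOn ψ (C.R i) (C.t i) Complex.I) :
    ∀ᶠ p in 𝓝 (C.B (C.s i)), p ∈ C.tail i → ∃ y : ℝ, 0 ≤ y ∧ ψ p = y * Complex.I := by
  have ht := C.t_mem i
  rw [C.cross_eq]
  filter_upwards [eventually_forall_param_mem (C.R_cont i) (C.R_inj i)
    (Set.Ioo_subset_Icc_self ht) hR]
  rintro p hp ⟨x, hx, e⟩
  obtain ⟨y, hy, e'⟩ := hp x ⟨ht.1.le.trans hx.1, hx.2⟩ e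
  refine ⟨y, ?_, e ▸ e'⟩
  rcases hx.1.eq_or_lt with h | h
  · rw [← h, sub_self, sign_zero, sign_eq_zero_iff] at hy
    exact hy.ge
  · exact (pos_of_sign_eq hy (by linarith)).le

/-- The corner of a spine at the crossing of the last tooth with `B`. -/
theorem spine_corner {i : Fin (N + 1)} (hi : i < Fin.last N) {ψ : OpenPartialHomeomorph S ℂ}
    (hψ : IsOrientedChartAt ψ (C.B (C.s (Fin.last N)))) (hB : RunsOn ψ C.B (C.s (Fin.last N)) 1)
    (hR : RunsOn ψ (C.R (Fin.last N)) (C.t (Fin.last N)) Complex.I) :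
    ∃ χ : OpenPartialHomeomorph S ℂ, IsOrientedChartAt χ (C.spine i (C.t i / 2)) ∧
      RunsOn χ (C.spine i) (C.t i / 2) 1 ∧ ∀ p, (χ p).im =
        (ψ p * (-1 - Complex.I)).im - 1 * |(ψ p * (-1 - Complex.I)).re| := by
  have h0 := (C.t_mem i).1
  refine exists_chart_of_corner ?_ 1 ?_
  · rwa [spine_back C le_rfl (by linarith), backParam_half]
  have h1 := ((C.backParam_cont i).tendsto (C.t i / 2)).eventually
    (by rw [backParam_half]; exact hB.eventually_nhds (C.s_mem _))
  have h2 := ((C.headParam_cont i).tendsto (C.t i / 2)).eventually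
    (by rw [headParam_half]; exact hR.eventually_nhds (C.t_mem _))
  filter_upwards [h1, h2, gt_mem_nhds (show C.t i / 2 < C.t i by linarith)]
    with x ⟨y, hy, e⟩ ⟨z, hz, e'⟩ hx
  have hsb := C.sign_backParam hi (C.t i / 2) x
  have hsh := C.sign_headParam i (C.t i / 2) x
  rw [backParam_half] at hsb
  rw [headParam_half] at hsh
  rcases le_total x (C.t i / 2) with h | h
  · refine ⟨z, hz.trans hsh, ?_⟩
    have hz0 : z ≤ 0 := by
      rcases h.eq_or_lt with h | h
      · rw [hsh, h, sub_self, sign_zero, sign_eq_zero_iff] at hz; exact hz.le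
      · exact (neg_of_sign_eq (hz.trans hsh) (by linarith)).le
    rw [spine_head C h, e', abs_of_nonpos hz0]
    push_cast
    linear_combination (-z : ℂ) * Complex.I_sq
  · refine ⟨-y, by rw [Left.sign_neg, hy, ← Left.sign_neg, hsb], ?_⟩
    have hy0 : y ≤ 0 := by
      rcases h.eq_or_lt with h | h
      · rw [← h, backParam_half, sub_self, sign_zero, sign_eq_zero_iff] at hy; exact hy.le
      · refine (neg_of_sign_eq hy ?_).le
        have := pos_of_sign_eq hsb (show 0 < x - C.t i / 2 by linarith)
        linarith
    rw [spine_back C h hx.le, e, abs_of_nonneg (by linarith)]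
    push_cast
    ring

/-- The corner of a spine at the crossing of its tooth with `B`. -/
theorem spine_corner_end {i : Fin (N + 1)} (hi : i < Fin.last N) :
    FlatAt (C.spine i) (C.t i) := by
  have h0 := (C.t_mem i).1
  obtain ⟨ψ, hψ, hB, hR⟩ := C.cross i
  have hψ' : IsOrientedChartAt ψ (C.spine i (C.t i)) := by rwa [spine_tail C le_rfl, ← cross_eq]
  obtain ⟨χ, h1, h2, -⟩ := exists_chart_of_corner (s := C.t i) hψ' (-1) (by
    have h1 := ((C.backParam_cont i).tendsto (C.t i)).eventually
      (by rw [backParam_end]; exact hB.eventually_nhds (C.s_mem _))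
    have h2 := hR.eventually_nhds (C.t_mem _)
    filter_upwards [h1, h2, lt_mem_nhds (show C.t i / 2 < C.t i by linarith)]
      with x ⟨y, hy, e⟩ ⟨z, hz, e'⟩ hx
    have hsb := C.sign_backParam hi (C.t i) x
    rw [backParam_end] at hsb
    rcases le_total x (C.t i) with h | h
    · refine ⟨-y, by rw [Left.sign_neg, hy, ← Left.sign_neg, hsb], ?_⟩
      have hy0 : 0 ≤ y := by
        rcases h.eq_or_lt with h | h
        · rw [h, backParam_end, sub_self, sign_zero, sign_eq_zero_iff] at hy; exact hy.ge
        · refine (pos_of_sign_eq hy ?_).le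
          have := neg_of_sign_eq hsb (show x - C.t i < 0 by linarith)
          linarith
      rw [spine_back C hx.le h, e, abs_of_nonpos (by linarith)]
      push_cast
      ring
    · refine ⟨z, hz, ?_⟩
      have hz0 : 0 ≤ z := by
        rcases h.eq_or_lt with h | h
        · rw [← h, sub_self, sign_zero, sign_eq_zero_iff] at hz; exact hz.ge
        · exact (pos_of_sign_eq hz (by linarith)).le
      rw [spine_tail C h, e', abs_of_nonneg hz0]
      push_cast
      linear_combination (-z : ℂ) * Complex.I_sq)
  exact ⟨χ, h1, h2⟩

/-- Before it reaches its own tooth, a spine has on its left-hand side neither points of the other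
tails nor points of a closed set off the spine. -/
theorem spine_left [T2Space S] {i : Fin (N + 1)} (hi : i < Fin.last N) {G : Set S}
    (hG : IsClosed G) (hGs : ∀ x ∈ Set.Ioo 0 (C.t i), C.spine i x ∉ G) {x : ℝ}
    (hx : x ∈ Set.Ioo 0 (C.t i)) :
    ∃ χ : OpenPartialHomeomorph S ℂ, IsOrientedChartAt χ (C.spine i x) ∧ RunsOn χ (C.spine i) x 1 ∧
      ∀ᶠ p in 𝓝 (C.spine i x), p ∈ G ∪ ⋃ j ∈ {j | j ≠ i}, C.tail j → (χ p).im ≤ 0 := by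
  have ht := C.t_mem i
  have hL := C.t_mem (Fin.last N)
  -- off the tails other than `k`, only the tail `k` matters
  have hoff : ∀ k, (∀ j, j ≠ i → j ≠ k → C.spine i x ∉ C.tail j) →
      ∀ᶠ p in 𝓝 (C.spine i x), p ∈ G ∪ ⋃ j ∈ {j | j ≠ i}, C.tail j → p ∈ C.tail k := by
    intro k hk
    have h1 : IsClosed (⋃ j ∈ {j | j ≠ i ∧ j ≠ k}, C.tail j) :=
      (Set.toFinite _).isClosed_biUnion fun j _ => C.tail_isClosed j
    have h2 : C.spine i x ∉ ⋃ j ∈ {j | j ≠ i ∧ j ≠ k}, C.tail j := by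
      simp only [Set.mem_iUnion, not_exists]
      exact fun j hj => hk j hj.1 hj.2
    filter_upwards [hG.isOpen_compl.mem_nhds (hGs x hx), h1.isOpen_compl.mem_nhds h2]
      with p hp1 hp2 hp
    rcases hp with hp | hp
    · exact absurd hp hp1
    · simp only [Set.mem_iUnion] at hp
      obtain ⟨j, hj, hpj⟩ := hp
      by_cases hjk : j = k
      · rwa [← hjk]
      · refine absurd ?_ hp2
        simp only [Set.mem_iUnion]
        exact ⟨j, ⟨hj, hjk⟩, hpj⟩
  have hnone : ∀ χ : OpenPartialHomeomorph S ℂ, (∀ j, j ≠ i → C.spine i x ∉ C.tail j) →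
      ∀ᶠ p in 𝓝 (C.spine i x), p ∈ G ∪ ⋃ j ∈ {j | j ≠ i}, C.tail j → (χ p).im ≤ 0 := by
    intro χ h
    filter_upwards [hoff (Fin.last N) fun j hj _ => h j hj,
      (C.tail_isClosed (Fin.last N)).isOpen_compl.mem_nhds (h _ hi.ne')] with p h1 h2 h3
    exact absurd (h1 h3) h2
  -- a point of `B` lies on the tail `j` only if it is the crossing with the tooth `j`
  have hBtail : ∀ y ∈ Set.Icc (0 : ℝ) 1, ∀ j, C.B y ∈ C.tail j → y = C.s j := by
    rintro y hy j ⟨z, hz, e⟩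
    exact (C.R_B j z ⟨(C.t_mem j).1.le.trans hz.1, hz.2⟩ y hy e).2
  rcases lt_trichotomy x (C.t i / 2) with h | h | h
  · have hm := C.headParam_mem hx.1.le h.le
    have hh0 : 0 < C.headParam i x := by
      have := C.headParam_strictMono i hx.1
      simpa [headParam] using this
    have hhL : C.headParam i x < C.t (Fin.last N) := by
      rw [← C.headParam_half i]; exact C.headParam_strictMono i h
    have hh : C.headParam i x ∈ Set.Ioo (0 : ℝ) 1 := ⟨hh0, hhL.trans hL.2⟩
    obtain ⟨χ, h1, h2⟩ := (C.R_flat (Fin.last N) _ hh).comp hh (C.headParam_cont i).continuousAt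
      (C.sign_headParam i x) (γ' := C.spine i)
      (by filter_upwards [gt_mem_nhds h] with y hy using C.spine_head hy.le)
    refine ⟨χ, h1, h2, hnone χ ?_⟩
    rintro j hj ⟨z, hz, e⟩
    rw [C.spine_head h.le] at e
    have hz01 : z ∈ Set.Icc (0 : ℝ) 1 := ⟨(C.t_mem j).1.le.trans hz.1, hz.2⟩
    by_cases hjL : j = Fin.last N
    · subst hjL
      have := C.R_inj _ hz01 (Set.Ioo_subset_Icc_self hh) e
      linarith [hz.1]
    · have := C.R_R _ _ hjL z hz01 _ (Set.Ioo_subset_Icc_self hh) e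
      linarith [hz.1, (C.t_mem j).1]
  · subst h
    have hs : C.spine i (C.t i / 2) = C.B (C.s (Fin.last N)) := by
      rw [C.spine_back le_rfl (by linarith [ht.1]), backParam_half]
    obtain ⟨ψ, hψ, hB, hR⟩ := C.cross (Fin.last N)
    obtain ⟨χ, h1, h2, h3⟩ := C.spine_corner hi hψ hB hR
    refine ⟨χ, h1, h2, ?_⟩
    have h4 := C.eventually_tail hR
    rw [← hs] at h4
    filter_upwards [h4, hoff (Fin.last N) fun j _ hj hp => hj (by
      rw [hs] at hp
      exact (C.s_mono.injective (hBtail _ (Set.Ioo_subset_Icc_self (C.s_mem _)) j hp)).symm)]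
      with p h5 h6 h7
    obtain ⟨y, hy, e⟩ := h5 (h6 h7)
    rw [h3, e]
    have e1 : (y * Complex.I * (-1 - Complex.I)).im = -y := by simp
    rw [e1]
    linarith [abs_nonneg (y * Complex.I * (-1 - Complex.I)).re]
  · have hs : C.spine i x = C.B (C.backParam i x) := C.spine_back h.le hx.2.le
    have hy01 : C.backParam i x ∈ Set.Ioo (0 : ℝ) 1 := by
      have h1 := C.backParam_strictAnti hi hx.2
      have h2 := C.backParam_strictAnti hi h
      rw [backParam_end] at h1
      rw [backParam_half] at h2
      exact ⟨(C.s_mem i).1.trans h1, h2.trans (C.s_mem _).2⟩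
    have hev : ∀ᶠ x' in 𝓝 x, C.spine i x' = C.B (C.backParam i x') := by
      filter_upwards [Ioo_mem_nhds h hx.2] with y hy using C.spine_back hy.1.le hy.2.le
    by_cases hk : ∃ k, C.backParam i x = C.s k
    · obtain ⟨k, hk⟩ := hk
      obtain ⟨ψ, hψ, hB, hR⟩ := C.cross k
      have h4 := C.eventually_tail hR
      rw [← hk] at hψ hB h4
      -- the spine follows `B` backwards, so the tail leaves to its right-hand side
      obtain ⟨χ, h1, h2, h3⟩ := exists_chart_of_reverse hψ hB hy01 (C.backParam_cont i).continuousAt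
        (C.sign_backParam hi x) hev
      refine ⟨χ, h1, h2, ?_⟩
      rw [← hs] at h4
      filter_upwards [h4, hoff k fun j _ hj hp => hj (by
        rw [hs, hk] at hp
        exact (C.s_mono.injective (hBtail _ (Set.Ioo_subset_Icc_self (C.s_mem _)) j hp)).symm)]
        with p h5 h6 h7
      obtain ⟨y, hy, e⟩ := h5 (h6 h7)
      rw [h3, e]
      simpa using hy
    · obtain ⟨ψ, hψ, hB⟩ := C.B_flat _ hy01
      obtain ⟨χ, h1, h2, -⟩ := exists_chart_of_reverse hψ hB hy01 (C.backParam_cont i).continuousAt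
        (C.sign_backParam hi x) hev
      refine ⟨χ, h1, h2, hnone χ fun j _ hp => hk ⟨j, ?_⟩⟩
      rw [hs] at hp
      exact hBtail _ (Set.Ioo_subset_Icc_self hy01) j hp

theorem spine_flat [T2Space S] {i : Fin (N + 1)} (hi : i < Fin.last N) :
    ∀ x ∈ Set.Ioo (0 : ℝ) 1, FlatAt (C.spine i) x := by
  intro x hx
  rcases lt_trichotomy x (C.t i) with h | h | h
  · obtain ⟨χ, h1, h2, -⟩ := C.spine_left hi isClosed_empty (fun _ _ => Set.notMem_empty _)
      ⟨hx.1, h⟩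
    exact ⟨χ, h1, h2⟩
  · rw [h]; exact C.spine_corner_end hi
  · refine (C.R_flat i x hx).congr ?_
    filter_upwards [lt_mem_nhds h] with y hy using (C.spine_tail hy.le).symm

theorem spine_run {i : Fin (N + 1)} : RunsOn C.φ (C.spine i) 0 1 := by
  have h0 := (C.t_mem i).1
  have h1 : Tendsto (C.headParam i) (𝓝[Set.Icc 0 1] 0) (𝓝[Set.Icc 0 1] 0) := by
    have h2 : Tendsto (C.headParam i) (𝓝[Set.Icc 0 1] 0) (𝓝 0) := by
      have := ((C.headParam_cont i).tendsto 0).mono_left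
        (nhdsWithin_le_nhds (s := Set.Icc (0 : ℝ) 1))
      simpa [headParam] using this
    refine tendsto_nhdsWithin_iff.2 ⟨h2, ?_⟩
    have h3 : ∀ᶠ x in 𝓝[Set.Icc 0 1] (0 : ℝ), x < C.t i / 2 :=
      nhdsWithin_le_nhds (gt_mem_nhds (by linarith))
    filter_upwards [h3, self_mem_nhdsWithin] with x hx hx'
    exact C.Icc_t_subset _ (C.headParam_mem hx'.1 hx.le)
  have h3 : ∀ᶠ x in 𝓝[Set.Icc 0 1] (0 : ℝ), x < C.t i / 2 :=
    nhdsWithin_le_nhds (gt_mem_nhds (by linarith))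
  filter_upwards [h1.eventually C.φ_run, h3] with x ⟨y, hy, e⟩ hx
  refine ⟨y, ?_, by rw [C.spine_head hx.le, e]⟩
  have := C.sign_headParam i 0 x
  rw [show C.headParam i 0 = 0 by simp [headParam]] at this
  rw [hy, this]

end Comb

/-! ### Rerouting the teeth of a comb -/

namespace Comb

variable {S : Type*} [TopologicalSpace S] [ChartedSpace ℂ S] {N : ℕ} (C : Comb S N)

/-- A flat arc from `r` that ends with the tail of the tooth `i`, and before avoids the obstacles
and the other tails. It starts along a ray of slope `η` to the left of the last tooth. -/
structure IsRerouting (i : Fin (N + 1)) (ρ : ℝ → S) (η : ℝ) : Prop where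
  cont : Continuous ρ
  inj : Set.InjOn ρ (Set.Icc 0 1)
  flat : ∀ x ∈ Set.Ioo (0 : ℝ) 1, FlatAt ρ x
  zero : ρ 0 = C.r
  tail_eq : ∀ x, C.t i ≤ x → ρ x = C.R i x
  run : RunsOn C.φ ρ 0 (1 + η * Complex.I)
  notMem_F : ∀ x ∈ Set.Ioo 0 (C.t i), ρ x ∉ C.F
  notMem_tail : ∀ x ∈ Set.Ioo 0 (C.t i), ∀ j, j ≠ i → ρ x ∉ C.tail j

theorem isRerouting_last : C.IsRerouting (Fin.last N) (C.R (Fin.last N)) 0 where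
  cont := C.R_cont _
  inj := C.R_inj _
  flat := C.R_flat _
  zero := C.R_zero _
  tail_eq _ _ := rfl
  run := by simpa using C.φ_run
  notMem_F x hx := C.F_R x (Set.Ioo_subset_Icc_self hx)
  notMem_tail := by
    rintro x hx j hj ⟨y, hy, e⟩
    have := C.R_R _ _ hj.symm x (C.Icc_t_subset _ (Set.Ioo_subset_Icc_self hx)) y
      ⟨(C.t_mem j).1.le.trans hy.1, hy.2⟩ e.symm
    exact hx.1.ne' this

theorem r_notMem_tail (j : Fin (N + 1)) : C.r ∉ C.tail j := by
  rintro ⟨y, hy, e⟩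
  have h0 := (C.t_mem j).1
  rw [← C.R_zero j] at e
  have := C.R_inj j ⟨h0.le.trans hy.1, hy.2⟩ ⟨le_rfl, zero_le_one⟩ e
  linarith [hy.1]

theorem r_notMem_F : C.r ∉ C.F := by
  rw [← C.R_zero (Fin.last N)]
  exact C.F_R 0 ⟨le_rfl, (C.t_mem _).1.le⟩

theorem exists_spine_eq_head (i : Fin (N + 1)) {y : ℝ} (hy : y ∈ Set.Icc 0 (C.t (Fin.last N))) :
    ∃ z ∈ Set.Icc (0 : ℝ) 1, C.spine i z = C.R (Fin.last N) y := by
  have ht := C.t_mem i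
  obtain ⟨z, hz, e⟩ := intermediate_value_Icc (show 0 ≤ C.t i / 2 by linarith [ht.1])
    (C.headParam_cont i).continuousOn (show y ∈ Set.Icc _ _ by
      rw [C.headParam_half]; simpa [headParam] using hy)
  exact ⟨z, ⟨hz.1, by linarith [hz.2, ht.1, ht.2]⟩, by rw [C.spine_head hz.2, e]⟩

theorem exists_spine_eq_back (i : Fin (N + 1)) {y : ℝ}
    (hy : y ∈ Set.Icc (C.s i) (C.s (Fin.last N))) :
    ∃ z ∈ Set.Icc (0 : ℝ) 1, C.spine i z = C.B y := by
  have ht := C.t_mem i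
  obtain ⟨z, hz, e⟩ := intermediate_value_Icc' (show C.t i / 2 ≤ C.t i by linarith [ht.1])
    (C.backParam_cont i).continuousOn (show y ∈ Set.Icc _ _ by
      rwa [C.backParam_half, C.backParam_end])
  exact ⟨z, ⟨by linarith [hz.1, ht.1], hz.2.trans ht.2.le⟩, by rw [C.spine_back hz.1 hz.2, e]⟩

variable {C}

/-- Before its tail, a rerouting that avoids its own spine avoids all spines to its right. -/
theorem IsRerouting.ne_spine {l k : Fin (N + 1)} (hlk : l < k) (hk : k < Fin.last N) {ρ : ℝ → S}
    {η : ℝ} (h : C.IsRerouting l ρ η)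
    (hs : ∀ x ∈ Set.Ioo 0 (C.t l), ∀ y ∈ Set.Icc (0 : ℝ) 1, ρ x ≠ C.spine l y) {x y : ℝ}
    (hx : x ∈ Set.Ioo 0 (C.t k)) (hy : y ∈ Set.Icc (0 : ℝ) 1) : C.spine k x ≠ ρ y := by
  intro e
  have htk := C.t_mem k
  rcases hy.1.eq_or_lt with h0 | h0
  · rw [← h0, h.zero, ← C.spine_zero k] at e
    exact hx.1.ne' (C.spine_injOn hk (C.Icc_t_subset _ (Set.Ioo_subset_Icc_self hx))
      ⟨le_rfl, zero_le_one⟩ e)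
  rcases le_total x (C.t k / 2) with hx1 | hx1
  · have hm := C.headParam_mem hx.1.le hx1
    rw [C.spine_head hx1] at e
    rcases lt_or_ge y (C.t l) with hyl | hyl
    · obtain ⟨z, hz, e'⟩ := C.exists_spine_eq_head l hm
      exact hs y ⟨h0, hyl⟩ z hz (by rw [e', e])
    · rw [h.tail_eq y hyl] at e
      exact h0.ne' (C.R_R _ _ (hlk.trans hk).ne y hy _ (C.Icc_t_subset _ hm) e.symm)
  · have hm := C.backParam_mem hk hx1 hx.2.le
    rw [C.spine_back hx1 hx.2.le] at e
    rcases lt_or_ge y (C.t l) with hyl | hyl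
    · obtain ⟨z, hz, e'⟩ := C.exists_spine_eq_back l ⟨(C.s_mono hlk).le.trans hm.1, hm.2⟩
      exact hs y ⟨h0, hyl⟩ z hz (by rw [e', e])
    · rw [h.tail_eq y hyl] at e
      have := (C.R_B l y hy _ (C.Icc_s_subset _ _ hm) e.symm).2
      linarith [hm.1, C.s_mono hlk]

theorem IsRerouting.ne_last {l : Fin (N + 1)} (hl : l < Fin.last N) {ρ : ℝ → S}
    {η : ℝ} (h : C.IsRerouting l ρ η)
    (hs : ∀ x ∈ Set.Ioo 0 (C.t l), ∀ y ∈ Set.Icc (0 : ℝ) 1, ρ x ≠ C.spine l y) {x y : ℝ}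
    (hx : x ∈ Set.Ioo 0 (C.t (Fin.last N))) (hy : y ∈ Set.Icc (0 : ℝ) 1) :
    C.R (Fin.last N) x ≠ ρ y := by
  intro e
  have hx01 := C.Icc_t_subset _ (Set.Ioo_subset_Icc_self hx)
  rcases hy.1.eq_or_lt with h0 | h0
  · rw [← h0, h.zero, ← C.R_zero (Fin.last N)] at e
    exact hx.1.ne' (C.R_inj _ hx01 ⟨le_rfl, zero_le_one⟩ e)
  rcases lt_or_ge y (C.t l) with hyl | hyl
  · obtain ⟨z, hz, e'⟩ := C.exists_spine_eq_head l (Set.Ioo_subset_Icc_self hx)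
    exact hs y ⟨h0, hyl⟩ z hz (by rw [e', e])
  · rw [h.tail_eq y hyl] at e
    exact hx.1.ne' (C.R_R _ _ hl.ne' x hx01 y hy e)

theorem IsRerouting.disjoint {i j : Fin (N + 1)} (hij : i ≠ j) {ρ ρ' : ℝ → S} {η η' : ℝ}
    (h : C.IsRerouting i ρ η) (h' : C.IsRerouting j ρ' η')
    (hne : ∀ x ∈ Set.Ioo 0 (C.t i), ∀ y ∈ Set.Icc (0 : ℝ) 1, ρ x ≠ ρ' y) {x y : ℝ}
    (hx : x ∈ Set.Icc (0 : ℝ) 1) (hy : y ∈ Set.Icc (0 : ℝ) 1) (e : ρ x = ρ' y) :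
    x = 0 ∧ y = 0 := by
  rcases hx.1.eq_or_lt with h0 | h0
  · rw [← h0, h.zero, ← h'.zero] at e
    exact ⟨h0.symm, h'.inj hy ⟨le_rfl, zero_le_one⟩ e.symm⟩
  exfalso
  rcases lt_or_ge x (C.t i) with hxi | hxi
  · exact hne x ⟨h0, hxi⟩ y hy e
  have e1 := e
  rw [h.tail_eq x hxi] at e
  rcases hy.1.eq_or_lt with h0' | h0'
  · rw [← h0', h'.zero, ← C.R_zero i] at e
    exact h0.ne' (C.R_inj i hx ⟨le_rfl, zero_le_one⟩ e)
  rcases lt_or_ge y (C.t j) with hyj | hyj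
  · exact h'.notMem_tail y ⟨h0', hyj⟩ i hij ⟨x, ⟨hxi, hx.2⟩, e⟩
  · rw [h'.tail_eq y hyj] at e
    exact h0.ne' (C.R_R i j hij x hx y hy e)

/-- Given reroutings of the first teeth, all to the left of the spine of the tooth `k`, the spine
itself can be displaced to its left to give a rerouting of the tooth `k` to their right. -/
theorem exists_rerouting [T2Space S] {k : Fin (N + 1)} (hk : k < Fin.last N)
    {ρ : Fin (N + 1) → ℝ → S} {η : Fin (N + 1) → ℝ}
    (h : ∀ l, l < k → C.IsRerouting l (ρ l) (η l) ∧ 0 < η l ∧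
      ∀ x ∈ Set.Ioo 0 (C.t l), ∀ y ∈ Set.Icc (0 : ℝ) 1, ρ l x ≠ C.spine l y) :
    ∃ (ρ' : ℝ → S) (η' : ℝ), C.IsRerouting k ρ' η' ∧ 0 < η' ∧
      (∀ x ∈ Set.Ioo 0 (C.t k), ∀ y ∈ Set.Icc (0 : ℝ) 1, ρ' x ≠ C.spine k y) ∧
      ∀ l, l < k → η' < η l ∧
        ∀ x ∈ Set.Ioo 0 (C.t k), ∀ y ∈ Set.Icc (0 : ℝ) 1, ρ' x ≠ ρ l y := by
  obtain ⟨η₀, hη₀, hη₀l⟩ : ∃ η₀ : ℝ, 0 < η₀ ∧ ∀ l, l < k → η₀ ≤ η l := by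
    have h1 : ∀ᶠ x in 𝓝[>] (0 : ℝ), ∀ l, l < k → x ≤ η l := by
      rw [eventually_all]
      intro l
      by_cases hl : l < k
      · filter_upwards [Ioo_mem_nhdsGT (h l hl).2.1] with x hx _ using hx.2.le
      · exact Eventually.of_forall fun x h => absurd h hl
    obtain ⟨x, hx, hx'⟩ := (h1.and self_mem_nhdsWithin).exists
    exact ⟨x, hx', hx⟩
  set P : Set S := ⋃ l ∈ {l | l < k}, ρ l '' Set.Icc 0 1 with hP
  have hPc : IsClosed P := (Set.toFinite _).isClosed_biUnion fun l hl =>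
    (isCompact_Icc.image (h l hl).1.cont).isClosed
  set G : Set S := C.F ∪ P with hG
  have hGc : IsClosed G := C.F_closed.union hPc
  have hGs : ∀ x ∈ Set.Ioo 0 (C.t k), C.spine k x ∉ G := by
    rintro x hx (hp | hp)
    · rcases le_total x (C.t k / 2) with hx1 | hx1
      · rw [C.spine_head hx1] at hp
        exact C.F_R _ (C.headParam_mem hx.1.le hx1) hp
      · rw [C.spine_back hx1 hx.2.le] at hp
        have hm := C.backParam_mem hk hx1 hx.2.le
        exact C.F_B _ ⟨(C.s_mono.monotone (Fin.zero_le k)).trans hm.1, hm.2⟩ hp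
    · simp only [hP, Set.mem_iUnion] at hp
      obtain ⟨l, hl, y, hy, e⟩ := hp
      exact (h l hl).1.ne_spine hl hk (h l hl).2.2 hx hy e.symm
  have hsector : ∀ᶠ p in 𝓝 (C.spine k 0), p ∈ G ∪ ⋃ j ∈ {j | j ≠ k}, C.tail j →
      0 < (C.φ p).im → η₀ * (C.φ p).re ≤ (C.φ p).im := by
    rw [C.spine_zero]
    have h1 : ∀ᶠ p in 𝓝 C.r, p ∉ C.F := C.F_closed.isOpen_compl.mem_nhds C.r_notMem_F
    have h2 : ∀ᶠ p in 𝓝 C.r, ∀ j, p ∉ C.tail j := eventually_all.2 fun j =>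
      (C.tail_isClosed j).isOpen_compl.mem_nhds (C.r_notMem_tail j)
    have h3 : ∀ᶠ p in 𝓝 C.r, ∀ l, l < k → ∀ x ∈ Set.Icc (0 : ℝ) 1, ρ l x = p → ∃ y : ℝ,
        SignType.sign y = SignType.sign (x - 0) ∧ C.φ (ρ l x) = y * (1 + η l * Complex.I) := by
      rw [eventually_all]
      intro l
      by_cases hl : l < k
      · have := eventually_forall_param_mem (h l hl).1.cont (h l hl).1.inj
          ⟨le_rfl, zero_le_one⟩ (h l hl).1.run
        rw [(h l hl).1.zero] at this
        exact this.mono fun p hp _ => hp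
      · exact Eventually.of_forall fun p h => absurd h hl
    filter_upwards [h1, h2, h3] with p h1 h2 h3 hp hpim
    rcases hp with (hp | hp) | hp
    · exact absurd hp h1
    · simp only [hP, Set.mem_iUnion] at hp
      obtain ⟨l, hl, x, hx, e⟩ := hp
      obtain ⟨y, hy, e'⟩ := h3 l hl x hx e
      rw [e] at e'
      have hre : (C.φ p).re = y := by rw [e']; simp
      have him : (C.φ p).im = y * η l := by rw [e']; simp
      have hηl := (h l hl).2.1
      rw [him] at hpim
      have hy0 : 0 < y := pos_of_mul_pos_left hpim hηl.le
      rw [hre, him]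
      nlinarith [hη₀l l hl]
    · simp only [Set.mem_iUnion] at hp
      obtain ⟨j, -, hj⟩ := hp
      exact absurd hj (h2 j)
  obtain ⟨ρ', η', h1, h2, h3, h4, h5, h6, h7, h8, h9⟩ := exists_displaced_arc
    (C.spine_continuous k) (C.spine_injOn hk) (C.spine_flat hk)
    (φ := C.φ) (by rw [C.spine_zero]; exact C.φ_chart) C.spine_run (C.t_mem k)
    (fun x hx => C.spine_left hk hGc hGs hx) hη₀ hsector
  refine ⟨ρ', η', ⟨h3, h4, h5, h6.trans (C.spine_zero k), fun x hx => ?_, h8, fun x hx hp => ?_,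
    fun x hx j hj hp => ?_⟩, h1, fun x hx => (h9 x hx).2, fun l hl =>
      ⟨h2.trans_le (hη₀l l hl), fun x hx y hy e => ?_⟩⟩
  · rw [h7 x hx, C.spine_tail hx]
  · exact (h9 x hx).1 (Or.inl (Or.inl hp))
  · refine (h9 x hx).1 (Or.inr ?_)
    simp only [Set.mem_iUnion]
    exact ⟨j, hj, hp⟩
  · refine (h9 x hx).1 (Or.inl (Or.inr ?_))
    simp only [hP, Set.mem_iUnion]
    exact ⟨l, hl, y, hy, e.symm⟩

variable (C)

/-- All teeth of a comb can be rerouted, such that the new arcs are disjoint except at `r`, and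
leave `r` in the order of their indices. -/
theorem exists_disjoint_reroutings [T2Space S] :
    ∃ (ρ : Fin (N + 1) → ℝ → S) (η : Fin (N + 1) → ℝ), StrictAnti η ∧
      (∀ i, C.IsRerouting i (ρ i) (η i)) ∧
      ∀ i j, i ≠ j → ∀ x ∈ Set.Icc (0 : ℝ) 1, ∀ y ∈ Set.Icc (0 : ℝ) 1, ρ i x = ρ j y → x = 0 := by
  have key : ∀ k : ℕ, k ≤ N → ∃ (ρ : Fin (N + 1) → ℝ → S) (η : Fin (N + 1) → ℝ),
      (∀ l : Fin (N + 1), (l : ℕ) < k → C.IsRerouting l (ρ l) (η l) ∧ 0 < η l ∧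
        ∀ x ∈ Set.Ioo 0 (C.t l), ∀ y ∈ Set.Icc (0 : ℝ) 1, ρ l x ≠ C.spine l y) ∧
      ∀ i j : Fin (N + 1), j < i → (i : ℕ) < k → η i < η j ∧
        ∀ x ∈ Set.Ioo 0 (C.t i), ∀ y ∈ Set.Icc (0 : ℝ) 1, ρ i x ≠ ρ j y := by
    intro k
    induction k with
    | zero =>
      exact fun _ => ⟨fun _ => C.R 0, fun _ => 0, fun l hl => absurd hl (Nat.not_lt_zero _),
        fun i j _ hi => absurd hi (Nat.not_lt_zero _)⟩
    | succ k ih =>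
      intro hk
      obtain ⟨ρ, η, h1, h2⟩ := ih (by omega)
      set K : Fin (N + 1) := ⟨k, by omega⟩ with hK
      have hKlast : K < Fin.last N := by rw [Fin.lt_def]; simp [hK]; omega
      obtain ⟨ρ', η', g1, g2, g3, g4⟩ := exists_rerouting hKlast (ρ := ρ) (η := η)
        fun l hl => h1 l hl
      refine ⟨Function.update ρ K ρ', Function.update η K η', fun l hl => ?_,
        fun i j hji hi => ?_⟩
      · by_cases hlK : l = K
        · subst hlK
          simp only [Function.update_self]
          exact ⟨g1, g2, g3⟩
        · simp only [Function.update_of_ne hlK]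
          refine h1 l ?_
          have : (l : ℕ) ≠ k := fun h => hlK (Fin.ext h)
          omega
      · have hjK : j ≠ K := fun h => by
          rw [h, Fin.lt_def] at hji; simp [hK] at hji; omega
        rw [Function.update_of_ne hjK, Function.update_of_ne hjK]
        by_cases hiK : i = K
        · rw [hiK, Function.update_self, Function.update_self]
          exact g4 j (hiK ▸ hji)
        · rw [Function.update_of_ne hiK, Function.update_of_ne hiK]
          refine h2 i j hji ?_
          have : (i : ℕ) ≠ k := fun h => hiK (Fin.ext h)
          omega
  obtain ⟨ρ, η, h1, h2⟩ := key N le_rfl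
  set L := Fin.last N with hL
  have hlt : ∀ i : Fin (N + 1), i ≠ L → (i : ℕ) < N := fun i hi =>
    Fin.lt_def.1 (Fin.lt_last_iff_ne_last.2 hi)
  have hre : ∀ i, C.IsRerouting i (Function.update ρ L (C.R L) i) (Function.update η L 0 i) := by
    intro i
    by_cases hi : i = L
    · rw [hi, Function.update_self, Function.update_self]; exact C.isRerouting_last
    · rw [Function.update_of_ne hi, Function.update_of_ne hi]; exact (h1 i (hlt i hi)).1
  have hpair : ∀ i j : Fin (N + 1), j < i →
      Function.update η L 0 i < Function.update η L 0 j ∧ ∀ x ∈ Set.Ioo 0 (C.t i),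
        ∀ y ∈ Set.Icc (0 : ℝ) 1,
          Function.update ρ L (C.R L) i x ≠ Function.update ρ L (C.R L) j y := by
    intro i j hji
    have hj : j ≠ L := fun h => (h ▸ hji).not_ge (Fin.le_last i)
    rw [Function.update_of_ne hj, Function.update_of_ne hj]
    obtain ⟨g1, g2, g3⟩ := h1 j (hlt j hj)
    by_cases hi : i = L
    · subst hi
      rw [Function.update_self, Function.update_self]
      exact ⟨g2, fun x hx y hy => g1.ne_last hji g3 hx hy⟩
    · rw [Function.update_of_ne hi, Function.update_of_ne hi]
      exact h2 i j hji (hlt i hi)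
  refine ⟨Function.update ρ L (C.R L), Function.update η L 0, fun j i hji => (hpair i j hji).1, hre,
    fun i j hij x hx y hy e => ?_⟩
  rcases lt_or_gt_of_ne hij with h | h
  · exact ((hre j).disjoint hij.symm (hre i) (hpair j i h).2 hy hx e.symm).2
  · exact ((hre i).disjoint hij (hre j) (hpair i j h).2 hx hy e).1

end Comb

/-! ### From 2-drawings to 1-drawings -/

namespace SimpleDrawing

variable {S : Type*} [TopologicalSpace S] [ChartedSpace ℂ S]

theorem flatAt_extend {a b : S} (p : Path a b) (hp : IsJordanArc p) {x : ℝ}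
    (hx : x ∈ Set.Ioo (0 : ℝ) 1) : FlatAt p.extend x := by
  obtain ⟨φ, h1, h2⟩ := hp.2 ⟨x, hx.1.le, hx.2.le⟩ hx.1 hx.2
  refine ⟨φ, ?_, (runsAlong_iff_runsOn (Path.extend_extends' p)).1 h2⟩
  rwa [p.extend_apply ⟨hx.1.le, hx.2.le⟩]

theorem injOn_extend {a b : S} (p : Path a b) (hp : IsJordanArc p) :
    Set.InjOn p.extend (Set.Icc 0 1) := by
  intro x hx y hy e
  rw [p.extend_apply hx, p.extend_apply hy] at e
  exact congrArg Subtype.val (hp.1 e)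

section Crossings

variable {n : ℕ} (D : SimpleDrawing n S)

theorem exists_crossing (hD : D.IsLDrawing 2) {i j : Fin n} (hij : i ≠ j) :
    ∃ s t : I, D.blue i s = D.red j t := by
  have h := hD.crossings i j hij
  have h1 := Set.encard_le_one_iff_subsingleton.2 (D.blue_inter_red j i hij.symm)
  rcases (Set.range (D.blue i) ∩ Set.range (D.red j)).eq_empty_or_nonempty with h2 | ⟨p, h2, h3⟩
  · rw [selfCrossings, h2, Set.empty_union] at h
    rw [h] at h1
    exact absurd h1 (by norm_num)
  · obtain ⟨s, rfl⟩ := h2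
    obtain ⟨t, e⟩ := h3
    exact ⟨s, t, e.symm⟩

theorem crossing_unique {i j : Fin n} (hij : i ≠ j) {s s' t t' : I} (h : D.blue i s = D.red j t)
    (h' : D.blue i s' = D.red j t') : s = s' ∧ t = t' := by
  have := D.blue_inter_red i j hij ⟨⟨s, rfl⟩, ⟨t, h.symm⟩⟩ ⟨⟨s', rfl⟩, ⟨t', h'.symm⟩⟩
  exact ⟨(D.blue_arc i).1 this, (D.red_arc j).1 (h ▸ h' ▸ this)⟩

theorem red_param_unique {i j : Fin n} (hij : i ≠ j) {t t' : I}
    (h : D.red j t ∈ Set.range (D.blue i)) (h' : D.red j t' ∈ Set.range (D.blue i)) : t = t' := by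
  obtain ⟨s, h⟩ := h
  obtain ⟨s', h'⟩ := h'
  exact (D.crossing_unique hij h h').2

theorem blue_param_unique {i j : Fin n} (hij : i ≠ j) {s s' : I}
    (h : D.blue i s ∈ Set.range (D.red j)) (h' : D.blue i s' ∈ Set.range (D.red j)) : s = s' := by
  obtain ⟨t, h⟩ := h
  obtain ⟨t', h'⟩ := h'
  exact (D.crossing_unique hij h.symm h'.symm).1

theorem crossing_interior {i j : Fin n} (hij : i ≠ j) {s t : I} (h : D.blue i s = D.red j t) :
    (s : ℝ) ∈ Set.Ioo (0 : ℝ) 1 ∧ (t : ℝ) ∈ Set.Ioo (0 : ℝ) 1 := by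
  refine ⟨⟨unitInterval.pos_iff_ne_zero.2 ?_, unitInterval.lt_one_iff_ne_one.2 ?_⟩,
    ⟨unitInterval.pos_iff_ne_zero.2 ?_, unitInterval.lt_one_iff_ne_one.2 ?_⟩⟩
  · rintro rfl
    exact D.b_notMem_red j ⟨t, by rw [← h]; simp⟩
  · rintro rfl
    exact D.v_notMem_red j i hij.symm ⟨t, by rw [← h]; simp⟩
  · rintro rfl
    exact D.r_notMem_blue i ⟨s, by rw [h]; simp⟩
  · rintro rfl
    exact D.v_notMem_blue i j hij ⟨s, by rw [h]; simp⟩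

theorem blue_eq_blue {i j : Fin n} (hij : i ≠ j) {s s' : I} (h : D.blue i s = D.blue j s') :
    s = 0 := by
  have : D.blue i s ∈ Set.range (D.blue i) ∩ Set.range (D.blue j) := ⟨⟨s, rfl⟩, ⟨s', h.symm⟩⟩
  rw [D.blue_inter_blue i j hij] at this
  exact (D.blue_arc i).1 (by simpa using this)

theorem red_eq_red {i j : Fin n} (hij : i ≠ j) {t t' : I} (h : D.red i t = D.red j t') :
    t = 0 := by
  have : D.red i t ∈ Set.range (D.red i) ∩ Set.range (D.red j) := ⟨⟨t, rfl⟩, ⟨t', h.symm⟩⟩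
  rw [D.red_inter_red i j hij] at this
  exact (D.red_arc i).1 (by simpa using this)

theorem blue_eq_red_self {i : Fin n} {s t : I} (h : D.blue i s = D.red i t) : t = 1 := by
  have : D.red i t ∈ Set.range (D.blue i) ∩ Set.range (D.red i) := ⟨⟨s, h⟩, ⟨t, rfl⟩⟩
  rw [D.blue_inter_red_self i] at this
  exact (D.red_arc i).1 (by simpa using this)

end Crossings

variable {N : ℕ}

/-- The index `m` separates the drawing: every other red edge crosses `blue m` negatively, after its
crossings with blue edges of greater index, and before those with blue edges of smaller index.
Along `blue m` these crossings appear in increasing order. -/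
structure IsSeparating (D : SimpleDrawing (N + 2) S) (m : Fin (N + 2)) : Prop where
  negative : ∀ (i : Fin (N + 1)) (s t : I), D.blue m s = D.red (m.succAbove i) t →
    IsNegativeCrossing (D.blue m) (D.red (m.succAbove i)) s t
  ahead : ∀ i j : Fin (N + 1), i < j → D.RedBefore (m.succAbove i) (m.succAbove j) m
  behind : ∀ i j : Fin (N + 1), j < i → D.RedBefore (m.succAbove i) m (m.succAbove j)
  increasing : D.BlueIncreasingAt m

theorem isSeparating_last {D : SimpleDrawing (N + 2) S} (hfirst : D.AheadFirst)
    (h1 : D.AheadIncreasing) (h2 : D.AheadNegative)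
    (h3 : D.BlueIncreasingAt (Fin.last (N + 1))) : D.IsSeparating (Fin.last (N + 1)) where
  negative i s t h := h2 _ _ (by simp [Fin.castSucc_lt_last]) s t h
  ahead i j h := h1 _ _ _ (Fin.strictMono_succAbove _ h) (by simp [Fin.castSucc_lt_last])
  behind i j h := hfirst _ _ _ (Fin.strictMono_succAbove _ h) (by simp [Fin.castSucc_lt_last])
  increasing := h3

theorem isSeparating_zero {D : SimpleDrawing (N + 2) S} (hfirst : D.AheadFirst)
    (h1 : D.BehindIncreasing) (h2 : D.BehindNegative)
    (h3 : D.BlueIncreasingAt 0) : D.IsSeparating 0 where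
  negative i s t h := h2 _ _ (by simp) s t h
  ahead i j h := hfirst _ _ _ (by simp) (Fin.strictMono_succAbove _ h)
  behind i j h := h1 _ _ _ (by simp) (Fin.strictMono_succAbove _ h)
  increasing := h3

/-- The red edges other than `red m`, as a comb crossed by `blue m`. The obstacles are the other
blue edges. -/
theorem IsSeparating.exists_comb [T2Space S] {D : SimpleDrawing (N + 2) S} (hD : D.IsLDrawing 2)
    {m : Fin (N + 2)} (hm : D.IsSeparating m) {φ : OpenPartialHomeomorph S ℂ}
    (hφ : IsOrientedChartAt φ D.r)
    (hrun : RunsAlong φ (D.red (m.succAbove (Fin.last N))) 0 1) :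
    ∃ C : Comb S N, C.r = D.r ∧ C.φ = φ ∧ (∀ i, C.R i = (D.red (m.succAbove i)).extend) ∧
      (∀ i, D.red (m.succAbove i) ⟨C.t i, (C.t_mem i).1.le, (C.t_mem i).2.le⟩
        ∈ Set.range (D.blue m)) ∧
      C.F = ⋃ i : Fin (N + 1), Set.range (D.blue (m.succAbove i)) := by
  have hne : ∀ i, m ≠ m.succAbove i := fun i => (Fin.succAbove_ne m i).symm
  choose s t hst using fun i => D.exists_crossing hD (hne i)
  have hint := fun i => D.crossing_interior (hne i) (hst i)
  have hsmono : StrictMono fun i => (s i : ℝ) := by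
    intro i j hij
    obtain ⟨x, y, hxy, hx, hy⟩ := hm.increasing _ _ (hne i).symm (hne j).symm
      (Fin.strictMono_succAbove m hij)
    rw [D.blue_param_unique (hne i) hx ⟨t i, (hst i).symm⟩,
      D.blue_param_unique (hne j) hy ⟨t j, (hst j).symm⟩] at hxy
    exact hxy
  refine ⟨{
    r := D.r
    R := fun i => (D.red (m.succAbove i)).extend
    B := (D.blue m).extend
    t := fun i => t i
    s := fun i => s i
    F := ⋃ i : Fin (N + 1), Set.range (D.blue (m.succAbove i))
    φ := φ
    R_cont := fun i => (D.red _).continuous_extend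
    R_inj := fun i => injOn_extend _ (D.red_arc _)
    R_zero := fun i => (D.red _).extend_zero
    R_flat := fun i x hx => flatAt_extend _ (D.red_arc _) hx
    B_cont := (D.blue _).continuous_extend
    B_inj := injOn_extend _ (D.blue_arc _)
    B_flat := fun x hx => flatAt_extend _ (D.blue_arc _) hx
    t_mem := fun i => (hint i).2
    s_mem := fun i => (hint i).1
    s_mono := hsmono
    cross_eq := fun i => by rw [Path.extend_extends', Path.extend_extends', hst]
    cross := fun i => ?_
    R_R := fun i j hij x hx y hy e => ?_
    R_B := fun i x hx y hy e => ?_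
    F_closed := isClosed_iUnion_of_finite fun i => (isCompact_range (D.blue _).continuous).isClosed
    F_B := fun y hy hp => ?_
    F_R := fun x hx hp => ?_
    φ_chart := hφ
    φ_run := (runsAlong_iff_runsOn (Path.extend_extends' _)).1 hrun }, rfl, rfl, fun i => rfl,
    fun i => ⟨s i, hst i⟩, rfl⟩
  · obtain ⟨-, ψ, h1, h2, h3⟩ := hm.negative i (s i) (t i) (hst i)
    exact ⟨ψ, by rwa [Path.extend_extends'], (runsAlong_iff_runsOn (Path.extend_extends' _)).1 h2,
      (runsAlong_iff_runsOn (Path.extend_extends' _)).1 h3⟩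
  · rw [Path.extend_apply _ hx, Path.extend_apply _ hy] at e
    exact congrArg Subtype.val
      (D.red_eq_red (fun h => hij (Fin.succAbove_right_injective h)) e)
  · rw [Path.extend_apply _ hx, Path.extend_apply _ hy] at e
    obtain ⟨h1, h2⟩ := D.crossing_unique (hne i) e.symm (hst i)
    exact ⟨congrArg Subtype.val h2, congrArg Subtype.val h1⟩
  · have hy01 : y ∈ Set.Icc (0 : ℝ) 1 := ⟨(hint _).1.1.le.trans hy.1, hy.2.trans (hint _).1.2.le⟩
    rw [Path.extend_apply _ hy01] at hp
    obtain ⟨i, s', hs'⟩ := Set.mem_iUnion.1 hp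
    have := congrArg Subtype.val (D.blue_eq_blue (hne i) hs'.symm)
    have h0 : y = 0 := this
    linarith [hy.1, (hint 0).1.1]
  · have hx01 : x ∈ Set.Icc (0 : ℝ) 1 := ⟨hx.1, hx.2.trans (hint _).2.2.le⟩
    rw [Path.extend_apply _ hx01] at hp
    obtain ⟨i, s', hs'⟩ := Set.mem_iUnion.1 hp
    rcases (Fin.le_last i).eq_or_lt with h | h
    · subst h
      have h1 : x = 1 := congrArg Subtype.val (D.blue_eq_red_self hs')
      linarith [hx.2, (hint (Fin.last N)).2.2]
    · obtain ⟨y, z, hyz, hy, hz⟩ := hm.behind _ _ h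
      rw [D.red_param_unique (hne _) hy ⟨s _, hst _⟩, D.red_param_unique
        (fun h' => h.ne (Fin.succAbove_right_injective h')) hz ⟨s', hs'⟩] at hyz
      exact absurd hx.2 (not_le.2 hyz)

theorem exists_isLDrawing_one_of_isSeparating [T2Space S] {D : SimpleDrawing (N + 2) S}
    (hD : D.IsLDrawing 2) {m : Fin (N + 2)} (hm : D.IsSeparating m) :
    ∃ E : SimpleDrawing (N + 1) S, E.IsLDrawing 1 := by
  have hne : ∀ i, m ≠ m.succAbove i := fun i => (Fin.succAbove_ne m i).symm
  have hinj : ∀ {i j : Fin (N + 1)}, i ≠ j → m.succAbove i ≠ m.succAbove j := fun h h' =>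
    h (Fin.succAbove_right_injective h')
  obtain ⟨φ, hφ, θ, hθ, -, hrun⟩ := hD.rotation_r
  set α := θ (m.succAbove (Fin.last N)) with hα
  -- turn the chart at `r` such that the last tooth starts along the positive real axis
  have hα0 : Complex.exp (-(α * Complex.I)) ≠ 0 := Complex.exp_ne_zero _
  have hrun' : RunsAlong (φ.transHomeomorph (mulHomeo _ hα0))
      (D.red (m.succAbove (Fin.last N))) 0 1 := by
    have := ((runsAlong_iff_runsOn (Path.extend_extends' _)).1
      (hrun (m.succAbove (Fin.last N))).2).mul hα0
    rw [← Complex.exp_add, add_neg_cancel, Complex.exp_zero] at this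
    exact (runsAlong_iff_runsOn (Path.extend_extends' _)).2 this
  obtain ⟨C, hCr, hCφ, hCR, hCB, hCF⟩ := hm.exists_comb hD (hφ.mul hα0) hrun'
  obtain ⟨ρ, η, hη, hρ, hρρ⟩ := C.exists_disjoint_reroutings
  have htail : ∀ i (x : I), C.t i ≤ x → ρ i x = D.red (m.succAbove i) x := fun i x hx => by
    rw [(hρ i).tail_eq x hx, hCR, Path.extend_extends']
  have hρ0 : ∀ i, ρ i 0 = D.r := fun i => by rw [(hρ i).zero, hCr]
  have hρ1 : ∀ i, ρ i 1 = D.v (m.succAbove i) := fun i => by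
    have := htail i 1 (C.t_mem i).2.le
    simpa using this
  -- a new red edge meets the blue edges only on its tail
  have hblue : ∀ i j (x : I), ρ i x ∈ Set.range (D.blue (m.succAbove j)) → C.t i < x := by
    intro i j x hx
    rcases x.2.1.eq_or_lt with h0 | h0
    · rw [← h0, hρ0] at hx
      exact absurd hx (D.r_notMem_blue _)
    rcases lt_trichotomy (x : ℝ) (C.t i) with h | h | h
    · refine absurd ?_ ((hρ i).notMem_F x ⟨h0, h⟩)
      rw [hCF]
      exact Set.mem_iUnion.2 ⟨j, hx⟩
    · exfalso
      rw [htail i x h.ge] at hx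
      obtain ⟨s, hs⟩ := hx
      obtain ⟨s', hs'⟩ := hCB i
      have hxt : x = ⟨C.t i, (C.t_mem i).1.le, (C.t_mem i).2.le⟩ := Subtype.ext h
      rw [← hxt, ← hs] at hs'
      have hs0 := D.blue_eq_blue (hne j) hs'
      rw [hs0, Path.source] at hs'
      exact D.b_notMem_red (m.succAbove i) ⟨x, by rw [← hs, ← hs']⟩
    · exact h
  have hblue' : ∀ i j (x : I), ρ i x ∈ Set.range (D.blue (m.succAbove j)) →
      ρ i x = D.red (m.succAbove i) x := fun i j x hx => htail i x (hblue i j x hx).le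
  -- the crossings with blue edges of greater index are cut off, those of smaller index remain
  have hgreater : ∀ i j (x : I), i < j → ρ i x ∉ Set.range (D.blue (m.succAbove j)) := by
    intro i j x hij hx
    have h1 := hblue i j x hx
    rw [hblue' i j x hx] at hx
    obtain ⟨y, z, hyz, hy, hz⟩ := hm.ahead i j hij
    rw [D.red_param_unique (hinj hij.ne') hy hx, D.red_param_unique (hne i) hz (hCB i)] at hyz
    exact absurd h1 (not_lt.2 (le_of_lt (show (x : ℝ) < C.t i from hyz)))
  have hsmaller : ∀ i j (x : I), i < j →
      D.red (m.succAbove j) x ∈ Set.range (D.blue (m.succAbove i)) →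
      ρ j x = D.red (m.succAbove j) x := by
    intro i j x hij hx
    obtain ⟨y, z, hyz, hy, hz⟩ := hm.behind j i hij
    rw [D.red_param_unique (hinj hij.ne) hz hx, D.red_param_unique (hne j) hy (hCB j)] at hyz
    exact htail j x (le_of_lt (show C.t j < x from hyz))
  have hrunE : ∀ i (x : I) (ψ : OpenPartialHomeomorph S ℂ) (u : ℂ), C.t i < x →
      RunsAlong ψ (D.red (m.succAbove i)) x u → RunsAlong ψ (fun x : I => ρ i x) x u := by
    intro i x ψ u hx h
    have hev : ∀ᶠ y : I in 𝓝 x, C.t i < y := continuous_subtype_val.continuousAt.eventually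
      (lt_mem_nhds hx)
    filter_upwards [h, hev] with y hy hy'
    rwa [htail i y hy'.le]
  let E : SimpleDrawing (N + 1) S :=
    { b := D.b
      r := D.r
      v := fun i => D.v (m.succAbove i)
      b_ne_r := D.b_ne_r
      b_ne_v := fun i => D.b_ne_v _
      r_ne_v := fun i => D.r_ne_v _
      v_injective := D.v_injective.comp Fin.succAbove_right_injective
      blue := fun i => D.blue (m.succAbove i)
      red := fun i =>
        { toFun := fun x => ρ i x
          continuous_toFun := (hρ i).cont.comp continuous_subtype_val
          source' := by simpa using hρ0 i
          target' := by simpa using hρ1 i }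
      blue_arc := fun i => D.blue_arc _
      red_arc := fun i => by
        refine ⟨fun x y e => Subtype.ext ((hρ i).inj x.2 y.2 e), fun x h0 h1 => ?_⟩
        obtain ⟨ψ, h2, h3⟩ := (hρ i).flat x ⟨h0, h1⟩
        exact ⟨ψ, h2, (runsAlong_iff_runsOn fun _ => rfl).2 h3⟩
      r_notMem_blue := fun i => D.r_notMem_blue _
      b_notMem_red := by
        rintro i ⟨x, hx⟩
        have hx : ρ i x = D.b := hx
        have h1 := hblue' i 0 x (by rw [hx]; exact ⟨0, by simp⟩)
        exact D.b_notMem_red _ ⟨x, by rw [← h1, hx]⟩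
      v_notMem_blue := fun i j hij => D.v_notMem_blue _ _ (hinj hij)
      v_notMem_red := by
        rintro i j hij ⟨x, hx⟩
        have hx : ρ i x = D.v (m.succAbove j) := hx
        have h1 := hblue' i j x (by rw [hx]; exact ⟨1, by simp⟩)
        exact D.v_notMem_red _ _ (hinj hij) ⟨x, by rw [← h1, hx]⟩
      blue_inter_blue := fun i j hij => D.blue_inter_blue _ _ (hinj hij)
      red_inter_red := by
        intro i j hij
        refine Set.Subset.antisymm ?_ ?_
        · rintro p ⟨⟨x, hx⟩, ⟨y, hy⟩⟩
          have hx : ρ i x = p := hx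
          have hy : ρ j y = p := hy
          have := hρρ i j hij x x.2 y y.2 (hx.trans hy.symm)
          rw [this, hρ0] at hx
          exact hx.symm
        · rintro p rfl
          exact ⟨⟨0, by simp⟩, ⟨0, by simp⟩⟩
      blue_inter_red_self := by
        intro i
        refine Set.Subset.antisymm ?_ ?_
        · rintro p ⟨hp, ⟨x, hx⟩⟩
          have hx : ρ i x = p := hx
          have h1 := hblue' i i x (by rwa [hx])
          rw [← D.blue_inter_red_self (m.succAbove i)]
          exact ⟨hp, ⟨x, by rw [← h1, hx]⟩⟩
        · rintro p rfl
          exact ⟨⟨1, by simp⟩, ⟨1, by simp⟩⟩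
      blue_inter_red := by
        intro i j hij
        refine (D.blue_inter_red _ _ (hinj hij)).anti ?_
        rintro p ⟨hp, ⟨x, hx⟩⟩
        have hx : ρ j x = p := hx
        have h1 := hblue' j i x (by rwa [hx])
        exact ⟨hp, ⟨x, by rw [← h1, hx]⟩⟩
      crossing := by
        intro i j hij s x h
        have h : D.blue (m.succAbove i) s = ρ j x := h
        have h1 := hblue j i x ⟨s, h⟩
        have h2 := htail j x h1.le
        refine (D.crossing _ _ (hinj hij) s x (h.trans h2)).imp ?_ ?_
        · rintro ⟨-, ψ, g1, g2, g3⟩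
          exact ⟨h, ψ, g1, g2, hrunE j x ψ _ h1 g3⟩
        · rintro ⟨-, ψ, g1, g2, g3⟩
          exact ⟨h, ψ, g1, g2, hrunE j x ψ _ h1 g3⟩ }
  have hcross : ∀ i j, i < j → (E.selfCrossings i j).encard = 1 := by
    intro i j hij
    have h1 : Set.range (E.blue j) ∩ Set.range (E.red i) = ∅ := by
      refine Set.eq_empty_of_forall_notMem ?_
      rintro p ⟨hp, ⟨x, hx⟩⟩
      have hx : ρ i x = p := hx
      exact hgreater i j x hij (by rwa [hx])
    obtain ⟨s, x, h2⟩ := D.exists_crossing hD (hinj hij.ne)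
    have h3 := hsmaller i j x hij ⟨s, h2⟩
    rw [selfCrossings, h1, Set.union_empty, Set.encard_eq_one]
    refine ⟨D.blue (m.succAbove i) s, (E.blue_inter_red i j hij.ne).eq_singleton_of_mem
      ⟨⟨s, rfl⟩, ⟨x, ?_⟩⟩⟩
    exact h3.trans h2.symm
  refine ⟨E, ⟨?_, ?_, ?_, ?_⟩⟩
  · obtain ⟨ψ, h1, ϑ, h2, h3, h4⟩ := hD.rotation_b
    exact ⟨ψ, h1, fun i => ϑ (m.succAbove i), h2.comp (Fin.strictMono_succAbove m),
      fun i j => h3 _ _, fun i => h4 _⟩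
  · -- the ray of slope `η i` relative to the last tooth has this angle
    refine ⟨φ, hφ, fun i => α + Real.arctan (η i), fun i j hij => ?_, fun i j => ?_, fun i => ?_⟩
    · have := Real.arctan_strictMono (hη hij)
      simp only
      linarith
    · have h1 := Real.arctan_lt_pi_div_two (η i)
      have h2 := Real.neg_pi_div_two_lt_arctan (η j)
      have := Real.pi_pos
      linarith
    · refine ⟨by simp, ?_⟩
      have h1 := (hρ i).run
      rw [hCφ] at h1
      refine (runsAlong_iff_runsOn (γ' := ρ i) fun _ => rfl).2 ?_
      filter_upwards [h1] with x ⟨y, hy, e⟩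
      have hsq : 0 < √(1 + η i ^ 2) := Real.sqrt_pos.2 (by positivity)
      refine ⟨y * √(1 + η i ^ 2), ?_, ?_⟩
      · rw [sign_mul, sign_pos hsq, mul_one, hy]; simp
      · have h2 : (√(1 + η i ^ 2) : ℂ) * Complex.exp (Real.arctan (η i) * Complex.I)
            = 1 + η i * Complex.I := by
          rw [Complex.exp_mul_I, ← Complex.ofReal_cos, ← Complex.ofReal_sin, Real.cos_arctan,
            Real.sin_arctan]
          have : (√(1 + η i ^ 2) : ℂ) ≠ 0 := Complex.ofReal_ne_zero.2 hsq.ne'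
          push_cast
          field_simp
        have e' : φ (ρ i x) * Complex.exp (-(α * Complex.I)) = y * (1 + η i * Complex.I) := e
        have h3 : Complex.exp (-(α * Complex.I)) * Complex.exp (α * Complex.I) = 1 := by
          rw [← Complex.exp_add, neg_add_cancel, Complex.exp_zero]
        rw [Complex.ofReal_add, Complex.ofReal_mul, add_mul, Complex.exp_add]
        linear_combination (Complex.exp (α * Complex.I)) * e' - φ (ρ i x) * h3
          - y * Complex.exp (α * Complex.I) * h2
  · intro i
    obtain ⟨ψ, h1, ϑ, h2, h3, h4⟩ := hD.rotation_v (m.succAbove i)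
    refine ⟨ψ, h1, ϑ, h2, h3, fun k => ?_⟩
    fin_cases k
    · exact h4 0
    · refine ⟨by simp, ?_⟩
      have h5 : RunsAlong ψ (D.red (m.succAbove i)).symm 0
        (Complex.exp (ϑ 1 * Complex.I)) := (h4 1).2
      change RunsAlong ψ (E.red i).symm 0 (Complex.exp (ϑ 1 * Complex.I))
      have hev : ∀ᶠ y : I in 𝓝 0, C.t i < (unitInterval.symm y : ℝ) := by
        have hc : Continuous fun y : I => (unitInterval.symm y : ℝ) := by fun_prop
        exact (hc.tendsto 0).eventually (lt_mem_nhds (by simpa using (C.t_mem i).2))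
      filter_upwards [h5, hev] with y hy hy'
      have : (E.red i).symm y = (D.red (m.succAbove i)).symm y := htail i _ hy'.le
      rwa [this]
  · intro i j hij
    rcases lt_or_gt_of_ne hij with h | h
    · simp [hcross i j h]
    · rw [selfCrossings, Set.union_comm]
      have := hcross j i h
      rw [selfCrossings] at this
      simpa using this

end SimpleDrawing

theorem claim11 {S : Type*} [TopologicalSpace S] [T2Space S] [CompactSpace S] [ChartedSpace ℂ S]
    (hS : IsOrientedAtlas S) (n : ℕ) (D : SimpleDrawing (n + 1) S) (hD : D.IsLDrawing 2)
    (hfirst : D.AheadFirst)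
    (h : (D.AheadIncreasing ∧ D.AheadNegative ∧ D.BlueIncreasingAt (Fin.last n)) ∨
      (D.BehindIncreasing ∧ D.BehindNegative ∧ D.BlueIncreasingAt 0)) :
    ∃ E : SimpleDrawing n S, E.IsLDrawing 1 := by
  cases n with
  | zero =>
    obtain ⟨φ, hφ, -⟩ := hD.rotation_b
    obtain ⟨ψ, hψ, -⟩ := hD.rotation_r
    let E : SimpleDrawing 0 S :=
      { b := D.b
        r := D.r
        v := fun i => i.elim0
        b_ne_r := D.b_ne_r
        b_ne_v := fun i => i.elim0
        r_ne_v := fun i => i.elim0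
        v_injective := fun i => i.elim0
        blue := fun i => i.elim0
        red := fun i => i.elim0
        blue_arc := fun i => i.elim0
        red_arc := fun i => i.elim0
        r_notMem_blue := fun i => i.elim0
        b_notMem_red := fun i => i.elim0
        v_notMem_blue := fun i => i.elim0
        v_notMem_red := fun i => i.elim0
        blue_inter_blue := fun i => i.elim0
        red_inter_red := fun i => i.elim0
        blue_inter_red_self := fun i => i.elim0
        blue_inter_red := fun i => i.elim0
        crossing := fun i => i.elim0 }
    exact ⟨E, ⟨⟨φ, hφ, fun i => i.elim0, fun i => i.elim0, fun i => i.elim0, fun i => i.elim0⟩,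
      ⟨ψ, hψ, fun i => i.elim0, fun i => i.elim0, fun i => i.elim0, fun i => i.elim0⟩,
      fun i => i.elim0, fun i => i.elim0⟩⟩
  | succ N =>
    rcases h with ⟨h1, h2, h3⟩ | ⟨h1, h2, h3⟩
    · exact SimpleDrawing.exists_isLDrawing_one_of_isSeparating hD
        (SimpleDrawing.isSeparating_last hfirst h1 h2 h3)
    · exact SimpleDrawing.exists_isLDrawing_one_of_isSeparating hD
        (SimpleDrawing.isSeparating_zero hfirst h1 h2 h3)
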